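/- **Setting.** Let $d,r\ge 1$ and $I_1,\dots,I_d$ be integers. A $d$-mode tensor $\mathscr X=\sum_{k=1}^r \mathbf x_k^{(1)}\otimes\dots\otimes \mathbf x_k^{(d)}$ is given in rank-$r$ CP form, i.e. by its factors $\mathbf x^{(j)}_k\in\mathbb R^{I_j}$. For each mode $j$ let $h^{(j)}$ be a real function and let $K^{(j)}(a,b)=h^{(j)}(\|a-b\|^2)$ or $K^{(j)}(a,b)=h^{(j)}(\langle a,b\rangle)$, where $h^{(j)}$ is Lipschitz (on $[0,\infty)$ in the first case, on $\mathbb R$ in the second) and $K^{(j)}$ is a symmetric positive semidefinite kernel on $\mathbb R^m$ for every $m$. Put $K(\mathscr X,\mathscr Y)=\sum_{k,l=1}^r\prod_{j=1}^d K^{(j)}(\mathbf x^{(j)}_k,\mathbf y^{(j)}_l)$. In each choice of the mode dimensions this is a kernel; write $\|\cdot\|_K$ for the norm of its reproducing kernel Hilbert space. Let $\rho$ be a probability law of $(\mathscr X,y)$ with $y\in\{-1,1\}$ and $\|\mathbf x^{(j)}_k\|^2\le B$ for all $j,k$ almost surely. With the hinge loss $L(y,t)=\max(0,1-yt)$ put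 $\mathcal R(f)=\mathbb E\,L(y,f(\mathscr X))$, let $\mathcal R^*$ be the infimum of $\mathcal R(f)$ over all measurable $f$, and let $$D(\lambda)=\inf_f\{\mathcal R(f)-\mathcal R^*+\lambda\|f\|_K^2\},$$ the infimum being over the reproducing kernel Hilbert space of $K$ on tensors of size $I_1\times\dots\times I_d$. Assume that $D(\lambda)\le c\,\lambda^{\eta}$ for all $\lambda>0$, for some constants $c$ and $0<\eta\le 1$. Let $0<\mu<1$. **Classifier.** For $n\ge1$ and $\delta_1\in(0,\tfrac12)$ put $$\epsilon=n^{-\mu/(2d)},\qquad \lambda=n^{-\mu/(2\eta+2)},\qquad P_j=P=\Big\lceil 3\,r^{2/d}\,\epsilon^{-2}\,[\log (n/\delta_1)]^{1/d}\Big\rceil+1\quad(\epsilon^{-2}=n^{\mu/d}).$$ Let $(\mathscr X_1,y_1),\dots,(\mathscr X_n,y_n)$ be i.i.d. with law $\rho$ and, independently of them, let $\mathbf A^{(j)}$ $(1\le j\le d)$ be independent $P_j\times I_j$ matrices with independent $N(0,1/P_j)$ entries. Let $\mathbf A\circ\mathscr X$ be the tensor of size $P_1\times\dots\times P_d$ with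 factors $\mathbf A^{(j)}\mathbf x^{(j)}_k$. The random projection based support tensor machine (RPSTM) $g_n^\lambda$ is the minimizer of $$\frac1n\sum_{i=1}^n L\big(y_i,g(\mathbf A\circ\mathscr X_i)\big)+\lambda\|g\|_K^2$$ over the reproducing kernel Hilbert space of $K$ on tensors of size $P_1\times\dots\times P_d$; its risk is $\mathcal R(g_n^\lambda)=\mathbb E_{(\mathscr X,y)\sim\rho}\,L(y,g_n^\lambda(\mathbf A\circ\mathscr X))$, with $\mathbf A$ and the training set held fixed. **Proposition (hinge loss rate).** Consider the assertion that $g_n^\lambda$ exists and $$\mathcal R(g_n^\lambda)-\mathcal R^*\le C\,\sqrt{\log(2/\delta_2)}\;n^{-\mu\eta/(2\eta+2)}\quad\text{with probability at least }(1-2\delta_1)(1-\delta_2).\tag{$*$}$$ 1. There is a constant $C>0$, depending only on $d,r,(I_j),(K^{(j)}),\rho,\eta,\mu$ and in particular not on $n,\delta_1,\delta_2$, such that for every $\delta_1\in(0,\tfrac12)$ there is an $N$ such that $(*)$ holds for all $n\ge N$ and all $\delta_2\in(0,1)$. 2. For every $\delta_1\in(0,\tfrac12)$ there is a constant $C>0$,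 now allowed to depend on $\delta_1$ as well, such that $(*)$ holds for all $n\ge 1$ and all $\delta_2\in(0,1)$. -/

import Mathlib

open MeasureTheory ProbabilityTheory
open scoped ENNReal NNReal InnerProductSpace

noncomputable section

/-! ### Tensors in CP form and their random projection -/

/-- A `d`-mode tensor of size `I 0 × ⋯ × I (d-1)` given in rank-`r` CP form
`∑ k, x k 0 ⊗ ⋯ ⊗ x k (d-1)`, recorded by its factors: `x j k ∈ ℝ^(I j)` is the `k`-th factor in
mode `j`. -/
abbrev CPTensor (d r : ℕ) (I : Fin d → ℕ) : Type :=
  (j : Fin d) → Fin r → EuclideanSpace ℝ (Fin (I j))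

/-- One matrix of size `P j × I j` for every mode `j`, given by its entries. -/
abbrev ModeMatrices {d : ℕ} (P I : Fin d → ℕ) : Type :=
  (j : Fin d) → Fin (P j) → Fin (I j) → ℝ

/-- The projected tensor `[A⁽¹⁾X⁽¹⁾, …, A⁽ᵈ⁾X⁽ᵈ⁾]`: every factor of mode `j` is multiplied by the
matrix of mode `j`. -/
def project {d r : ℕ} {P I : Fin d → ℕ} (A : ModeMatrices P I) (x : CPTensor d r I) :
    CPTensor d r P :=
  fun j k => WithLp.toLp 2 ((Matrix.of (A j)).mulVec (x j k))

/-- The law of the random projection: all entries of all matrices are independent, those of the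
`P j × I j` matrix of mode `j` being centred Gaussian with variance `1 / P j`. -/
def projectionLaw {d : ℕ} (P I : Fin d → ℕ) : Measure (ModeMatrices P I) :=
  Measure.pi fun j => Measure.pi fun _ => Measure.pi fun _ => gaussianReal 0 ((P j : ℝ≥0)⁻¹)

/-! ### Kernels -/

/-- The two admissible shapes of a kernel on vectors: a function of the squared distance or a
function of the inner product. -/
inductive KernelForm
  | distance
  | innerProduct

/-- The set of values that the scalar argument of the kernel profile can take. -/
def KernelForm.range : KernelForm → Set ℝ
  | .distance => Set.Ici 0
  | .innerProduct => Set.univ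

/-- The scalar to which the profile is applied: `‖a - b‖²` or `⟪a, b⟫`. -/
def KernelForm.arg {m : ℕ} : KernelForm → EuclideanSpace ℝ (Fin m) → EuclideanSpace ℝ (Fin m) → ℝ
  | .distance, a, b => ‖a - b‖ ^ 2
  | .innerProduct, a, b => ⟪a, b⟫_ℝ

/-- A kernel on vectors of the form `h (‖a - b‖²)` or `h ⟪a, b⟫`. It is evaluated at the original
and at the projected factors, so it has to be a kernel (symmetric and positive semidefinite) in
every dimension. -/
structure ModeKernel where
  form : KernelForm
  profile : ℝ → ℝ
  posSemidef : ∀ m : ℕ, (Matrix.of fun a b : EuclideanSpace ℝ (Fin m) =>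
    profile (form.arg a b)).PosSemidef

/-- The value of the kernel. -/
def ModeKernel.eval (κ : ModeKernel) {m : ℕ} (a b : EuclideanSpace ℝ (Fin m)) : ℝ :=
  κ.profile (κ.form.arg a b)

/-- The tensor kernel `K(X, Y) = ∑_{k,l} ∏_j K⁽ʲ⁾(x_k⁽ʲ⁾, y_l⁽ʲ⁾)`. -/
def tensorKernel {d r : ℕ} (κ : Fin d → ModeKernel) {I : Fin d → ℕ} (x y : CPTensor d r I) : ℝ :=
  ∑ k, ∑ l, ∏ j, (κ j).eval (x j k) (y j l)

/-- A real kernel as a matrix of operators on `ℝ`, the format used for Mathlib's `RKHS`. -/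
def operatorKernel {X : Type} (k : X → X → ℝ) : Matrix X X (ℝ →L[ℝ] ℝ) :=
  Matrix.of fun x y => k x y • ContinuousLinearMap.id ℝ ℝ

theorem operatorKernel_posSemidef {X : Type} {k : X → X → ℝ} (hk : (Matrix.of k).PosSemidef) :
    (operatorKernel k).PosSemidef := by
  have hsymm : ∀ x y, k y x = k x y := fun x y => by
    simpa using hk.1.apply x y
  have hherm : (operatorKernel k).IsHermitian := by
    have hid : star (ContinuousLinearMap.id ℝ ℝ) = ContinuousLinearMap.id ℝ ℝ := star_one (ℝ →L[ℝ] ℝ)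
    ext x y
    simp only [operatorKernel, Matrix.conjTranspose_apply, Matrix.of_apply, star_smul, hid,
      star_trivial, hsymm x y]
  refine (RKHS.posSemidef_tfae.out 0 2).mpr (And.intro hherm fun v => ?_)
  have h := hk.2 v
  refine le_of_le_of_eq h ?_
  simp only [operatorKernel, Matrix.of_apply, RCLike.re_to_real, star_trivial]
  refine Finsupp.sum_congr fun x _ => Finsupp.sum_congr fun y _ => ?_
  simp [hsymm x y]
  ring

theorem posSemidef_of_feature {X H : Type} [NormedAddCommGroup H] [InnerProductSpace ℝ H]
    (φ : X → H) {k : X → X → ℝ} (hk : ∀ x y, k x y = ⟪φ x, φ y⟫_ℝ) :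
    (Matrix.of k).PosSemidef := by
  refine ⟨?_, fun c => ?_⟩
  · ext x y
    simp [Matrix.conjTranspose_apply, hk, real_inner_comm]
  · have h : (c.sum fun x a => c.sum fun y b => star a * Matrix.of k x y * b)
        = ⟪c.sum fun x a => a • φ x, c.sum fun x a => a • φ x⟫_ℝ := by
      simp only [Finsupp.sum, inner_sum, sum_inner, inner_smul_left, inner_smul_right,
        Matrix.of_apply, hk, star_trivial, conj_trivial]
      rw [Finset.sum_comm]
      refine Finset.sum_congr rfl fun y _ => ?_
      rw [Finset.mul_sum]
      refine Finset.sum_congr rfl fun x _ => ?_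
      ring
    rw [h]
    exact real_inner_self_nonneg

theorem prodKernel_posSemidef {d : ℕ} (κ : Fin d → ModeKernel) (I : Fin d → ℕ) :
    (Matrix.of fun a b : (j : Fin d) → EuclideanSpace ℝ (Fin (I j)) =>
      ∏ j, (κ j).eval (a j) (b j)).PosSemidef := by
  classical
  have key : ∀ s : Finset (Fin d),
      (Matrix.of fun a b : (j : Fin d) → EuclideanSpace ℝ (Fin (I j)) =>
        ∏ j ∈ s, (κ j).eval (a j) (b j)).PosSemidef := by
    intro s
    induction s using Finset.induction_on with
    | empty => exact posSemidef_of_feature (fun _ => (1 : ℝ)) (by simp)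
    | insert i s hi ih =>
      have h := (((κ i).posSemidef (I i)).submatrix
        (fun a : (j : Fin d) → EuclideanSpace ℝ (Fin (I j)) => a i)).hadamard ih
      have e : (Matrix.of fun a b : (j : Fin d) → EuclideanSpace ℝ (Fin (I j)) =>
          ∏ j ∈ insert i s, (κ j).eval (a j) (b j)) =
          ((Matrix.of fun a b : EuclideanSpace ℝ (Fin (I i)) =>
            (κ i).profile ((κ i).form.arg a b)).submatrix (fun a => a i) (fun a => a i)).hadamard
            (Matrix.of fun a b => ∏ j ∈ s, (κ j).eval (a j) (b j)) := by
        ext a b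
        rw [Matrix.of_apply, Finset.prod_insert hi]
        rfl
      rw [e]
      exact h
  exact key Finset.univ

theorem tensorKernel_posSemidef {d r : ℕ} (κ : Fin d → ModeKernel) (I : Fin d → ℕ) :
    (Matrix.of (tensorKernel (r := r) κ (I := I))).PosSemidef := by
  let p : ((j : Fin d) → EuclideanSpace ℝ (Fin (I j))) →
      ((j : Fin d) → EuclideanSpace ℝ (Fin (I j))) → ℝ := fun a b => ∏ j, (κ j).eval (a j) (b j)
  have : Fact (operatorKernel p).PosSemidef :=
    ⟨operatorKernel_posSemidef (prodKernel_posSemidef κ I)⟩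
  let φ := fun a => RKHS.kerFun (RKHS.OfKernel (operatorKernel p)) a (1 : ℝ)
  have hφ : ∀ a b, ⟪φ a, φ b⟫_ℝ = p a b := by
    intro a b
    simp only [φ]
    rw [RKHS.kerFun_inner, RKHS.kerFun_apply, RKHS.OfKernel.kernel_ofKernel]
    simp [operatorKernel]
  refine posSemidef_of_feature (fun x : CPTensor d r I => ∑ k, φ (fun j => x j k)) fun x y => ?_
  simp only [inner_sum, sum_inner, hφ, tensorKernel, p]
  rw [Finset.sum_comm]

instance tensorKernel_fact {d r : ℕ} (κ : Fin d → ModeKernel) (I : Fin d → ℕ) :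
    Fact (operatorKernel (tensorKernel (r := r) κ (I := I))).PosSemidef :=
  ⟨operatorKernel_posSemidef (tensorKernel_posSemidef κ I)⟩

/-- The reproducing kernel Hilbert space of the tensor kernel on tensors of size `I`; its elements
are functions `CPTensor d r I → ℝ`, and its norm is `‖·‖_K`. -/
abbrev TensorRKHS {d : ℕ} (r : ℕ) (κ : Fin d → ModeKernel) (I : Fin d → ℕ) : Type :=
  RKHS.OfKernel (operatorKernel (tensorKernel (r := r) κ (I := I)))

/-! ### Risks -/

/-- The hinge loss. -/
def hinge (y t : ℝ) : ℝ := max 0 (1 - y * t)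

/-- The risk `𝔼 L(y, f(X))` for the hinge loss, as an extended nonnegative number. -/
def risk {X : Type} [MeasurableSpace X] (ρ : Measure (X × ℝ)) (f : X → ℝ) : ℝ≥0∞ :=
  ∫⁻ z, ENNReal.ofReal (hinge z.2 (f z.1)) ∂ρ

/-- The Bayes risk: the infimum of the risk over all measurable functions. -/
def bayesRisk {X : Type} [MeasurableSpace X] (ρ : Measure (X × ℝ)) : ℝ≥0∞ :=
  ⨅ (f : X → ℝ) (_ : Measurable f), risk ρ f

/-- `D(lam) = inf_f { R(f) - R* + lam ‖f‖_K² }` over the reproducing kernel Hilbert space. -/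
def approxError {d r : ℕ} (κ : Fin d → ModeKernel) {I : Fin d → ℕ}
    (ρ : Measure (CPTensor d r I × ℝ)) (lam : ℝ) : ℝ≥0∞ :=
  (⨅ f : TensorRKHS r κ I, (risk ρ f + ENNReal.ofReal (lam * ‖f‖ ^ 2))) - bayesRisk ρ

/-! ### The classifier -/

/-- The regularized empirical hinge risk on the projected training set. -/
def regEmpiricalRisk {d r n : ℕ} (κ : Fin d → ModeKernel) {P I : Fin d → ℕ}
    (A : ModeMatrices P I) (T : Fin n → CPTensor d r I × ℝ) (lam : ℝ) (g : TensorRKHS r κ P) : ℝ :=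
  (1 / (n : ℝ)) * ∑ i, hinge (T i).2 (g (project A (T i).1)) + lam * ‖g‖ ^ 2

/-- `g` is the random projection based support tensor machine: it minimizes the regularized
empirical risk of the projected training set over the reproducing kernel Hilbert space. -/
def IsRPSTM {d r n : ℕ} (κ : Fin d → ModeKernel) {P I : Fin d → ℕ}
    (A : ModeMatrices P I) (T : Fin n → CPTensor d r I × ℝ) (lam : ℝ) (g : TensorRKHS r κ P) :
    Prop :=
  ∀ g' : TensorRKHS r κ P, regEmpiricalRisk κ A T lam g ≤ regEmpiricalRisk κ A T lam g'

/-- For the projection `A` and the training set `T`, the classifier exists and its excess risk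
`R(g) - R*` is at most `b`. -/
def ExcessRiskAtMost {d r n : ℕ} (κ : Fin d → ModeKernel) {P I : Fin d → ℕ}
    (ρ : Measure (CPTensor d r I × ℝ)) (A : ModeMatrices P I) (T : Fin n → CPTensor d r I × ℝ)
    (lam b : ℝ) : Prop :=
  (∃ g : TensorRKHS r κ P, IsRPSTM κ A T lam g) ∧
    ∀ g : TensorRKHS r κ P, IsRPSTM κ A T lam g →
      risk ρ (fun x => g (project A x)) ≤ bayesRisk ρ + ENNReal.ofReal b

/-- The joint law of the random projection and of an independent training set of `n` independent
observations with law `ρ`. -/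
def jointLaw {d r : ℕ} (P I : Fin d → ℕ) (ρ : Measure (CPTensor d r I × ℝ)) (n : ℕ) :
    Measure (ModeMatrices P I × (Fin n → CPTensor d r I × ℝ)) :=
  (projectionLaw P I).prod (Measure.pi fun _ => ρ)

/-! ### The choice of parameters -/

/-- `ε = (1/n)^(μ/(2d))`. -/
def projError (d : ℕ) (μ : ℝ) (n : ℕ) : ℝ := (1 / (n : ℝ)) ^ (μ / (2 * d))

/-- `lam = (1/n)^(μ/(2η+2))`. -/
def regParam (η μ : ℝ) (n : ℕ) : ℝ := (1 / (n : ℝ)) ^ (μ / (2 * η + 2))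

/-- `P = ⌈3 r^(2/d) ε⁻² [log (n/δ₁)]^(1/d)⌉ + 1`, where `ε⁻² = n^(μ/d)` for `ε = projError d μ n`. -/
def projDim (d r : ℕ) (μ δ₁ : ℝ) (n : ℕ) : ℕ :=
  ⌈3 * (r : ℝ) ^ (2 / (d : ℝ)) * (projError d μ n ^ 2)⁻¹ *
    (Real.log (n / δ₁)) ^ (1 / (d : ℝ))⌉₊ + 1

/-- With probability at least `(1 - 2δ₁)(1 - δ₂)`, the excess risk of the classifier is at most
`C √(log (2/δ₂)) (1/n)^(μη/(2η+2))`. The bound is put on the outer measure of the exceptional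
set, so that no measurability of this set is presupposed. -/
def HingeRateHolds {d r : ℕ} (κ : Fin d → ModeKernel) {I : Fin d → ℕ}
    (ρ : Measure (CPTensor d r I × ℝ)) (η μ C δ₁ δ₂ : ℝ) (n : ℕ) : Prop :=
  jointLaw (fun _ => projDim d r μ δ₁ n) I ρ n
    {ω | ¬ ExcessRiskAtMost κ ρ ω.1 ω.2 (regParam η μ n)
      (C * √(Real.log (2 / δ₂)) * (1 / (n : ℝ)) ^ (μ * η / (2 * η + 2)))}
    ≤ ENNReal.ofReal (1 - (1 - 2 * δ₁) * (1 - δ₂))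

end

/-! The comparison between the original and the projected problem is one-sided and runs through the
dual of the support vector machine. Estimating the difference of the two kernels by Lipschitz
continuity would give an error of order `ε`. After division by `lam` this is too large when `d > 1`,
because the rate requires `ε ^ d / lam`. Instead, every kernel matrix `K` of the original data is
dominated by the projected one `K'`: `K ≤ C K' + E` in the Loewner order, with `E` positive
semidefinite and with diagonal at most `C * gaussianTail ε`, which is `O(ε ^ d)`.

For a Gaussian kernel the domination is a comparison of spectral measures. The density of `N(0, 1)`
is at most 6 times that of `N(0, σ)` for `|σ - 1| ≤ ε`, except where `g ^ 2 > 1 / ε`; the part left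
over has tiny mass. Diagonalizing `TᵀT` and taking Schur products gives
`exists_isDominated_gaussian` for a near isometry `T`. A continuous function of the squared distance
that is a kernel in every dimension is a limit of mixtures of exponentials (`exists_exp_mixture`),
so it inherits the domination. A Lipschitz function of the inner product that is a kernel in every
dimension is affine (`IsProfile.innerProduct_affine`), where domination is immediate. Schur products
combine the modes (`exists_isDominated_prod`).

The dual objective is `∑ α - ‖∑ α u‖² / (4 lam)`. Hence the optimal projected objective is at most
that of any `f` on the original data with `C * lam` in place of `lam`, plus `O(ε ^ d / lam)`
(`exists_svmObjective_project_le`). The factor `C` only changes the constant in `D(C lam) ≤ c (C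
lam) ^ η`.

Passing from empirical to true risk costs `O(1 / (lam √n))` times `√(log (2 / δ₂))`. Strong
convexity makes the machine stable under the change of one observation, and a bounded differences
inequality applies.

The matrices are near isometries of the fixed spaces `ℝ^(I j)` except with probability `O(1 / (P
ε²))`, by Chebyshev. Since `P ε² ≥ (log n)^(1/d) → ∞`, this is below `2 δ₁` from some `N` depending
on `δ₁`. The finitely many `n < N` are absorbed into a constant that depends on `δ₁`, by means of a
crude risk bound. -/

noncomputable section

/-! ### Support vector machines in an inner product space -/

section SVM

variable {H : Type*} [NormedAddCommGroup H] [InnerProductSpace ℝ H]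

/-- The regularized empirical hinge risk of `g` on the label-weighted feature vectors `u`. -/
def svmObjective {n : ℕ} (lam : ℝ) (u : Fin n → H) (g : H) : ℝ :=
  (1 / (n : ℝ)) * ∑ i, hinge 1 ⟪u i, g⟫_ℝ + lam * ‖g‖ ^ 2

/-- `g` minimizes the regularized empirical hinge risk. -/
def IsSVM {n : ℕ} (lam : ℝ) (u : Fin n → H) (g : H) : Prop :=
  ∀ g', svmObjective lam u g ≤ svmObjective lam u g'

theorem hinge_nonneg (y t : ℝ) : 0 ≤ hinge y t := le_max_left _ _

theorem one_sub_mul_le_hinge (y t : ℝ) : 1 - y * t ≤ hinge y t := le_max_right _ _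

theorem hinge_zero (y : ℝ) : hinge y 0 = 1 := by simp [hinge]

theorem hinge_one_mul (y t : ℝ) : hinge 1 (y * t) = hinge y t := by simp [hinge]

theorem abs_hinge_one_sub_le (s t : ℝ) : |hinge 1 s - hinge 1 t| ≤ |s - t| := by
  have h := abs_max_sub_max_le_abs (1 - s) (1 - t) 0
  simp only [hinge, one_mul, max_comm (0 : ℝ)]
  refine h.trans (le_of_eq ?_)
  rw [abs_sub_comm]
  congr 1
  ring

theorem hinge_one_le (t : ℝ) : hinge 1 t ≤ 1 + |t| := by
  refine max_le (by positivity) ?_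
  have := neg_abs_le t
  linarith

theorem continuous_hinge_one : Continuous (hinge 1) := by
  unfold hinge
  fun_prop

theorem hinge_one_convex (s t b : ℝ) (hb : 0 ≤ b) (hb' : b ≤ 1) :
    hinge 1 ((1 - b) * s + b * t) ≤ (1 - b) * hinge 1 s + b * hinge 1 t := by
  have h1 := mul_le_mul_of_nonneg_left (one_sub_mul_le_hinge 1 s) (sub_nonneg.2 hb')
  have h2 := mul_le_mul_of_nonneg_left (one_sub_mul_le_hinge 1 t) hb
  have h3 := mul_nonneg (sub_nonneg.2 hb') (hinge_nonneg 1 s)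
  have h4 := mul_nonneg hb (hinge_nonneg 1 t)
  refine max_le (by linarith) ?_
  linarith

/-- Divide by `β` and let `β → 0`. First-order optimality along a segment is extracted in this form,
so no derivative of the hinge loss is needed. -/
theorem nonpos_of_forall_mul_le_sq_mul {a b : ℝ}
    (h : ∀ β : ℝ, 0 < β → β ≤ 1 → β * a ≤ β ^ 2 * b) : a ≤ 0 := by
  by_contra! ha
  have hb : 0 < |b| + 1 := by positivity
  have hβ : 0 < min 1 (a / (2 * (|b| + 1))) := lt_min one_pos (by positivity)
  have h1 := h _ hβ (min_le_left _ _)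
  set β := min 1 (a / (2 * (|b| + 1)))
  have h2 : a ≤ β * b := by
    have : β * a ≤ β * (β * b) := by linarith [h1, sq β]
    exact le_of_mul_le_mul_left this hβ
  have h3 : β * b ≤ β * (|b| + 1) :=
    mul_le_mul_of_nonneg_left (by linarith [le_abs_self b]) hβ.le
  have h4 : β * (|b| + 1) ≤ a / (2 * (|b| + 1)) * (|b| + 1) :=
    mul_le_mul_of_nonneg_right (min_le_right _ _) hb.le
  have h5 : a / (2 * (|b| + 1)) * (|b| + 1) = a / 2 := by field_simp
  linarith

/-- The dual problem of the support vector machine has a solution, and it gives a primal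
candidate with the same value. -/
theorem exists_dual {n : ℕ} {lam : ℝ} (hlam : 0 < lam) (u : Fin n → H) :
    ∃ (α : Fin n → ℝ) (g : H), (∀ i, 0 ≤ α i ∧ α i ≤ 1 / n) ∧
      svmObjective lam u g = ∑ i, α i - 1 / (4 * lam) * ‖∑ i, α i • u i‖ ^ 2 := by
  classical
  let W : (Fin n → ℝ) → ℝ := fun α => ∑ i, α i - 1 / (4 * lam) * ‖∑ i, α i • u i‖ ^ 2
  have hc : IsCompact (Set.pi Set.univ fun _ : Fin n => Set.Icc (0 : ℝ) (1 / n)) :=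
    isCompact_univ_pi fun _ => isCompact_Icc
  have hne : (Set.pi Set.univ fun _ : Fin n => Set.Icc (0 : ℝ) (1 / n)).Nonempty :=
    ⟨fun _ => 0, fun i _ => ⟨le_rfl, by positivity⟩⟩
  have hW : Continuous W := by fun_prop
  obtain ⟨α, hα, hmax⟩ := hc.exists_isMaxOn hne hW.continuousOn
  have hα' : ∀ i, 0 ≤ α i ∧ α i ≤ 1 / n := fun i => hα i (Set.mem_univ i)
  set s := ∑ i, α i • u i with hs
  -- This is the stationary point in `g` of the Lagrangian with multipliers `α`.
  let g : H := (1 / (2 * lam)) • s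
  refine ⟨α, g, hα', ?_⟩
  have hinner : ∀ i, ⟪u i, g⟫_ℝ = 1 / (2 * lam) * ⟪s, u i⟫_ℝ := fun i => by
    simp only [g, inner_smul_right, real_inner_comm]
  -- First-order optimality of `α` in its `i`-th coordinate: `1 - ⟪u i, g⟫` is the partial
  -- derivative of `W`, tested by moving `α i` a fraction `β` of the way to `τ`.
  have hvar : ∀ (i : Fin n) (τ : ℝ), 0 ≤ τ → τ ≤ 1 / n → (τ - α i) * (1 - ⟪u i, g⟫_ℝ) ≤ 0 := by
    intro i τ h0 h1
    refine nonpos_of_forall_mul_le_sq_mul (b := (τ - α i) ^ 2 * ‖u i‖ ^ 2 / (4 * lam))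
      fun β hβ hβ' => ?_
    set δ := β * (τ - α i) with hδ
    have hmem : Function.update α i (α i + δ) ∈
        Set.pi Set.univ fun _ : Fin n => Set.Icc (0 : ℝ) (1 / n) := by
      intro j _
      by_cases hj : j = i
      · subst hj
        have e : α j + δ = (1 - β) * α j + β * τ := by rw [hδ]; ring
        have hp := hα' j
        simp only [Function.update_self, e]
        constructor
        · have := mul_nonneg (sub_nonneg.2 hβ') hp.1
          have := mul_nonneg hβ.le h0
          linarith
        · have := mul_le_mul_of_nonneg_left hp.2 (sub_nonneg.2 hβ')
          have := mul_le_mul_of_nonneg_left h1 hβ.le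
          linarith
      · simpa [hj] using hα' j
    have hle : W (Function.update α i (α i + δ)) ≤ W α := hmax hmem
    have e0 : Function.update α i (α i + δ) = α + Pi.single i δ := by
      ext j
      by_cases hj : j = i
      · subst hj; simp
      · simp [hj]
    have e1 : ∑ j, (α + Pi.single i δ : Fin n → ℝ) j = ∑ j, α j + δ := by
      simp [Finset.sum_add_distrib]
    have e2 : ∑ j, (α + Pi.single i δ : Fin n → ℝ) j • u j = s + δ • u i := by
      simp [add_smul, Finset.sum_add_distrib, hs, Pi.single_apply, ite_smul]
    simp only [W, e0, e1, e2, ← hs] at hle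
    rw [norm_add_sq_real, norm_smul, mul_pow, inner_smul_right, Real.norm_eq_abs, sq_abs] at hle
    rw [hinner]
    have e3 : δ ^ 2 = β ^ 2 * (τ - α i) ^ 2 := by rw [hδ]; ring
    rw [e3] at hle
    have e4 : β * ((τ - α i) * (1 - 1 / (2 * lam) * ⟪s, u i⟫_ℝ))
        = δ - 1 / (4 * lam) * (2 * (δ * ⟪s, u i⟫_ℝ)) := by rw [hδ]; field_simp; ring
    rw [e4]
    have e5 : β ^ 2 * ((τ - α i) ^ 2 * ‖u i‖ ^ 2 / (4 * lam)) =
      1 / (4 * lam) * (β ^ 2 * (τ - α i) ^ 2 * ‖u i‖ ^ 2) := by field_simp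
    rw [e5]
    linarith
  -- Complementary slackness: the endpoints `τ = 0` and `τ = 1 / n` force `α i` to the end of its
  -- interval determined by the sign of the margin defect.
  have hslack : ∀ i, 1 / (n : ℝ) * hinge 1 ⟪u i, g⟫_ℝ = α i * (1 - ⟪u i, g⟫_ℝ) := by
    intro i
    have h0 := hvar i 0 le_rfl (by positivity)
    have h1 := hvar i (1 / n) (by positivity) le_rfl
    have hp := hα' i
    simp only [hinge, one_mul]
    rcases lt_trichotomy (1 - ⟪u i, g⟫_ℝ) 0 with hm | hm | hm
    · rw [max_eq_left hm.le]
      have : α i = 0 := by nlinarith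
      simp [this]
    · simp [hm]
    · rw [max_eq_right hm.le]
      have : α i = 1 / n := by nlinarith
      rw [this]
  have hsum : ∑ i, α i * ⟪u i, g⟫_ℝ = 1 / (2 * lam) * ‖s‖ ^ 2 := by
    have : ∑ i, α i * ⟪u i, g⟫_ℝ = ⟪s, g⟫_ℝ := by
      simp [hs, sum_inner, inner_smul_left]
    rw [this]
    simp [g, inner_smul_right]
  have hg : ‖g‖ ^ 2 = (1 / (2 * lam)) ^ 2 * ‖s‖ ^ 2 := by
    simp only [g, norm_smul, mul_pow, Real.norm_eq_abs, sq_abs]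
  rw [svmObjective, Finset.mul_sum, Finset.sum_congr rfl fun i _ => hslack i, hg]
  simp only [mul_sub, mul_one, Finset.sum_sub_distrib, hsum]
  field_simp
  ring

/-- Bound `1 - t` by the hinge loss and use Young's inequality on `⟪∑ α u, f⟫`. The multipliers are
only required to be feasible, so those of one problem can be inserted into another with different
features and a different `lam`. -/
theorem weak_duality {n : ℕ} {lam : ℝ} (hlam : 0 < lam) (u : Fin n → H) (f : H)
    {α : Fin n → ℝ} (hα : ∀ i, 0 ≤ α i ∧ α i ≤ 1 / n) :
    ∑ i, α i - 1 / (4 * lam) * ‖∑ i, α i • u i‖ ^ 2 ≤ svmObjective lam u f := by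
  have h1 : ∑ i, α i * (1 - ⟪u i, f⟫_ℝ) ≤ (1 / (n : ℝ)) * ∑ i, hinge 1 ⟪u i, f⟫_ℝ := by
    rw [Finset.mul_sum]
    refine Finset.sum_le_sum fun i _ => ?_
    calc α i * (1 - ⟪u i, f⟫_ℝ) ≤ α i * hinge 1 ⟪u i, f⟫_ℝ :=
          mul_le_mul_of_nonneg_left (by simpa using one_sub_mul_le_hinge 1 ⟪u i, f⟫_ℝ) (hα i).1
      _ ≤ _ := mul_le_mul_of_nonneg_right (hα i).2 (hinge_nonneg _ _)
  have h2 : ∑ i, α i * (1 - ⟪u i, f⟫_ℝ) = ∑ i, α i - ⟪∑ i, α i • u i, f⟫_ℝ := by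
    simp [mul_sub, sum_inner, inner_smul_left]
  set s := ∑ i, α i • u i
  have h3 := real_inner_le_norm s f
  have h4 : ‖s‖ * ‖f‖ ≤ 1 / (4 * lam) * ‖s‖ ^ 2 + lam * ‖f‖ ^ 2 := by
    have : 0 ≤ (‖s‖ - 2 * lam * ‖f‖) ^ 2 / (4 * lam) := by positivity
    have e : (‖s‖ - 2 * lam * ‖f‖) ^ 2 / (4 * lam)
        = 1 / (4 * lam) * ‖s‖ ^ 2 + lam * ‖f‖ ^ 2 - ‖s‖ * ‖f‖ := by field_simp; ring
    linarith
  rw [svmObjective]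
  linarith

theorem exists_isSVM {n : ℕ} {lam : ℝ} (hlam : 0 < lam) (u : Fin n → H) :
    ∃ g, IsSVM lam u g := by
  obtain ⟨α, g, hα, hg⟩ := exists_dual hlam u
  exact ⟨g, fun g' => hg.trans_le (weak_duality hlam u g' hα)⟩

/-- Strong convexity of the quadratic penalty: compare `g` with points of the segment to `g'` and
let them tend to `g`. -/
theorem IsSVM.add_sq_norm_sub_le {n : ℕ} {lam : ℝ} {u : Fin n → H} {g : H}
    (hg : IsSVM lam u g) (g' : H) :
    svmObjective lam u g + lam * ‖g' - g‖ ^ 2 ≤ svmObjective lam u g' := by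
  rw [← sub_nonpos]
  refine nonpos_of_forall_mul_le_sq_mul (b := lam * ‖g' - g‖ ^ 2) fun β hβ hβ' => ?_
  have h := hg (g + β • (g' - g))
  have hnorm : ‖g + β • (g' - g)‖ ^ 2 =
      (1 - β) * ‖g‖ ^ 2 + β * ‖g'‖ ^ 2 - β * (1 - β) * ‖g' - g‖ ^ 2 := by
    rw [norm_add_sq_real, norm_smul, mul_pow, inner_smul_right, Real.norm_eq_abs, sq_abs,
      norm_sub_sq_real, inner_sub_right, real_inner_self_eq_norm_sq, real_inner_comm g]
    ring
  have hhinge : (1 / (n : ℝ)) * ∑ i, hinge 1 ⟪u i, g + β • (g' - g)⟫_ℝ ≤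
      (1 - β) * ((1 / (n : ℝ)) * ∑ i, hinge 1 ⟪u i, g⟫_ℝ) +
      β * ((1 / (n : ℝ)) * ∑ i, hinge 1 ⟪u i, g'⟫_ℝ) := by
    have : ∑ i, hinge 1 ⟪u i, g + β • (g' - g)⟫_ℝ ≤
        (1 - β) * ∑ i, hinge 1 ⟪u i, g⟫_ℝ + β * ∑ i, hinge 1 ⟪u i, g'⟫_ℝ := by
      rw [Finset.mul_sum, Finset.mul_sum, ← Finset.sum_add_distrib]
      refine Finset.sum_le_sum fun i _ => ?_
      refine le_trans (le_of_eq ?_) (hinge_one_convex _ _ β hβ.le hβ')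
      rw [inner_add_right, inner_smul_right, inner_sub_right]
      congr 1
      ring
    have h0 : (0 : ℝ) ≤ 1 / n := by positivity
    nlinarith [mul_le_mul_of_nonneg_left this h0]
  simp only [svmObjective, hnorm] at h ⊢
  nlinarith

theorem IsSVM.norm_sq_le {n : ℕ} {lam : ℝ} {u : Fin n → H} {g : H}
    (hg : IsSVM lam u g) : lam * ‖g‖ ^ 2 ≤ 1 ∧ svmObjective lam u g ≤ 1 := by
  have h0 : svmObjective lam u 0 ≤ 1 := by
    simp only [svmObjective, inner_zero_right, hinge_zero]
    simp only [Finset.sum_const, Finset.card_univ, Fintype.card_fin, nsmul_eq_mul, mul_one,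
      norm_zero]
    rcases Nat.eq_zero_or_pos n with h | h
    · subst h; simp
    · have : (n : ℝ) ≠ 0 := by positivity
      field_simp
      simp
  have h1 : 0 ≤ (1 / (n : ℝ)) * ∑ i, hinge 1 ⟪u i, g⟫_ℝ :=
    mul_nonneg (by positivity) (Finset.sum_nonneg fun _ _ => hinge_nonneg _ _)
  have h2 := hg 0
  refine ⟨?_, h2.trans h0⟩
  have := h2.trans h0
  rw [svmObjective] at this
  linarith

theorem IsSVM.norm_le {n : ℕ} {lam : ℝ} (hlam : 0 < lam) {u : Fin n → H} {g : H}
    (hg : IsSVM lam u g) : ‖g‖ ≤ 1 / √lam := by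
  have h := hg.norm_sq_le.1
  rw [le_div_iff₀ (Real.sqrt_pos.2 hlam)]
  refine le_of_sq_le_sq ?_ zero_le_one
  rw [mul_pow, Real.sq_sqrt hlam.le]
  linarith

/-! ### Uniqueness and stability of the minimizer. -/

theorem IsSVM.eq {n : ℕ} {lam : ℝ} (hlam : 0 < lam) {u : Fin n → H} {g g' : H}
    (hg : IsSVM lam u g) (hg' : IsSVM lam u g') : g = g' := by
  have h := hg.add_sq_norm_sub_le g'
  have h2 := hg' g
  have h3 : lam * ‖g' - g‖ ^ 2 ≤ 0 := by linarith
  have h4 : ‖g' - g‖ ^ 2 ≤ 0 := by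
    by_contra! hh
    exact absurd h3 (not_le.2 (mul_pos hlam hh))
  have h5 : ‖g' - g‖ = 0 := by
    have := sq_nonneg ‖g' - g‖
    exact pow_eq_zero_iff (two_ne_zero) |>.1 (le_antisymm h4 this)
  exact (sub_eq_zero.1 (norm_eq_zero.1 h5)).symm

/-- When the two strong convexity inequalities are added, the penalties cancel and only differences
of losses remain. Both the stability under replacement of an observation and the continuity in the
data follow from this. -/
theorem IsSVM.two_mul_sq_norm_sub_le {n : ℕ} {lam : ℝ} {u u' : Fin n → H} {g g' : H}
    (hg : IsSVM lam u g) (hg' : IsSVM lam u' g') :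
    2 * lam * ‖g - g'‖ ^ 2 ≤ (1 / (n : ℝ)) * ∑ i, ((hinge 1 ⟪u i, g'⟫_ℝ - hinge 1 ⟪u i, g⟫_ℝ) +
      (hinge 1 ⟪u' i, g⟫_ℝ - hinge 1 ⟪u' i, g'⟫_ℝ)) := by
  have h1 := hg.add_sq_norm_sub_le g'
  have h2 := hg'.add_sq_norm_sub_le g
  rw [norm_sub_rev] at h1
  simp only [svmObjective] at h1 h2
  simp only [Finset.sum_add_distrib, Finset.sum_sub_distrib]
  linarith

/-- Replacing one observation moves the minimizer by at most `κ / (lam n)`. -/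
theorem IsSVM.norm_sub_update_le {n : ℕ} {lam : ℝ} (hlam : 0 < lam) {u : Fin n → H}
    {i : Fin n} {v : H} {g g' : H} {κ : ℝ} (hui : ‖u i‖ ≤ κ) (hv : ‖v‖ ≤ κ)
    (hg : IsSVM lam u g) (hg' : IsSVM lam (Function.update u i v) g') :
    ‖g - g'‖ ≤ κ / (lam * n) := by
  classical
  have hn : (0 : ℝ) < n := by exact_mod_cast i.pos
  have h := hg.two_mul_sq_norm_sub_le hg'
  have hlip : ∀ w : H, ‖w‖ ≤ κ → ∀ a b : H,
      hinge 1 ⟪w, a⟫_ℝ - hinge 1 ⟪w, b⟫_ℝ ≤ κ * ‖a - b‖ := by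
    intro w hw a b
    refine (le_abs_self _).trans ((abs_hinge_one_sub_le _ _).trans ?_)
    rw [← inner_sub_right]
    exact (abs_real_inner_le_norm _ _).trans (mul_le_mul_of_nonneg_right hw (norm_nonneg _))
  have hs : ∑ j, ((hinge 1 ⟪u j, g'⟫_ℝ - hinge 1 ⟪u j, g⟫_ℝ) +
      (hinge 1 ⟪Function.update u i v j, g⟫_ℝ - hinge 1 ⟪Function.update u i v j, g'⟫_ℝ)) ≤
      2 * κ * ‖g - g'‖ := by
    -- For an observation common to both samples the two differences cancel, so only index `i`
    -- contributes.
    rw [Finset.sum_eq_single i]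
    · have h1 := hlip (u i) hui g' g
      have h2 := hlip v hv g g'
      rw [norm_sub_rev] at h1
      simp only [Function.update_self]
      linarith
    · intro j _ hj
      simp [hj]
    · simp
  have hκ : 0 ≤ κ := (norm_nonneg v).trans hv
  have h3 : 2 * lam * ‖g - g'‖ ^ 2 ≤ 1 / n * (2 * κ * ‖g - g'‖) :=
    h.trans (mul_le_mul_of_nonneg_left hs (by positivity))
  rcases (norm_nonneg (g - g')).eq_or_lt with h0 | h0
  · rw [← h0]; positivity
  · rw [le_div_iff₀ (by positivity)]
    have h4 : lam * ‖g - g'‖ ≤ 1 / n * κ := by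
      refine le_of_mul_le_mul_right ?_ h0
      nlinarith
    have h5 := mul_le_mul_of_nonneg_right h4 hn.le
    have h6 : 1 / (n : ℝ) * κ * n = κ := by field_simp
    linarith

/-- The minimizer of the regularized empirical hinge risk. -/
def svm {n : ℕ} (lam : ℝ) (u : Fin n → H) : H :=
  open Classical in if h : ∃ g, IsSVM lam u g then h.choose else 0

theorem isSVM_svm {n : ℕ} {lam : ℝ} (hlam : 0 < lam) (u : Fin n → H) : IsSVM lam u (svm lam u) := by
  have h := exists_isSVM hlam u
  simp only [svm, h, dif_pos]
  exact h.choose_spec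

/-- Continuity makes the loss of the trained machine jointly measurable in the projection, the
sample and the test point, as needed for Fubini and for the concentration inequality. -/
theorem continuous_svm {n : ℕ} {lam : ℝ} (hlam : 0 < lam) :
    Continuous (svm lam : (Fin n → H) → H) := by
  refine continuous_iff_continuousAt.2 fun u => ?_
  rw [ContinuousAt, tendsto_iff_norm_sub_tendsto_zero]
  have hb : ∀ u', ‖svm lam u' - svm lam u‖ ^ 2 ≤
      1 / (lam * √lam) * ((1 / (n : ℝ)) * ∑ i, ‖u' i - u i‖) := by
    intro u'
    have h := (isSVM_svm hlam u').two_mul_sq_norm_sub_le (isSVM_svm hlam u)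
    set g := svm lam u
    set g' := svm lam u'
    have hg : ‖g‖ ≤ 1 / √lam := (isSVM_svm hlam u).norm_le hlam
    have hg' : ‖g'‖ ≤ 1 / √lam := (isSVM_svm hlam u').norm_le hlam
    have hlip : ∀ (a w w' : H), ‖a‖ ≤ 1 / √lam →
        hinge 1 ⟪w, a⟫_ℝ - hinge 1 ⟪w', a⟫_ℝ ≤ ‖w - w'‖ * (1 / √lam) := by
      intro a w w' ha
      refine (le_abs_self _).trans ((abs_hinge_one_sub_le _ _).trans ?_)
      rw [← inner_sub_left]
      exact (abs_real_inner_le_norm _ _).trans (mul_le_mul_of_nonneg_left ha (norm_nonneg _))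
    have hs : ∑ i, ((hinge 1 ⟪u' i, g⟫_ℝ - hinge 1 ⟪u' i, g'⟫_ℝ) +
        (hinge 1 ⟪u i, g'⟫_ℝ - hinge 1 ⟪u i, g⟫_ℝ)) ≤
        ∑ i, 2 * (1 / √lam) * ‖u' i - u i‖ := by
      refine Finset.sum_le_sum fun i _ => ?_
      have h1 := hlip g (u' i) (u i) hg
      have h2 := hlip g' (u i) (u' i) hg'
      rw [norm_sub_rev] at h2
      linarith
    rw [← Finset.mul_sum] at hs
    have h3 := h.trans (mul_le_mul_of_nonneg_left hs (by positivity : (0 : ℝ) ≤ 1 / n))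
    have h4 : ‖g' - g‖ ^ 2 ≤ (1 / n * (2 * (1 / √lam) * ∑ i, ‖u' i - u i‖)) / (2 * lam) := by
      rw [le_div_iff₀ (by positivity)]
      linarith
    refine h4.trans (le_of_eq ?_)
    have : √lam ≠ 0 := (Real.sqrt_pos.2 hlam).ne'
    rcases Nat.eq_zero_or_pos n with h | h
    · subst h; simp
    field_simp
  have ht : Filter.Tendsto (fun u' : Fin n → H => √(1 / (lam * √lam) *
      ((1 / (n : ℝ)) * ∑ i, ‖u' i - u i‖))) (nhds u) (nhds 0) := by
    have hc : Continuous fun u' : Fin n → H => √(1 / (lam * √lam) *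
      ((1 / (n : ℝ)) * ∑ i, ‖u' i - u i‖)) := by fun_prop
    have := hc.tendsto u
    simpa using this
  refine squeeze_zero (fun _ => norm_nonneg _) (fun u' => ?_) ht
  exact Real.le_sqrt_of_sq_le (hb u')

end SVM

/-! ### The bounded differences inequality -/

section BoundedDifferences

variable {Ω : Type*} [MeasurableSpace Ω] (ρ : Measure Ω) [IsProbabilityMeasure ρ]

theorem measurable_finCons {n : ℕ} :
    Measurable fun p : Ω × (Fin n → Ω) => (Fin.cons p.1 p.2 : Fin (n + 1) → Ω) := by
  refine measurable_pi_iff.2 fun i => ?_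
  refine Fin.cases ?_ (fun j => ?_) i
  · simpa using measurable_fst
  · exact (measurable_pi_apply j).comp measurable_snd

theorem measurePreserving_finCons (n : ℕ) :
    MeasurePreserving (fun p : Ω × (Fin n → Ω) => (Fin.cons p.1 p.2 : Fin (n + 1) → Ω))
      (ρ.prod (Measure.pi fun _ => ρ)) (Measure.pi fun _ => ρ) := by
  have h := (measurePreserving_piFinSuccAbove (fun _ : Fin (n + 1) => ρ) 0).symm
  convert h using 1
  ext p i
  simp [MeasurableEquiv.piFinSuccAbove, Fin.insertNthEquiv]

theorem integrable_of_measurable_of_abs_le {α : Type*} [MeasurableSpace α] {m : Measure α}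
    [IsFiniteMeasure m] {f : α → ℝ} (hf : Measurable f) {M : ℝ} (hM : ∀ x, |f x| ≤ M) :
    Integrable f m :=
  Integrable.of_bound hf.aestronglyMeasurable M (Filter.Eventually.of_forall hM)

theorem integral_pi_succ {n : ℕ} {f : (Fin (n + 1) → Ω) → ℝ} (hf : Measurable f) {M : ℝ}
    (hM : ∀ T, |f T| ≤ M) :
    ∫ T, f T ∂(Measure.pi fun _ => ρ) =
      ∫ z, ∫ T, f (Fin.cons z T) ∂(Measure.pi fun _ : Fin n => ρ) ∂ρ := by
  rw [← (measurePreserving_finCons ρ n).map_eq, integral_map measurable_finCons.aemeasurable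
    hf.aestronglyMeasurable, integral_prod]
  exact integrable_of_measurable_of_abs_le (hf.comp measurable_finCons) fun p => hM _

/-- Induction on `n`: condition on the first observation `z`. Its conditional mean `g z` deviates
from the total mean by at most `c`, so Hoeffding's lemma on `[-c, c]` handles `g`, and the induction
hypothesis handles the other coordinates. -/
theorem integral_exp_le_of_bounded_differences {c M : ℝ} (s : ℝ) {n : ℕ} {f : (Fin n → Ω) → ℝ}
    (hf : Measurable f) (hM : ∀ T, |f T| ≤ M)
    (hdiff : ∀ T i z, |f T - f (Function.update T i z)| ≤ c) :
    ∫ T, Real.exp (s * (f T - ∫ T', f T' ∂(Measure.pi fun _ => ρ))) ∂(Measure.pi fun _ => ρ) ≤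
      Real.exp (n * c ^ 2 * s ^ 2 / 2) := by
  induction n with
  | zero =>
    rw [Measure.pi_of_empty (fun _ : Fin 0 => ρ)]
    simp
  | succ n ih =>
    have hfz : ∀ z, Measurable fun T : Fin n → Ω => f (Fin.cons z T) := fun z =>
      hf.comp (measurable_finCons.comp measurable_prodMk_left)
    set m := ∫ T, f T ∂(Measure.pi fun _ => ρ) with hm
    let g : Ω → ℝ := fun z => ∫ T, f (Fin.cons z T) ∂(Measure.pi fun _ : Fin n => ρ)
    have hgm : Measurable g := by
      have : StronglyMeasurable (fun p : Ω × (Fin n → Ω) => f (Fin.cons p.1 p.2)) :=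
        (hf.comp measurable_finCons).stronglyMeasurable
      exact this.integral_prod_right.measurable
    have hint : ∀ z, Integrable (fun T : Fin n → Ω => f (Fin.cons z T))
        (Measure.pi fun _ => ρ) := fun z =>
      integrable_of_measurable_of_abs_le (hfz z) fun T => hM _
    have hgM : ∀ z, |g z| ≤ M := by
      intro z
      have h := norm_integral_le_of_norm_le_const (μ := Measure.pi fun _ : Fin n => ρ)
        (f := fun T : Fin n → Ω => f (Fin.cons z T)) (C := M)
        (Filter.Eventually.of_forall fun T => hM _)
      simpa using h
    have hgi : Integrable g ρ := integrable_of_measurable_of_abs_le hgm hgM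
    have hmg : m = ∫ z, g z ∂ρ := integral_pi_succ ρ hf hM
    have hgg : ∀ z z', |g z - g z'| ≤ c := by
      intro z z'
      simp only [g]
      rw [← integral_sub (hint z) (hint z')]
      have h := norm_integral_le_of_norm_le_const (μ := Measure.pi fun _ : Fin n => ρ)
        (f := fun T : Fin n → Ω => f (Fin.cons z T) - f (Fin.cons z' T)) (C := c)
        (Filter.Eventually.of_forall fun T => by
          have := hdiff (Fin.cons z T) 0 z'
          rwa [Fin.update_cons_zero] at this)
      simpa using h
    have hgmean : ∀ z, |g z - m| ≤ c := by
      intro z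
      have e : g z - m = ∫ z', (g z - g z') ∂ρ := by
        rw [integral_sub (integrable_const _) hgi, ← hmg]
        simp
      rw [e]
      have h := norm_integral_le_of_norm_le_const (μ := ρ) (f := fun z' => g z - g z') (C := c)
        (Filter.Eventually.of_forall fun z' => hgg z z')
      simpa using h
    have hoeff : ∫ z, Real.exp (s * (g z - m)) ∂ρ ≤ Real.exp (c ^ 2 * s ^ 2 / 2) := by
      have h := hasSubgaussianMGF_of_mem_Icc_of_integral_eq_zero (μ := ρ) (X := fun z => g z - m)
        (a := -c) (b := c) (hgm.sub_const m).aemeasurable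
        (Filter.Eventually.of_forall fun z => abs_le.1 (hgmean z))
        (by rw [integral_sub hgi (integrable_const _), ← hmg]; simp)
      have h2 := h.mgf_le s
      simp only [mgf] at h2
      refine h2.trans (le_of_eq ?_)
      congr 1
      push_cast
      rw [Real.norm_eq_abs, div_pow, sq_abs]
      ring
    have hexp : ∀ T, |Real.exp (s * (f T - m))| ≤ Real.exp (|s| * (M + |m|)) := by
      intro T
      rw [abs_of_pos (Real.exp_pos _)]
      refine Real.exp_le_exp.2 ((le_abs_self _).trans ?_)
      rw [abs_mul]
      refine mul_le_mul_of_nonneg_left ?_ (abs_nonneg _)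
      exact (abs_sub _ _).trans (by linarith [hM T])
    rw [integral_pi_succ ρ (by fun_prop) hexp]
    have hin : ∀ z, ∫ T, Real.exp (s * (f (Fin.cons z T) - m)) ∂(Measure.pi fun _ : Fin n => ρ) ≤
        Real.exp (s * (g z - m)) * Real.exp (n * c ^ 2 * s ^ 2 / 2) := by
      intro z
      have h := ih (f := fun T => f (Fin.cons z T)) (hfz z) (fun T => hM _) (fun T i v => by
        have := hdiff (Fin.cons z T) i.succ v
        rwa [← Fin.cons_update] at this)
      have e : ∀ T : Fin n → Ω, Real.exp (s * (f (Fin.cons z T) - m)) =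
          Real.exp (s * (g z - m)) * Real.exp (s * (f (Fin.cons z T) - g z)) := by
        intro T
        rw [← Real.exp_add]
        congr 1
        ring
      simp only [e]
      rw [integral_const_mul]
      exact mul_le_mul_of_nonneg_left h (Real.exp_pos _).le
    calc ∫ z, ∫ T, Real.exp (s * (f (Fin.cons z T) - m)) ∂(Measure.pi fun _ : Fin n => ρ) ∂ρ
        ≤ ∫ z, Real.exp (s * (g z - m)) * Real.exp (n * c ^ 2 * s ^ 2 / 2) ∂ρ := by
          refine integral_mono_of_nonneg
            (Filter.Eventually.of_forall fun z => integral_nonneg fun _ => (Real.exp_pos _).le) ?_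
            (Filter.Eventually.of_forall hin)
          refine Integrable.mul_const ?_ _
          refine integrable_of_measurable_of_abs_le (by fun_prop) (M := Real.exp (|s| * c)) ?_
          intro z
          rw [abs_of_pos (Real.exp_pos _)]
          refine Real.exp_le_exp.2 ((le_abs_self _).trans ?_)
          rw [abs_mul]
          exact mul_le_mul_of_nonneg_left (hgmean z) (abs_nonneg _)
      _ ≤ Real.exp (c ^ 2 * s ^ 2 / 2) * Real.exp (n * c ^ 2 * s ^ 2 / 2) := by
          rw [integral_mul_const]
          exact mul_le_mul_of_nonneg_right hoeff (Real.exp_pos _).le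
      _ = _ := by
          rw [← Real.exp_add]
          congr 1
          push_cast
          ring

/-- McDiarmid's inequality, with a constant that is not optimal. -/
theorem measure_ge_le_of_bounded_differences {c M : ℝ} {n : ℕ} {f : (Fin n → Ω) → ℝ}
    (hf : Measurable f) (hM : ∀ T, |f T| ≤ M)
    (hdiff : ∀ T i z, |f T - f (Function.update T i z)| ≤ c) {t : ℝ} (ht : 0 ≤ t) :
    (Measure.pi fun _ : Fin n => ρ).real
      {T | ∫ T', f T' ∂(Measure.pi fun _ => ρ) + t ≤ f T} ≤
      Real.exp (-t ^ 2 / (2 * (n * c ^ 2))) := by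
  set m := ∫ T', f T' ∂(Measure.pi fun _ => ρ)
  have h : HasSubgaussianMGF (fun T => f T - m) ⟨n * c ^ 2, by positivity⟩
      (Measure.pi fun _ : Fin n => ρ) := by
    refine ⟨fun s => ?_, fun s => ?_⟩
    · refine integrable_of_measurable_of_abs_le (by fun_prop) (M := Real.exp (|s| * (M + |m|))) ?_
      intro T
      rw [abs_of_pos (Real.exp_pos _)]
      refine Real.exp_le_exp.2 ((le_abs_self _).trans ?_)
      rw [abs_mul]
      refine mul_le_mul_of_nonneg_left ?_ (abs_nonneg _)
      exact (abs_sub _ _).trans (by linarith [hM T])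
    · exact integral_exp_le_of_bounded_differences ρ s hf hM hdiff
  have h2 := h.measure_ge_le ht
  refine le_trans (le_of_eq ?_) h2
  congr 1
  ext T
  simp only [Set.mem_ofPred_eq]
  constructor <;> intro h <;> linarith

/-- Overwriting one observation by an independent copy preserves the law of the sample. This
exchanges a training point with a fresh test point. -/
theorem measurePreserving_update {n : ℕ} (i : Fin n) :
    MeasurePreserving (fun p : (Fin n → Ω) × Ω => Function.update p.1 i p.2)
      ((Measure.pi fun _ => ρ).prod ρ) (Measure.pi fun _ => ρ) := by
  have hmeas : Measurable fun p : (Fin n → Ω) × Ω => Function.update p.1 i p.2 := by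
    refine measurable_pi_iff.2 fun j => ?_
    by_cases hj : j = i
    · subst hj
      simpa using measurable_snd
    · simp only [Function.update_of_ne hj]
      exact (measurable_pi_apply j).comp measurable_fst
  refine ⟨hmeas, (Measure.pi_eq fun s hs => ?_).symm⟩
  rw [Measure.map_apply hmeas (MeasurableSet.univ_pi hs)]
  have e : (fun p : (Fin n → Ω) × Ω => Function.update p.1 i p.2) ⁻¹' (Set.univ.pi s) =
      (Set.univ.pi (Function.update s i Set.univ)) ×ˢ (s i) := by
    ext p
    simp only [Set.mem_preimage, Set.mem_pi, Set.mem_univ, true_imp_iff, Set.mem_prod]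
    constructor
    · intro h
      refine ⟨fun j => ?_, by simpa using h i⟩
      by_cases hj : j = i
      · subst hj; simp
      · simpa [hj] using h j
    · rintro ⟨h1, h2⟩ j
      by_cases hj : j = i
      · subst hj; simpa using h2
      · simpa [hj] using h1 j
  rw [e, Measure.prod_prod, Measure.pi_pi, ← Finset.prod_erase_mul _ _ (Finset.mem_univ i),
    ← Finset.prod_erase_mul Finset.univ (fun j => ρ (s j)) (Finset.mem_univ i)]
  simp only [Function.update_self, measure_univ, mul_one]
  congr 1
  refine Finset.prod_congr rfl fun j hj => ?_
  rw [Function.update_of_ne (Finset.ne_of_mem_erase hj)]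

end BoundedDifferences

/-! ### Generalization of the support vector machine -/

section Generalization

variable {Ω H : Type*} [NormedAddCommGroup H] [InnerProductSpace ℝ H]

/-- The hinge loss at `z` of the machine trained on `T`. -/
def svmLoss {n : ℕ} (lam : ℝ) (ψ : Ω → H) (T : Fin n → Ω) (z : Ω) : ℝ :=
  hinge 1 ⟪ψ z, svm lam fun i => ψ (T i)⟫_ℝ

variable {lam : ℝ} {ψ : Ω → H} {κ : ℝ}

theorem svmLoss_nonneg {n : ℕ} (T : Fin n → Ω) (z : Ω) : 0 ≤ svmLoss lam ψ T z :=
  hinge_nonneg _ _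

theorem svmLoss_le (hlam : 0 < lam) (hψ : ∀ z, ‖ψ z‖ ≤ κ) {n : ℕ} (T : Fin n → Ω) (z : Ω) :
    svmLoss lam ψ T z ≤ 1 + κ / √lam := by
  refine (hinge_one_le _).trans ?_
  have h := (isSVM_svm hlam fun i => ψ (T i)).norm_le hlam
  have h2 := abs_real_inner_le_norm (ψ z) (svm lam fun i => ψ (T i))
  have h3 := mul_le_mul (hψ z) h (norm_nonneg _) ((norm_nonneg _).trans (hψ z))
  rw [mul_one_div] at h3
  linarith

theorem abs_svmLoss_sub_update_le (hlam : 0 < lam) (hψ : ∀ z, ‖ψ z‖ ≤ κ) {n : ℕ} (T : Fin n → Ω)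
    (i : Fin n) (v z : Ω) :
    |svmLoss lam ψ T z - svmLoss lam ψ (Function.update T i v) z| ≤ κ ^ 2 / (lam * n) := by
  have e : (fun j => ψ (Function.update T i v j)) = Function.update (fun j => ψ (T j)) i (ψ v) := by
    ext j
    by_cases hj : j = i
    · subst hj; simp
    · simp [hj]
  simp only [svmLoss, e]
  refine (abs_hinge_one_sub_le _ _).trans ?_
  rw [← inner_sub_right]
  refine (abs_real_inner_le_norm _ _).trans ?_
  have h := IsSVM.norm_sub_update_le hlam (hψ (T i)) (hψ v) (isSVM_svm hlam fun i => ψ (T i))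
    (isSVM_svm hlam _)
  calc _ ≤ κ * (κ / (lam * n)) :=
        mul_le_mul (hψ z) h (norm_nonneg _) ((norm_nonneg _).trans (hψ z))
    _ = _ := by ring

variable [MeasurableSpace Ω] (ρ : Measure Ω) [IsProbabilityMeasure ρ]

/-- The excess of the risk of the machine over its empirical risk, plus the deviation of the
empirical mean of `q` from its expectation. -/
def generalizationGap (n : ℕ) (lam : ℝ) (ψ : Ω → H) (q : Ω → ℝ) (T : Fin n → Ω) : ℝ :=
  ∫ z, svmLoss lam ψ T z ∂ρ - (1 / (n : ℝ)) * ∑ i, svmLoss lam ψ T (T i) +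
    ((1 / (n : ℝ)) * ∑ i, q (T i) - ∫ z, q z ∂ρ)

theorem measurable_svmLoss_apply {n : ℕ}
    (hmeas : Measurable fun p : (Fin n → Ω) × Ω => svmLoss lam ψ p.1 p.2) (i : Fin n) :
    Measurable fun T : Fin n → Ω => svmLoss lam ψ T (T i) :=
  hmeas.comp (measurable_id.prodMk (measurable_pi_apply i))

theorem measurable_integral_svmLoss {n : ℕ}
    (hmeas : Measurable fun p : (Fin n → Ω) × Ω => svmLoss lam ψ p.1 p.2) :
    Measurable fun T : Fin n → Ω => ∫ z, svmLoss lam ψ T z ∂ρ :=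
  hmeas.stronglyMeasurable.integral_prod_right.measurable

/-- In law, the loss at a training point is the loss at a fresh point `z` of the machine trained
with `z` in place of `T i`. By stability, this differs from the loss of the machine trained on `T`
by at most `κ² / (lam n)`. -/
theorem integral_svmLoss_self_ge {n : ℕ} (hlam : 0 < lam) (hψ : ∀ z, ‖ψ z‖ ≤ κ)
    (hmeas : Measurable fun p : (Fin n → Ω) × Ω => svmLoss lam ψ p.1 p.2) (i : Fin n) :
    ∫ T : Fin n → Ω, ∫ z, svmLoss lam ψ T z ∂ρ ∂(Measure.pi fun _ => ρ) - κ ^ 2 / (lam * n) ≤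
      ∫ T, svmLoss lam ψ T (T i) ∂(Measure.pi fun _ => ρ) := by
  have hb : ∀ T z, |svmLoss (n := n) lam ψ T z| ≤ 1 + κ / √lam := fun T z => by
    rw [abs_of_nonneg (svmLoss_nonneg _ _)]
    exact svmLoss_le hlam hψ T z
  have hi : Integrable (fun p : (Fin n → Ω) × Ω => svmLoss lam ψ p.1 p.2)
      ((Measure.pi fun _ => ρ).prod ρ) :=
    integrable_of_measurable_of_abs_le hmeas fun p => hb _ _
  have hu := measurePreserving_update ρ i
  have hmi := measurable_svmLoss_apply hmeas i
  have e1 : ∫ T, svmLoss lam ψ T (T i) ∂(Measure.pi fun _ : Fin n => ρ) =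
      ∫ p : (Fin n → Ω) × Ω, svmLoss lam ψ (Function.update p.1 i p.2) p.2
        ∂((Measure.pi fun _ => ρ).prod ρ) := by
    conv_lhs => rw [← hu.map_eq]
    rw [integral_map hu.measurable.aemeasurable hmi.aestronglyMeasurable]
    simp
  rw [e1, ← integral_prod (fun p : (Fin n → Ω) × Ω => svmLoss lam ψ p.1 p.2) hi]
  have hi2 : Integrable (fun p : (Fin n → Ω) × Ω =>
      svmLoss lam ψ (Function.update p.1 i p.2) p.2) ((Measure.pi fun _ => ρ).prod ρ) :=
    integrable_of_measurable_of_abs_le (hmeas.comp (hu.measurable.prodMk measurable_snd))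
      fun p => hb _ _
  have e2 : ∫ p : (Fin n → Ω) × Ω, svmLoss lam ψ p.1 p.2 ∂((Measure.pi fun _ => ρ).prod ρ) -
      κ ^ 2 / (lam * n) = ∫ p : (Fin n → Ω) × Ω, (svmLoss lam ψ p.1 p.2 - κ ^ 2 / (lam * n))
        ∂((Measure.pi fun _ => ρ).prod ρ) := by
    rw [integral_sub hi (integrable_const _)]
    simp
  rw [e2]
  refine integral_mono (hi.sub (integrable_const _)) hi2 fun p => ?_
  have := abs_svmLoss_sub_update_le hlam hψ p.1 i p.2 p.2
  have := (abs_le.1 this).2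
  simp only
  linarith

/-- The part of the gap coming from `q` has mean zero, so the expected gap is only the stability
bias. -/
theorem integral_generalizationGap_le {n : ℕ} (hn : 0 < n) (hlam : 0 < lam) (hψ : ∀ z, ‖ψ z‖ ≤ κ)
    (hmeas : Measurable fun p : (Fin n → Ω) × Ω => svmLoss lam ψ p.1 p.2) {q : Ω → ℝ}
    (hq : Measurable q) {M : ℝ} (hqM : ∀ z, 0 ≤ q z ∧ q z ≤ M) :
    ∫ T, generalizationGap ρ n lam ψ q T ∂(Measure.pi fun _ => ρ) ≤ κ ^ 2 / (lam * n) := by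
  have hb : ∀ T z, |svmLoss (n := n) lam ψ T z| ≤ 1 + κ / √lam := fun T z => by
    rw [abs_of_nonneg (svmLoss_nonneg _ _)]
    exact svmLoss_le hlam hψ T z
  have hqb : ∀ z, |q z| ≤ M := fun z => by rw [abs_of_nonneg (hqM z).1]; exact (hqM z).2
  have hn' : (n : ℝ) ≠ 0 := by positivity
  have i1 : Integrable (fun T : Fin n → Ω => ∫ z, svmLoss lam ψ T z ∂ρ)
      (Measure.pi fun _ => ρ) := by
    refine integrable_of_measurable_of_abs_le (measurable_integral_svmLoss ρ hmeas)
      (M := 1 + κ / √lam) fun T => ?_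
    have h := norm_integral_le_of_norm_le_const (μ := ρ) (f := svmLoss lam ψ T)
      (C := 1 + κ / √lam) (Filter.Eventually.of_forall fun z => hb T z)
    simpa using h
  have i2 : ∀ i, Integrable (fun T : Fin n → Ω => svmLoss lam ψ T (T i))
      (Measure.pi fun _ => ρ) := fun i =>
    integrable_of_measurable_of_abs_le (measurable_svmLoss_apply hmeas i) fun T => hb _ _
  have i3 : ∀ i, Integrable (fun T : Fin n → Ω => q (T i)) (Measure.pi fun _ => ρ) := fun i =>
    integrable_of_measurable_of_abs_le (hq.comp (measurable_pi_apply i)) fun T => hqb _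
  have eq : ∀ i : Fin n, ∫ T : Fin n → Ω, q (T i) ∂(Measure.pi fun _ => ρ) = ∫ z, q z ∂ρ :=
    fun i => by
      have h := measurePreserving_eval (fun _ : Fin n => ρ) i
      conv_rhs => rw [← h.map_eq]
      rw [integral_map h.measurable.aemeasurable hq.aestronglyMeasurable]
  have hself := fun i => integral_svmLoss_self_ge ρ hlam hψ hmeas i
  simp only [generalizationGap]
  rw [integral_add, integral_sub i1, integral_sub, integral_const_mul, integral_const_mul,
    integral_finsetSum _ fun i _ => i2 i, integral_finsetSum _ fun i _ => i3 i]
  · simp only [eq, integral_const, probReal_univ, one_smul, Finset.sum_const, Finset.card_univ,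
      Fintype.card_fin, nsmul_eq_mul]
    set A := ∫ T, ∫ z, svmLoss lam ψ T z ∂ρ ∂(Measure.pi fun _ : Fin n => ρ)
    have hs : (n : ℝ) * (A - κ ^ 2 / (lam * n)) ≤
        ∑ i, ∫ T : Fin n → Ω, svmLoss lam ψ T (T i) ∂(Measure.pi fun _ => ρ) := by
      have := Finset.sum_le_sum fun i (_ : i ∈ (Finset.univ : Finset (Fin n))) => hself i
      simpa [mul_sub] using this
    have h2 := mul_le_mul_of_nonneg_left hs (by positivity : (0 : ℝ) ≤ 1 / n)
    rw [← mul_assoc, one_div_mul_cancel hn', one_mul] at h2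
    rw [← mul_assoc, one_div_mul_cancel hn', one_mul]
    linarith
  · exact (integrable_finsetSum _ fun i _ => i3 i).const_mul _
  · exact integrable_const _
  · exact (integrable_finsetSum _ fun i _ => i2 i).const_mul _
  · exact i1.sub ((integrable_finsetSum _ fun i _ => i2 i).const_mul _)
  · exact ((integrable_finsetSum _ fun i _ => i3 i).const_mul _).sub (integrable_const _)

/-- Stability accounts for the two terms `κ² / (lam n)`, one from the risk and one from the
empirical risk. The `i`-th summands also change their evaluation point, which costs the range of the
loss and of `q`, divided by `n`. -/
theorem abs_generalizationGap_sub_update_le {n : ℕ} (hlam : 0 < lam) (hψ : ∀ z, ‖ψ z‖ ≤ κ)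
    (hmeas : Measurable fun p : (Fin n → Ω) × Ω => svmLoss lam ψ p.1 p.2) {q : Ω → ℝ}
    {M : ℝ} (hqM : ∀ z, 0 ≤ q z ∧ q z ≤ M) (T : Fin n → Ω) (i : Fin n) (v : Ω) :
    |generalizationGap ρ n lam ψ q T - generalizationGap ρ n lam ψ q (Function.update T i v)| ≤
      2 * (κ ^ 2 / (lam * n)) + (1 + κ / √lam + M) / n := by
  classical
  have hn : (0 : ℝ) < n := by exact_mod_cast i.pos
  have hκ : 0 ≤ κ := (norm_nonneg _).trans (hψ v)
  have hb : ∀ T z, |svmLoss (n := n) lam ψ T z| ≤ 1 + κ / √lam := fun T z => by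
    rw [abs_of_nonneg (svmLoss_nonneg _ _)]
    exact svmLoss_le hlam hψ T z
  set T' := Function.update T i v with hT'
  have hi : ∀ T : Fin n → Ω, Integrable (svmLoss lam ψ T) ρ := fun T =>
    integrable_of_measurable_of_abs_le (hmeas.comp measurable_prodMk_left) fun z => hb T z
  have h1 : |∫ z, svmLoss lam ψ T z ∂ρ - ∫ z, svmLoss lam ψ T' z ∂ρ| ≤ κ ^ 2 / (lam * n) := by
    rw [← integral_sub (hi T) (hi T')]
    have h := norm_integral_le_of_norm_le_const (μ := ρ)
      (f := fun z => svmLoss lam ψ T z - svmLoss lam ψ T' z) (C := κ ^ 2 / (lam * n))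
      (Filter.Eventually.of_forall fun z => abs_svmLoss_sub_update_le hlam hψ T i v z)
    simpa using h
  have h2 : |∑ j, svmLoss lam ψ T (T j) - ∑ j, svmLoss lam ψ T' (T' j)| ≤
      n * (κ ^ 2 / (lam * n)) + (1 + κ / √lam) := by
    rw [← Finset.sum_sub_distrib]
    refine (Finset.abs_sum_le_sum_abs _ _).trans ?_
    have : ∀ j ∈ (Finset.univ : Finset (Fin n)),
        |svmLoss lam ψ T (T j) - svmLoss lam ψ T' (T' j)| ≤
        κ ^ 2 / (lam * n) + if j = i then (1 + κ / √lam) else 0 := by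
      intro j _
      by_cases hj : j = i
      · simp only [hj, if_true]
        have p1 := svmLoss_nonneg (lam := lam) (ψ := ψ) T (T i)
        have p2 := svmLoss_nonneg (lam := lam) (ψ := ψ) T' (T' i)
        have p3 := svmLoss_le hlam hψ T (T i)
        have p4 := svmLoss_le hlam hψ T' (T' i)
        have p5 : 0 ≤ κ ^ 2 / (lam * n) := by positivity
        rw [abs_le]
        constructor <;> linarith
      · have e : T' j = T j := by rw [hT', Function.update_of_ne hj]
        simp only [hj, if_false, e, add_zero]
        exact abs_svmLoss_sub_update_le hlam hψ T i v _
    refine (Finset.sum_le_sum this).trans (le_of_eq ?_)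
    simp [Finset.sum_add_distrib]
  have h3 : |∑ j, q (T j) - ∑ j, q (T' j)| ≤ M := by
    rw [← Finset.sum_sub_distrib, Finset.sum_eq_single i]
    · have p1 := hqM (T i)
      have p2 := hqM (T' i)
      rw [abs_le]
      constructor <;> linarith
    · intro j _ hj
      rw [hT', Function.update_of_ne hj, sub_self]
    · simp
  set a := ∑ j, svmLoss lam ψ T (T j)
  set a' := ∑ j, svmLoss lam ψ T' (T' j)
  set b := ∑ j, q (T j)
  set b' := ∑ j, q (T' j)
  set x := ∫ z, svmLoss lam ψ T z ∂ρ
  set x' := ∫ z, svmLoss lam ψ T' z ∂ρ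
  have e : generalizationGap ρ n lam ψ q T - generalizationGap ρ n lam ψ q T' =
      (x - x') - 1 / n * (a - a') + 1 / n * (b - b') := by
    simp only [generalizationGap]
    ring
  rw [e]
  have t1 : |1 / (n : ℝ) * (a - a')| ≤ 1 / n * (n * (κ ^ 2 / (lam * n)) + (1 + κ / √lam)) := by
    rw [abs_mul, abs_of_nonneg (by positivity : (0 : ℝ) ≤ 1 / n)]
    exact mul_le_mul_of_nonneg_left h2 (by positivity)
  have t2 : |1 / (n : ℝ) * (b - b')| ≤ 1 / n * M := by
    rw [abs_mul, abs_of_nonneg (by positivity : (0 : ℝ) ≤ 1 / n)]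
    exact mul_le_mul_of_nonneg_left h3 (by positivity)
  refine (abs_add_le _ _).trans ?_
  have t3 := abs_sub (x - x') (1 / n * (a - a'))
  have e2 : 1 / (n : ℝ) * (n * (κ ^ 2 / (lam * n)) + (1 + κ / √lam)) =
      κ ^ 2 / (lam * n) + 1 / n * (1 + κ / √lam) := by
    field_simp
  have e3 : (1 + κ / √lam + M) / n = 1 / n * (1 + κ / √lam) + 1 / n * M := by ring
  rw [e3]
  linarith

theorem measurable_generalizationGap {n : ℕ}
    (hmeas : Measurable fun p : (Fin n → Ω) × Ω => svmLoss lam ψ p.1 p.2) {q : Ω → ℝ}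
    (hq : Measurable q) : Measurable (generalizationGap ρ n lam ψ q) := by
  have h1 := measurable_integral_svmLoss ρ hmeas
  have h2 := fun i => measurable_svmLoss_apply hmeas i
  have h3 : ∀ i, Measurable fun T : Fin n → Ω => q (T i) := fun i =>
    hq.comp (measurable_pi_apply i)
  unfold generalizationGap
  exact (h1.sub ((Finset.measurable_sum _ fun i _ => h2 i).const_mul _)).add
    (((Finset.measurable_sum _ fun i _ => h3 i).const_mul _).sub_const _)

/-- This only secures integrability in the concentration inequality; the size of the bound does not
enter the tail estimate. -/
theorem abs_generalizationGap_le {n : ℕ} (hn : 0 < n) (hlam : 0 < lam) (hψ : ∀ z, ‖ψ z‖ ≤ κ)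
    {q : Ω → ℝ} {M : ℝ} (hqM : ∀ z, 0 ≤ q z ∧ q z ≤ M) (T : Fin n → Ω) :
    |generalizationGap ρ n lam ψ q T| ≤ 2 * (1 + κ / √lam) + 2 * M := by
  have hb : ∀ T z, |svmLoss (n := n) lam ψ T z| ≤ 1 + κ / √lam := fun T z => by
    rw [abs_of_nonneg (svmLoss_nonneg _ _)]
    exact svmLoss_le hlam hψ T z
  have hqb : ∀ z, |q z| ≤ M := fun z => by rw [abs_of_nonneg (hqM z).1]; exact (hqM z).2
  have hn' : (0 : ℝ) < n := by positivity
  have h1 := norm_integral_le_of_norm_le_const (μ := ρ) (f := svmLoss lam ψ T)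
      (C := 1 + κ / √lam) (Filter.Eventually.of_forall fun z => hb T z)
  have h2 := norm_integral_le_of_norm_le_const (μ := ρ) (f := q)
      (C := M) (Filter.Eventually.of_forall fun z => hqb z)
  have hmean : ∀ (a : Fin n → ℝ) (C : ℝ), (∀ i, |a i| ≤ C) → |1 / (n : ℝ) * ∑ i, a i| ≤ C := by
    intro a C ha
    rw [abs_mul, abs_of_nonneg (by positivity : (0 : ℝ) ≤ 1 / n)]
    have : |∑ i, a i| ≤ n * C := by
      refine (Finset.abs_sum_le_sum_abs _ _).trans ?_
      refine (Finset.sum_le_sum fun i _ => ha i).trans (le_of_eq (by simp))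
    calc 1 / (n : ℝ) * |∑ i, a i| ≤ 1 / n * (n * C) :=
          mul_le_mul_of_nonneg_left this (by positivity)
      _ = C := by field_simp
  have h3 := hmean (fun i => svmLoss lam ψ T (T i)) _ fun i => hb T (T i)
  have h4 := hmean (fun i => q (T i)) _ fun i => hqb (T i)
  simp only [probReal_univ, mul_one, Real.norm_eq_abs] at h1 h2
  unfold generalizationGap
  rw [abs_le] at *
  constructor <;> linarith

/-- With probability at least `1 - exp (-t² / (2 n b²))`, the generalization gap is at most
`κ² / (lam n) + t`. -/
theorem measure_generalizationGap_ge_le {n : ℕ} (hn : 0 < n) (hlam : 0 < lam)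
    (hψ : ∀ z, ‖ψ z‖ ≤ κ)
    (hmeas : Measurable fun p : (Fin n → Ω) × Ω => svmLoss lam ψ p.1 p.2) {q : Ω → ℝ}
    (hq : Measurable q) {M : ℝ} (hqM : ∀ z, 0 ≤ q z ∧ q z ≤ M) {t : ℝ} (ht : 0 ≤ t) {b : ℝ}
    (hb : 2 * (κ ^ 2 / (lam * n)) + (1 + κ / √lam + M) / n ≤ b) :
    (Measure.pi fun _ : Fin n => ρ).real
      {T | κ ^ 2 / (lam * n) + t ≤ generalizationGap ρ n lam ψ q T} ≤
      Real.exp (-t ^ 2 / (2 * (n * b ^ 2))) := by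
  refine le_trans (measureReal_mono ?_) (measure_ge_le_of_bounded_differences ρ
    (measurable_generalizationGap ρ hmeas hq) (abs_generalizationGap_le ρ hn hlam hψ hqM)
    (fun T i v => (abs_generalizationGap_sub_update_le ρ hlam hψ hmeas hqM T i v).trans hb) ht)
  intro T hT
  have := integral_generalizationGap_le ρ hn hlam hψ hmeas hq hqM
  simp only [Set.mem_ofPred_eq] at hT ⊢
  linarith

end Generalization

/-! ### Domination of kernel matrices -/

section Domination

theorem posSemidef_iff_sum {ι : Type*} [Fintype ι] {M : Matrix ι ι ℝ} :
    M.PosSemidef ↔ (∀ i j, M i j = M j i) ∧ ∀ α : ι → ℝ, 0 ≤ ∑ i, ∑ j, α i * α j * M i j := by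
  have e : ∀ α : ι → ℝ, star α ⬝ᵥ (M.mulVec α) = ∑ i, ∑ j, α i * α j * M i j := by
    intro α
    simp only [dotProduct, Matrix.mulVec, Pi.star_apply, star_trivial, Finset.mul_sum]
    refine Finset.sum_congr rfl fun i _ => Finset.sum_congr rfl fun j _ => by ring
  rw [Matrix.posSemidef_iff_dotProduct_mulVec]
  constructor
  · rintro ⟨h1, h2⟩
    exact ⟨fun i j => by simpa using h1.apply j i, fun α => by rw [← e]; exact h2 α⟩
  · rintro ⟨h1, h2⟩
    refine ⟨?_, fun α => by rw [e]; exact h2 α⟩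
    ext i j
    simpa using h1 j i

/-- Test the quadratic form on `e_i + e_j` and `e_i - e_j`. -/
theorem Matrix.PosSemidef.abs_apply_le {ι : Type*} [Fintype ι] {E : Matrix ι ι ℝ}
    (hE : E.PosSemidef) {e : ℝ} (he : ∀ i, E i i ≤ e) (i j : ι) : |E i j| ≤ e := by
  classical
  have key : ∀ s : ℝ, 0 ≤ E i i + 2 * s * E i j + s ^ 2 * E j j := by
    intro s
    have h := (hE.submatrix ![i, j]).dotProduct_mulVec_nonneg ![1, s]
    have hs := (posSemidef_iff_sum.1 hE).1 i j
    simp [dotProduct, Matrix.mulVec, Fin.sum_univ_two] at h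
    rw [← hs] at h
    nlinarith
  have h1 := key 1
  have h2 := key (-1)
  have hi := he i
  have hj := he j
  rw [abs_le]
  constructor <;> linarith

/-- The kernel matrix `K` is dominated by `C • K'` up to a positive semidefinite matrix with
diagonal at most `e`. -/
def IsDominated {ι : Type*} (C e : ℝ) (K K' : Matrix ι ι ℝ) : Prop :=
  ∃ E : Matrix ι ι ℝ, E.PosSemidef ∧ (∀ i, E i i ≤ e) ∧ (C • K' + E - K).PosSemidef

theorem IsDominated.mono {ι : Type*} {C C' e e' : ℝ} {K K' : Matrix ι ι ℝ} (h : IsDominated C e K K')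
    (hK' : K'.PosSemidef) (hC : C ≤ C') (he : e ≤ e') : IsDominated C' e' K K' := by
  obtain ⟨E, hE, hd, hp⟩ := h
  refine ⟨E, hE, fun i => (hd i).trans he, ?_⟩
  have := hp.add (hK'.smul (sub_nonneg.2 hC))
  convert this using 1
  rw [sub_smul]
  abel

/-- With `S = C • K' + E`, the difference of Schur products telescopes as `S₁ ∘ S₂ - K₁ ∘ K₂ = (S₁ -
K₁) ∘ S₂ + K₁ ∘ (S₂ - K₂)`, and each summand is positive semidefinite by the Schur product theorem.
The new error collects all terms of `S₁ ∘ S₂` containing some `Eᵢ`. -/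
theorem IsDominated.hadamard {ι : Type*} {C₁ C₂ e₁ e₂ M₁ M₂ : ℝ} {K₁ K₁' K₂ K₂' : Matrix ι ι ℝ}
    (h₁ : IsDominated C₁ e₁ K₁ K₁') (h₂ : IsDominated C₂ e₂ K₂ K₂')
    (hC₁ : 0 ≤ C₁) (hC₂ : 0 ≤ C₂) (hK₁ : K₁.PosSemidef) (hK₁' : K₁'.PosSemidef)
    (hK₂' : K₂'.PosSemidef) (hM₁ : ∀ i, K₁' i i ≤ M₁) (hM₂ : ∀ i, K₂' i i ≤ M₂) :
    IsDominated (C₁ * C₂) (C₁ * M₁ * e₂ + C₂ * M₂ * e₁ + e₁ * e₂) (K₁.hadamard K₂)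
      (K₁'.hadamard K₂') := by
  obtain ⟨E₁, hE₁, hd₁, hp₁⟩ := h₁
  obtain ⟨E₂, hE₂, hd₂, hp₂⟩ := h₂
  refine ⟨C₁ • K₁'.hadamard E₂ + C₂ • E₁.hadamard K₂' + E₁.hadamard E₂, ?_, ?_, ?_⟩
  · exact (((hK₁'.hadamard hE₂).smul hC₁).add ((hE₁.hadamard hK₂').smul hC₂)).add
      (hE₁.hadamard hE₂)
  · intro i
    have p1 := hE₁.diag_nonneg (i := i)
    have p2 := hE₂.diag_nonneg (i := i)
    have p3 := hK₁'.diag_nonneg (i := i)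
    have p4 := hK₂'.diag_nonneg (i := i)
    simp only [Matrix.add_apply, Matrix.smul_apply, Matrix.hadamard_apply, smul_eq_mul]
    have q1 := mul_le_mul_of_nonneg_left
      (mul_le_mul (hM₁ i) (hd₂ i) p2 (p3.trans (hM₁ i))) hC₁
    have q2 := mul_le_mul_of_nonneg_left
      (mul_le_mul (hd₁ i) (hM₂ i) p4 (p1.trans (hd₁ i))) hC₂
    have q3 := mul_le_mul (hd₁ i) (hd₂ i) p2 (p1.trans (hd₁ i))
    linarith
  · have hS₂ : (C₂ • K₂' + E₂).PosSemidef := (hK₂'.smul hC₂).add hE₂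
    have e : (C₁ * C₂) • K₁'.hadamard K₂' +
        (C₁ • K₁'.hadamard E₂ + C₂ • E₁.hadamard K₂' + E₁.hadamard E₂) - K₁.hadamard K₂ =
        (C₁ • K₁' + E₁ - K₁).hadamard (C₂ • K₂' + E₂) + K₁.hadamard (C₂ • K₂' + E₂ - K₂) := by
      ext i j
      simp
      ring
    rw [e]
    exact (hp₁.hadamard hS₂).add (hK₁.hadamard hp₂)

theorem IsDominated.sum {ι S : Type*} (s : Finset S) {C e : ℝ} {w : S → ℝ} (hw : ∀ a ∈ s, 0 ≤ w a)
    {K K' : S → Matrix ι ι ℝ} (h : ∀ a ∈ s, IsDominated C e (K a) (K' a)) :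
    IsDominated C (e * ∑ a ∈ s, w a) (∑ a ∈ s, w a • K a) (∑ a ∈ s, w a • K' a) := by
  classical
  choose! E hE hd hp using h
  refine ⟨∑ a ∈ s, w a • E a, ?_, ?_, ?_⟩
  · exact Matrix.posSemidef_sum s fun a ha => (hE a ha).smul (hw a ha)
  · intro i
    rw [Matrix.sum_apply, Finset.mul_sum]
    refine Finset.sum_le_sum fun a ha => ?_
    rw [Matrix.smul_apply, smul_eq_mul, mul_comm e]
    exact mul_le_mul_of_nonneg_left (hd a ha i) (hw a ha)
  · have := Matrix.posSemidef_sum s fun a ha => (hp a ha).smul (hw a ha)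
    convert this using 1
    rw [Finset.smul_sum, ← Finset.sum_add_distrib, ← Finset.sum_sub_distrib]
    refine Finset.sum_congr rfl fun a _ => ?_
    rw [smul_sub, smul_add, smul_comm]

variable {ι : Type*} [Fintype ι]

/-- All entries of `E` are bounded by its diagonal bound, so the error is measured by the `ℓ¹` norm
of `α`. For dual multipliers this norm is bounded independently of the sample size. -/
theorem IsDominated.sum_le {C e : ℝ} {K K' : Matrix ι ι ℝ} (h : IsDominated C e K K')
    (α : ι → ℝ) : ∑ i, ∑ j, α i * α j * K i j ≤
      C * ∑ i, ∑ j, α i * α j * K' i j + e * (∑ i, |α i|) ^ 2 := by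
  obtain ⟨E, hE, hd, hp⟩ := h
  have h1 := (posSemidef_iff_sum.1 hp).2 α
  have h2 : ∑ i, ∑ j, α i * α j * E i j ≤ e * (∑ i, |α i|) ^ 2 := by
    rw [sq, Finset.sum_mul_sum, Finset.mul_sum]
    refine Finset.sum_le_sum fun i _ => ?_
    rw [Finset.mul_sum]
    refine Finset.sum_le_sum fun j _ => ?_
    have h3 := hE.abs_apply_le hd i j
    calc α i * α j * E i j ≤ |α i * α j * E i j| := le_abs_self _
      _ = |α i| * |α j| * |E i j| := by rw [abs_mul, abs_mul]
      _ ≤ |α i| * |α j| * e := mul_le_mul_of_nonneg_left h3 (by positivity)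
      _ = _ := by ring
  have e1 : ∑ i, ∑ j, α i * α j * (C • K' + E - K) i j =
      C * ∑ i, ∑ j, α i * α j * K' i j + ∑ i, ∑ j, α i * α j * E i j -
        ∑ i, ∑ j, α i * α j * K i j := by
    simp only [Finset.mul_sum, ← Finset.sum_add_distrib, ← Finset.sum_sub_distrib]
    refine Finset.sum_congr rfl fun i _ => Finset.sum_congr rfl fun j _ => ?_
    simp
    ring
  rw [e1] at h1
  linarith

theorem posSemidef_of_tendsto {F : ℕ → Matrix ι ι ℝ} {G : Matrix ι ι ℝ}
    {l : Filter ℕ} [l.NeBot]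
    (hF : ∀ n, (F n).PosSemidef) (h : ∀ i j, Filter.Tendsto (fun n => F n i j) l (nhds (G i j))) :
    G.PosSemidef := by
  refine posSemidef_iff_sum.2 ⟨fun i j => ?_, fun α => ?_⟩
  · refine tendsto_nhds_unique (h i j) ?_
    have := h j i
    refine this.congr fun n => (posSemidef_iff_sum.1 (hF n)).1 j i
  · refine ge_of_tendsto' (x := l)
      (tendsto_finsetSum _ fun i _ => tendsto_finsetSum _ fun j _ => (h i j).const_mul _)
      fun n => (posSemidef_iff_sum.1 (hF n)).2 α

/-- The error matrices have entries in `[-e, e]`, so a subsequence converges; its limit is an error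
matrix for the limiting kernels. -/
theorem IsDominated.of_tendsto {C e : ℝ} {K K' : ℕ → Matrix ι ι ℝ} {K₀ K₀' : Matrix ι ι ℝ}
    (h : ∀ n, IsDominated C e (K n) (K' n))
    (hK : ∀ i j, Filter.Tendsto (fun n => K n i j) Filter.atTop (nhds (K₀ i j)))
    (hK' : ∀ i j, Filter.Tendsto (fun n => K' n i j) Filter.atTop (nhds (K₀' i j))) :
    IsDominated C e K₀ K₀' := by
  choose E hE hd hp using h
  let F : ℕ → ι → ι → ℝ := fun n i j => E n i j
  have hcomp : IsCompact (Set.pi Set.univ fun _ : ι => Set.pi Set.univ fun _ : ι =>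
      Set.Icc (-e) e) := isCompact_univ_pi fun _ => isCompact_univ_pi fun _ => isCompact_Icc
  obtain ⟨E₀, -, φ, hφ, hlim⟩ := hcomp.tendsto_subseq (x := F) fun n i _ j _ =>
    abs_le.1 ((hE n).abs_apply_le (hd n) i j)
  have hlim' : ∀ i j, Filter.Tendsto (fun n => E (φ n) i j) Filter.atTop (nhds (E₀ i j)) :=
    fun i j => (tendsto_pi_nhds.1 (tendsto_pi_nhds.1 hlim i)) j
  refine ⟨Matrix.of E₀, posSemidef_of_tendsto (l := Filter.atTop) (fun n => hE (φ n)) hlim',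
    fun i => le_of_tendsto' (hlim' i i) fun n => hd (φ n) i,
    posSemidef_of_tendsto (l := Filter.atTop) (fun n => hp (φ n)) fun i j => ?_⟩
  have a1 := ((hK' i j).comp hφ.tendsto_atTop).const_mul C
  have a2 := (hK i j).comp hφ.tendsto_atTop
  simpa using (a1.add (hlim' i j)).sub a2

/-- Iterated Schur products, with one constant chosen before the index set and the matrices: it must
not depend on the sample size. The error stays linear in `τ` because `τ ≤ 1` absorbs the products of
errors. -/
theorem exists_isDominated_prod {J : Type*} (s : Finset J) (c : J → ℝ) (hc : ∀ j, 0 ≤ c j) :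
    ∃ C : ℝ, 0 ≤ C ∧ ∀ (ι : Type) [Fintype ι] (τ : ℝ) (_ : 0 ≤ τ) (_ : τ ≤ 1)
      (K K' : J → Matrix ι ι ℝ), (∀ j ∈ s, (K j).PosSemidef) → (∀ j ∈ s, (K' j).PosSemidef) →
      (∀ j ∈ s, ∀ i, K' j i i ≤ c j) → (∀ j ∈ s, IsDominated (c j) (c j * τ) (K j) (K' j)) →
      IsDominated C (C * τ) (Matrix.of fun a b => ∏ j ∈ s, K j a b)
        (Matrix.of fun a b => ∏ j ∈ s, K' j a b) ∧
      (Matrix.of fun a b => ∏ j ∈ s, K j a b).PosSemidef ∧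
      (Matrix.of fun a b => ∏ j ∈ s, K' j a b).PosSemidef ∧
      ∀ i, ∏ j ∈ s, K' j i i ≤ C := by
  classical
  induction s using Finset.induction_on with
  | empty =>
    refine ⟨1, zero_le_one, fun ι _ τ h0 _ K K' _ _ _ _ => ?_⟩
    have h1 : (Matrix.of fun _ _ : ι => (1 : ℝ)).PosSemidef := by
      refine posSemidef_iff_sum.2 ⟨fun _ _ => rfl, fun α => ?_⟩
      simp only [Matrix.of_apply, mul_one, ← Finset.sum_mul_sum]
      exact mul_self_nonneg _
    simp only [Finset.prod_empty]
    refine ⟨⟨0, Matrix.PosSemidef.zero, fun i => by simpa using h0, ?_⟩, h1, h1, fun _ => le_rfl⟩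
    simpa using Matrix.PosSemidef.zero
  | insert a s ha ih =>
    obtain ⟨C, hC, h⟩ := ih
    -- The first term bounds the domination factor and the diagonal; the bracket is the coefficient
    -- of `τ` in the error of `IsDominated.hadamard`.
    refine ⟨c a * C + (c a * c a * C + C * C * c a + c a * C), by have := hc a; positivity,
      fun ι _ τ h0 h1 K K' hK hK' hd hdom => ?_⟩
    have hmem : ∀ j ∈ s, j ∈ insert a s := fun j hj => Finset.mem_insert_of_mem hj
    have haa := Finset.mem_insert_self a s
    obtain ⟨g1, g2, g3, g4⟩ := h ι τ h0 h1 K K' (fun j hj => hK j (hmem j hj))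
      (fun j hj => hK' j (hmem j hj)) (fun j hj => hd j (hmem j hj))
      (fun j hj => hdom j (hmem j hj))
    have e : ∀ L : J → Matrix ι ι ℝ, (Matrix.of fun i j => ∏ k ∈ insert a s, L k i j) =
        (L a).hadamard (Matrix.of fun i j => ∏ k ∈ s, L k i j) := by
      intro L
      ext i j
      simp [Finset.prod_insert ha]
    have hc' := hc a
    have hp : (Matrix.of fun i j => ∏ k ∈ insert a s, K' k i j).PosSemidef := by
      rw [e]
      exact (hK' a haa).hadamard g3
    refine ⟨?_, ?_, hp, fun i => ?_⟩
    · refine IsDominated.mono (C := c a * C)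
        (e := c a * c a * (C * τ) + C * C * (c a * τ) + c a * τ * (C * τ)) ?_ hp ?_ ?_
      · rw [e, e]
        exact (hdom a haa).hadamard g1 hc' hC (hK a haa) (hK' a haa) g3 (hd a haa) g4
      · have : 0 ≤ c a * c a * C + C * C * c a + c a * C := by positivity
        linarith
      · have q1 : c a * τ * (C * τ) ≤ c a * C * τ := by
          have : c a * C * τ * τ ≤ c a * C * τ * 1 :=
            mul_le_mul_of_nonneg_left h1 (by positivity)
          linarith
        have q2 : 0 ≤ c a * C * τ := by positivity
        linarith
    · rw [e]
      exact (hK a haa).hadamard g2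
    · rw [Finset.prod_insert ha]
      have p3 := (hK' a haa).diag_nonneg (i := i)
      have p4 := g3.diag_nonneg (i := i)
      have := mul_le_mul (hd a haa i) (g4 i) p4 hc'
      have : 0 ≤ c a * c a * C + C * C * c a + c a * C := by positivity
      linarith

end Domination

/-! ### Domination of Gaussian kernels under near isometries -/

section Gaussian

theorem integral_cos_gaussianReal (v : ℝ≥0) (t : ℝ) :
    ∫ x, Real.cos (t * x) ∂(gaussianReal 0 v) = Real.exp (-(v * t ^ 2 / 2)) := by
  have h := charFun_gaussianReal (μ := 0) (v := v) t
  rw [charFun_apply_real] at h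
  have h2 := congrArg Complex.re h
  have hi : Integrable (fun x : ℝ => Complex.exp (t * x * Complex.I)) (gaussianReal 0 v) := by
    refine Integrable.of_bound (by fun_prop) 1 (Filter.Eventually.of_forall fun x => ?_)
    rw [← Complex.ofReal_mul, Complex.norm_exp_ofReal_mul_I]
  have h3 := integral_re hi
  simp only [RCLike.re_to_complex] at h3
  rw [← h3] at h2
  have e : ∀ x : ℝ, (Complex.exp (t * x * Complex.I)).re = Real.cos (t * x) := fun x => by
    rw [← Complex.ofReal_mul, Complex.exp_ofReal_mul_I_re]
  simp only [e] at h2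
  rw [h2]
  have : (t * (0 : ℝ) * Complex.I - v * t ^ 2 / 2 : ℂ) = ((-(v * t ^ 2 / 2) : ℝ) : ℂ) := by
    push_cast
    ring
  rw [this, Complex.exp_ofReal_re]

theorem sum_mul_cos_sub {ι : Type*} [Fintype ι] (α w : ι → ℝ) :
    ∑ i, ∑ j, α i * α j * Real.cos (w i - w j) =
      (∑ i, α i * Real.cos (w i)) ^ 2 + (∑ i, α i * Real.sin (w i)) ^ 2 := by
  rw [sq, sq, Finset.sum_mul_sum, Finset.sum_mul_sum, ← Finset.sum_add_distrib]
  refine Finset.sum_congr rfl fun i _ => ?_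
  rw [← Finset.sum_add_distrib]
  refine Finset.sum_congr rfl fun j _ => ?_
  rw [Real.cos_sub]
  ring

theorem integrable_cos_mul (m : Measure ℝ) [IsFiniteMeasure m] (t : ℝ) :
    Integrable (fun g => Real.cos (t * g)) m :=
  integrable_of_measurable_of_abs_le (by fun_prop) (M := 1) fun _ => Real.abs_cos_le_one _

theorem sum_mul_integral_cos {ι : Type*} [Fintype ι] (m : Measure ℝ) [IsFiniteMeasure m]
    (α v : ι → ℝ) :
    ∑ i, ∑ j, α i * α j * ∫ g, Real.cos ((v i - v j) * g) ∂m =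
      ∫ g, ((∑ i, α i * Real.cos (v i * g)) ^ 2 + (∑ i, α i * Real.sin (v i * g)) ^ 2) ∂m := by
  have h : ∀ g, (∑ i, α i * Real.cos (v i * g)) ^ 2 + (∑ i, α i * Real.sin (v i * g)) ^ 2 =
      ∑ i, ∑ j, α i * α j * Real.cos ((v i - v j) * g) := fun g => by
    rw [← sum_mul_cos_sub]
    simp only [sub_mul]
  simp only [h]
  rw [integral_finsetSum _ fun i _ => integrable_finsetSum _ fun j _ =>
    (integrable_cos_mul m _).const_mul _]
  refine Finset.sum_congr rfl fun i _ => ?_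
  rw [integral_finsetSum _ fun j _ => (integrable_cos_mul m _).const_mul _]
  refine Finset.sum_congr rfl fun j _ => ?_
  rw [integral_const_mul]

theorem posSemidef_integral_cos {ι : Type*} [Fintype ι] (m : Measure ℝ) [IsFiniteMeasure m]
    (v : ι → ℝ) :
    (Matrix.of fun i j => ∫ g, Real.cos ((v i - v j) * g) ∂m).PosSemidef := by
  refine posSemidef_iff_sum.2 ⟨fun i j => ?_, fun α => ?_⟩
  · simp only [Matrix.of_apply]
    refine integral_congr_ae (Filter.Eventually.of_forall fun g => ?_)
    simp only
    rw [← Real.cos_neg]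
    congr 1
    ring
  · simp only [Matrix.of_apply]
    rw [sum_mul_integral_cos]
    exact integral_nonneg fun g => by positivity

/-- The probability that the square of a standard Gaussian exceeds `1 / θ`. -/
def gaussianTail (θ : ℝ) : ℝ := (gaussianReal 0 1).real {g | 1 / θ < g ^ 2}

theorem gaussianTail_nonneg (θ : ℝ) : 0 ≤ gaussianTail θ := measureReal_nonneg

theorem gaussianTail_le_one (θ : ℝ) : gaussianTail θ ≤ 1 := measureReal_le_one

/-- Markov's inequality for the moment of order `2 d`. The power `θ ^ d` is the one that the choice
of `ε` requires. -/
theorem exists_gaussianTail_le (d : ℕ) :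
    ∃ c : ℝ, 0 ≤ c ∧ ∀ θ : ℝ, 0 < θ → gaussianTail θ ≤ c * θ ^ d := by
  refine ⟨∫ g, (g ^ 2) ^ d ∂(gaussianReal 0 1), integral_nonneg fun g => by positivity,
    fun θ hθ => ?_⟩
  have hint : Integrable (fun g : ℝ => (g ^ 2) ^ d) (gaussianReal 0 1) := by
    have h := (memLp_id_gaussianReal (μ := 0) (v := 1) ((2 * d : ℕ) : ℝ≥0)).integrable_norm_pow'
    simp only [← pow_mul]
    refine h.congr (Filter.Eventually.of_forall fun g => ?_)
    simp [pow_mul]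
  have h := mul_meas_ge_le_integral_of_nonneg (μ := gaussianReal 0 1)
    (f := fun g : ℝ => (g ^ 2) ^ d) (Filter.Eventually.of_forall fun g => by positivity) hint
    ((1 / θ) ^ d)
  have h2 : gaussianTail θ ≤ (gaussianReal 0 1).real {g | (1 / θ) ^ d ≤ (g ^ 2) ^ d} := by
    refine measureReal_mono fun g hg => ?_
    simp only [Set.mem_ofPred_eq] at hg ⊢
    exact pow_le_pow_left₀ (by positivity) hg.le d
  have h3 : (1 / θ) ^ d * gaussianTail θ ≤ ∫ g, (g ^ 2) ^ d ∂(gaussianReal 0 1) :=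
    (mul_le_mul_of_nonneg_left h2 (by positivity)).trans h
  have h4 := mul_le_mul_of_nonneg_right h3 (by positivity : 0 ≤ θ ^ d)
  have e : (1 / θ) ^ d * gaussianTail θ * θ ^ d = gaussianTail θ := by
    rw [one_div, inv_pow]
    field_simp
  linarith

/-- The ratio of the densities is `√σ * exp (g² (1 - σ) / (2 σ))`. Here `√σ ≤ 2`, and the exponent
is at most 1 because `g² (1 - σ) ≤ g² θ ≤ 1 ≤ 2 σ`; thus `6 = 2 * 3` with `e < 3`. -/
theorem gaussianPDFReal_one_le {θ : ℝ} (hθ : 0 < θ) (hθ' : θ ≤ 1 / 2) {σ : ℝ≥0}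
    (h1 : 1 - θ ≤ σ) (h2 : σ ≤ 1 + θ) {g : ℝ} (hg : g ^ 2 ≤ 1 / θ) :
    gaussianPDFReal 0 1 g ≤ 6 * gaussianPDFReal 0 σ g := by
  have hσ : (0 : ℝ) < σ := by linarith
  simp only [gaussianPDFReal, sub_zero, NNReal.coe_one, mul_one]
  have hs : √(2 * Real.pi * σ) ≤ 2 * √(2 * Real.pi) := by
    rw [show 2 * √(2 * Real.pi) = √(2 ^ 2) * √(2 * Real.pi) by
      rw [Real.sqrt_sq (by norm_num)], ← Real.sqrt_mul (by norm_num)]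
    refine Real.sqrt_le_sqrt ?_
    have : (σ : ℝ) ≤ 4 := by linarith
    have := Real.pi_pos
    nlinarith
  have hsp : 0 < √(2 * Real.pi * σ) := Real.sqrt_pos.2 (by have := Real.pi_pos; positivity)
  have hsp' : 0 < √(2 * Real.pi) := Real.sqrt_pos.2 (by have := Real.pi_pos; positivity)
  have hinv : (√(2 * Real.pi))⁻¹ ≤ 2 * (√(2 * Real.pi * σ))⁻¹ := by
    rw [← div_eq_mul_inv, le_div_iff₀ hsp, inv_mul_le_iff₀ hsp']
    linarith
  have hexp : Real.exp (-g ^ 2 / 2) ≤ 3 * Real.exp (-g ^ 2 / (2 * σ)) := by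
    have e : -g ^ 2 / 2 = g ^ 2 * (1 - σ) / (2 * σ) + -g ^ 2 / (2 * σ) := by
      field_simp
      ring
    rw [e, Real.exp_add]
    refine mul_le_mul_of_nonneg_right ?_ (Real.exp_pos _).le
    have h3 : g ^ 2 * (1 - σ) / (2 * σ) ≤ 1 := by
      rw [div_le_one (by positivity)]
      have q1 : g ^ 2 * (1 - σ) ≤ g ^ 2 * θ :=
        mul_le_mul_of_nonneg_left (by linarith) (sq_nonneg _)
      have q2 : g ^ 2 * θ ≤ 1 := by rwa [le_div_iff₀ hθ] at hg
      linarith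
    have := Real.exp_le_exp.2 h3
    have := Real.exp_one_lt_three
    linarith
  calc _ ≤ (2 * (√(2 * Real.pi * σ))⁻¹) * (3 * Real.exp (-g ^ 2 / (2 * σ))) :=
        mul_le_mul hinv hexp (Real.exp_pos _).le (by positivity)
    _ = _ := by ring

theorem gaussianReal_restrict_le {θ : ℝ} (hθ : 0 < θ) (hθ' : θ ≤ 1 / 2) {σ : ℝ≥0}
    (h1 : 1 - θ ≤ σ) (h2 : σ ≤ 1 + θ) :
    (gaussianReal 0 1).restrict {g | 1 / θ < g ^ 2}ᶜ ≤ (6 : ℝ≥0∞) • gaussianReal 0 σ := by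
  have hσ : σ ≠ 0 := by
    have : (0 : ℝ) < σ := by linarith
    exact_mod_cast this.ne'
  have hS : MeasurableSet {g : ℝ | 1 / θ < g ^ 2}ᶜ :=
    (measurableSet_lt measurable_const (by fun_prop)).compl
  refine Measure.le_iff.2 fun s hs => ?_
  rw [Measure.restrict_apply hs, Measure.smul_apply, smul_eq_mul, gaussianReal_apply _ one_ne_zero,
    gaussianReal_apply _ hσ, ← lintegral_const_mul _ (measurable_gaussianPDF _ _)]
  refine (setLIntegral_mono (measurable_gaussianPDF _ _ |>.const_mul _) fun g hg => ?_).trans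
    (lintegral_mono_set Set.inter_subset_left)
  have hg' : g ^ 2 ≤ 1 / θ := not_lt.1 hg.2
  have := gaussianPDFReal_one_le hθ hθ' h1 h2 hg'
  simp only [gaussianPDF]
  refine (ENNReal.ofReal_le_ofReal this).trans (le_of_eq ?_)
  rw [ENNReal.ofReal_mul (by norm_num)]
  norm_num

/-- Each kernel is the Fourier transform of a Gaussian law, so its quadratic form is the integral of
one nonnegative function `Q` against that law. Off the tail set the two laws are comparable with
factor 6; the error matrix is the Fourier transform of the standard law restricted to the tail. -/
theorem isDominated_exp_sq {ι : Type*} [Fintype ι] {θ : ℝ} (hθ : 0 < θ) (hθ' : θ ≤ 1 / 2) {σ : ℝ}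
    (h1 : 1 - θ ≤ σ) (h2 : σ ≤ 1 + θ) (v : ι → ℝ) :
    IsDominated 6 (6 * gaussianTail θ) (Matrix.of fun i j => Real.exp (-(v i - v j) ^ 2))
      (Matrix.of fun i j => Real.exp (-(σ * (v i - v j) ^ 2))) := by
  lift σ to ℝ≥0 using by linarith
  set S : Set ℝ := {g | 1 / θ < g ^ 2} with hS
  have hSm : MeasurableSet S := measurableSet_lt measurable_const (by fun_prop)
  -- The factor `√2` cancels the `1 / 2` in the Gaussian characteristic function.
  set w : ι → ℝ := fun i => √2 * v i with hw
  have hcos : ∀ (s : ℝ≥0) (i j : ι), ∫ g, Real.cos ((w i - w j) * g) ∂(gaussianReal 0 s) =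
      Real.exp (-(s * (v i - v j) ^ 2)) := by
    intro s i j
    rw [integral_cos_gaussianReal]
    congr 2
    rw [hw, ← mul_sub, mul_pow, Real.sq_sqrt (by norm_num)]
    ring
  refine ⟨Matrix.of fun i j => ∫ g in S, Real.cos ((w i - w j) * g) ∂(gaussianReal 0 1),
    posSemidef_integral_cos _ w, fun i => ?_, ?_⟩
  · simp only [Matrix.of_apply, sub_self, zero_mul, Real.cos_zero, setIntegral_const, smul_eq_mul,
      mul_one]
    have := gaussianTail_nonneg θ
    change gaussianTail θ ≤ _
    linarith
  · refine posSemidef_iff_sum.2 ⟨fun i j => ?_, fun α => ?_⟩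
    · have hsymm := (posSemidef_iff_sum.1
        (posSemidef_integral_cos ((gaussianReal 0 1).restrict S) w)).1 i j
      simp only [Matrix.of_apply] at hsymm
      simp only [Matrix.sub_apply, Matrix.add_apply, Matrix.smul_apply, Matrix.of_apply, hsymm]
      rw [show (v i - v j) ^ 2 = (v j - v i) ^ 2 by ring]
    · have e : ∀ i j, α i * α j * ((6 : ℝ) • (Matrix.of fun i j =>
          Real.exp (-((σ : ℝ) * (v i - v j) ^ 2))) + (Matrix.of fun i j =>
          ∫ g in S, Real.cos ((w i - w j) * g) ∂(gaussianReal 0 1)) -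
          Matrix.of fun i j => Real.exp (-(v i - v j) ^ 2)) i j =
          6 * (α i * α j * ∫ g, Real.cos ((w i - w j) * g) ∂(gaussianReal 0 σ)) +
          α i * α j * ∫ g, Real.cos ((w i - w j) * g) ∂((gaussianReal 0 1).restrict S) -
          α i * α j * ∫ g, Real.cos ((w i - w j) * g) ∂(gaussianReal 0 1) := by
        intro i j
        rw [hcos, hcos]
        simp
        ring
      simp only [e, Finset.sum_sub_distrib, Finset.sum_add_distrib, ← Finset.mul_sum]
      rw [sum_mul_integral_cos, sum_mul_integral_cos, sum_mul_integral_cos]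
      set Q : ℝ → ℝ := fun g =>
        (∑ i, α i * Real.cos (w i * g)) ^ 2 + (∑ i, α i * Real.sin (w i * g)) ^ 2 with hQ
      have hQi : ∀ (m : Measure ℝ) [IsFiniteMeasure m], Integrable Q m := by
        intro m _
        have : ∀ g, Q g = ∑ i, ∑ j, α i * α j * Real.cos ((w i - w j) * g) := fun g => by
          simp only [hQ]
          rw [← sum_mul_cos_sub]
          simp only [sub_mul]
        rw [funext this]
        exact integrable_finsetSum _ fun i _ => integrable_finsetSum _ fun j _ =>
          (integrable_cos_mul m _).const_mul _
      have hsplit := integral_add_compl hSm (hQi (gaussianReal 0 1))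
      have hle : ∫ g in Sᶜ, Q g ∂(gaussianReal 0 1) ≤ ∫ g, Q g ∂((6 : ℝ≥0∞) • gaussianReal 0 σ) := by
        refine integral_mono_measure (gaussianReal_restrict_le hθ hθ' h1 h2)
          (Filter.Eventually.of_forall fun g => by positivity) ?_
        exact (hQi _).smul_measure (by norm_num)
      rw [integral_smul_measure] at hle
      norm_num at hle
      linarith

/-- Take an orthonormal eigenbasis of `T* T`; its vectors have orthogonal images. -/
theorem exists_orthonormalBasis_orthogonal_image {m : ℕ} {W : Type*} [NormedAddCommGroup W]
    [InnerProductSpace ℝ W] [FiniteDimensional ℝ W] (T : EuclideanSpace ℝ (Fin m) →ₗ[ℝ] W) :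
    ∃ b : OrthonormalBasis (Fin m) ℝ (EuclideanSpace ℝ (Fin m)), ∀ v,
      ‖T v‖ ^ 2 = ∑ k, ‖T (b k)‖ ^ 2 * ⟪b k, v⟫_ℝ ^ 2 := by
  have hT : (T.adjoint ∘ₗ T).IsSymmetric := fun x y => by
    rw [LinearMap.comp_apply, LinearMap.comp_apply, LinearMap.adjoint_inner_left,
      LinearMap.adjoint_inner_right]
  have hn : Module.finrank ℝ (EuclideanSpace ℝ (Fin m)) = m := by simp
  set b := hT.eigenvectorBasis hn with hb
  have hval : ∀ k v, ⟪T (b k), T v⟫_ℝ = hT.eigenvalues hn k * ⟪b k, v⟫_ℝ := by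
    intro k v
    have h := hT.apply_eigenvectorBasis hn k
    rw [← LinearMap.adjoint_inner_left]
    change ⟪(T.adjoint ∘ₗ T) (b k), v⟫_ℝ = _
    rw [hb, h, inner_smul_left]
    simp
  refine ⟨b, fun v => ?_⟩
  have hself : ∀ k, ‖T (b k)‖ ^ 2 = hT.eigenvalues hn k := by
    intro k
    rw [← real_inner_self_eq_norm_sq, hval, real_inner_self_eq_norm_sq, b.norm_eq_one]
    ring
  have h1 : ‖T v‖ ^ 2 = ⟪(T.adjoint ∘ₗ T) v, v⟫_ℝ := by
    rw [LinearMap.comp_apply, LinearMap.adjoint_inner_left, real_inner_self_eq_norm_sq]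
  rw [h1, ← b.sum_inner_mul_inner]
  refine Finset.sum_congr rfl fun k _ => ?_
  rw [LinearMap.comp_apply, LinearMap.adjoint_inner_left, real_inner_comm, hval, hself]
  ring

/-- `T` changes squared norms by a factor between `1 - θ` and `1 + θ`. -/
def IsNearIsometry {V W : Type*} [NormedAddCommGroup V] [NormedAddCommGroup W] (θ : ℝ)
    (T : V → W) : Prop :=
  ∀ v, (1 - θ) * ‖v‖ ^ 2 ≤ ‖T v‖ ^ 2 ∧ ‖T v‖ ^ 2 ≤ (1 + θ) * ‖v‖ ^ 2

theorem posSemidef_exp_sq {ι : Type*} [Fintype ι] {σ : ℝ} (hσ : 0 ≤ σ) (v : ι → ℝ) :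
    (Matrix.of fun i j => Real.exp (-(σ * (v i - v j) ^ 2))).PosSemidef := by
  lift σ to ℝ≥0 using hσ
  have h := posSemidef_integral_cos (gaussianReal 0 σ) fun i => √2 * v i
  have e : (Matrix.of fun i j => Real.exp (-((σ : ℝ) * (v i - v j) ^ 2))) =
      Matrix.of fun i j => ∫ g, Real.cos ((√2 * v i - √2 * v j) * g) ∂gaussianReal 0 σ := by
    ext i j
    rw [Matrix.of_apply, Matrix.of_apply, integral_cos_gaussianReal, ← mul_sub, mul_pow, Real.sq_sqrt (by norm_num)]
    congr 1
    ring
  rw [e]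
  exact h

/-- Domination of Gaussian kernels of arbitrary width by their images under near isometries. -/
theorem exists_isDominated_gaussian (m : ℕ) : ∃ C : ℝ, 0 ≤ C ∧
    ∀ (ι : Type) [Fintype ι] (p : ℕ) (T : EuclideanSpace ℝ (Fin m) →ₗ[ℝ] EuclideanSpace ℝ (Fin p))
      (θ : ℝ), 0 < θ → θ ≤ 1 / 2 → IsNearIsometry θ T →
      ∀ (x : ι → EuclideanSpace ℝ (Fin m)) (s : ℝ), 0 ≤ s →
        IsDominated C (C * gaussianTail θ)
          (Matrix.of fun i j => Real.exp (-(s * ‖x i - x j‖ ^ 2)))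
          (Matrix.of fun i j => Real.exp (-(s * ‖T (x i) - T (x j)‖ ^ 2))) := by
  obtain ⟨C, hC, h⟩ := exists_isDominated_prod (Finset.univ : Finset (Fin m)) (fun _ => 6)
    fun _ => by norm_num
  refine ⟨C, hC, fun ι _ p T θ hθ hθ' hT x s hs => ?_⟩
  -- In this basis both Gaussian kernels factor over the `m` coordinates, and the image only
  -- rescales the `k`-th variance by `‖T (b k)‖²`. Hence the constant depends on `m` but not on the
  -- target dimension `p`.
  obtain ⟨b, hb⟩ := exists_orthonormalBasis_orthogonal_image T
  have hσ : ∀ k, 1 - θ ≤ ‖T (b k)‖ ^ 2 ∧ ‖T (b k)‖ ^ 2 ≤ 1 + θ := fun k => by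
    have := hT (b k)
    simpa [b.norm_eq_one] using this
  let v : Fin m → ι → ℝ := fun k i => √s * ⟪b k, x i⟫_ℝ
  have hv : ∀ k i j, (v k i - v k j) ^ 2 = s * ⟪b k, x i - x j⟫_ℝ ^ 2 := fun k i j => by
    simp only [v]
    rw [← mul_sub, mul_pow, Real.sq_sqrt hs, inner_sub_right]
  obtain ⟨hdom, -⟩ := h ι (gaussianTail θ) (gaussianTail_nonneg θ) (gaussianTail_le_one θ)
    (fun k => Matrix.of fun i j => Real.exp (-(v k i - v k j) ^ 2))
    (fun k => Matrix.of fun i j => Real.exp (-(‖T (b k)‖ ^ 2 * (v k i - v k j) ^ 2)))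
    (fun k _ => by simpa using posSemidef_exp_sq zero_le_one (v k))
    (fun k _ => posSemidef_exp_sq (sq_nonneg _) (v k))
    (fun k _ i => by simp)
    (fun k _ => isDominated_exp_sq hθ hθ' (hσ k).1 (hσ k).2 (v k))
  have e1 : (Matrix.of fun i j => Real.exp (-(s * ‖x i - x j‖ ^ 2))) =
      Matrix.of fun i j => ∏ k, Matrix.of (fun i j => Real.exp (-(v k i - v k j) ^ 2)) i j := by
    ext i j
    simp only [Matrix.of_apply, ← Real.exp_sum, hv, Finset.sum_neg_distrib, ← Finset.mul_sum]
    rw [← b.sum_sq_norm_inner_right (x i - x j)]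
    simp
  have e2 : (Matrix.of fun i j => Real.exp (-(s * ‖T (x i) - T (x j)‖ ^ 2))) =
      Matrix.of fun i j => ∏ k, Matrix.of
        (fun i j => Real.exp (-(‖T (b k)‖ ^ 2 * (v k i - v k j) ^ 2))) i j := by
    ext i j
    simp only [Matrix.of_apply, ← Real.exp_sum, hv, Finset.sum_neg_distrib]
    rw [← map_sub, hb, Finset.mul_sum]
    congr 2
    refine Finset.sum_congr rfl fun k _ => by ring
  rw [e1, e2]
  exact hdom

end Gaussian

/-! ### Profiles that are positive semidefinite in every dimension -/

section Profiles

/-- The function `h` of the squared distance or of the inner product is a positive semidefinite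
kernel in every dimension. -/
def IsProfile (F : KernelForm) (h : ℝ → ℝ) : Prop :=
  ∀ (m : ℕ) (ι : Type) [Fintype ι] (x : ι → EuclideanSpace ℝ (Fin m)) (α : ι → ℝ),
    0 ≤ ∑ i, ∑ j, α i * α j * h (F.arg (x i) (x j))

theorem ModeKernel.isProfile (κ : ModeKernel) : IsProfile κ.form κ.profile := by
  intro m ι _ x α
  exact (posSemidef_iff_sum.1 ((κ.posSemidef m).submatrix x)).2 α

theorem KernelForm.arg_comm (F : KernelForm) {m : ℕ} (a b : EuclideanSpace ℝ (Fin m)) :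
    F.arg a b = F.arg b a := by
  cases F
  · simp [KernelForm.arg, norm_sub_rev]
  · simp [KernelForm.arg, real_inner_comm]

theorem IsProfile.posSemidef {F : KernelForm} {h : ℝ → ℝ} (hh : IsProfile F h) {m : ℕ} {ι : Type}
    [Fintype ι] (x : ι → EuclideanSpace ℝ (Fin m)) :
    (Matrix.of fun i j => h (F.arg (x i) (x j))).PosSemidef :=
  posSemidef_iff_sum.2 ⟨fun i j => by simp only [Matrix.of_apply, F.arg_comm], hh m ι x⟩

/-- The concatenation of two vectors. -/
def euclideanAppend {m p : ℕ} (x : EuclideanSpace ℝ (Fin m)) (u : EuclideanSpace ℝ (Fin p)) :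
    EuclideanSpace ℝ (Fin (m + p)) :=
  WithLp.toLp 2 (Fin.append x u)

theorem KernelForm.arg_append (F : KernelForm) {m p : ℕ} (x y : EuclideanSpace ℝ (Fin m))
    (u v : EuclideanSpace ℝ (Fin p)) :
    F.arg (euclideanAppend x u) (euclideanAppend y v) = F.arg x y + F.arg u v := by
  cases F
  · simp [KernelForm.arg, euclideanAppend, EuclideanSpace.real_norm_sq_eq, Fin.sum_univ_add]
  · simp [KernelForm.arg, euclideanAppend, PiLp.inner_apply, Fin.sum_univ_add]

/-- Append the vectors `u a` in extra coordinates: the scalar arguments add. Positivity in every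
dimension thus yields positivity of averages and differences of translates. -/
theorem IsProfile.sum_shift {F : KernelForm} {h : ℝ → ℝ} (hh : IsProfile F h) {p : ℕ} {A : Type}
    [Fintype A] (u : A → EuclideanSpace ℝ (Fin p)) (β : A → ℝ) :
    IsProfile F fun t => ∑ a, ∑ b, β a * β b * h (t + F.arg (u a) (u b)) := by
  intro m ι _ x α
  refine (hh (m + p) (ι × A) (fun q => euclideanAppend (x q.1) (u q.2))
    fun q => α q.1 * β q.2).trans_eq ?_
  simp only [F.arg_append, Fintype.sum_prod_type, Finset.mul_sum]
  refine Finset.sum_congr rfl fun i _ => ?_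
  rw [Finset.sum_comm]
  refine Finset.sum_congr rfl fun j _ => Finset.sum_congr rfl fun a _ =>
    Finset.sum_congr rfl fun b _ => by ring

theorem IsProfile.const_mul {F : KernelForm} {h : ℝ → ℝ} (hh : IsProfile F h) {c : ℝ}
    (hc : 0 ≤ c) : IsProfile F fun t => c * h t := by
  intro m ι _ x α
  have := mul_nonneg hc (hh m ι x α)
  simp only [Finset.mul_sum] at this
  refine this.trans_eq ?_
  refine Finset.sum_congr rfl fun i _ => Finset.sum_congr rfl fun j _ => by ring

theorem IsProfile.of_tendsto {F : KernelForm} {f : ℕ → ℝ → ℝ} {h : ℝ → ℝ}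
    (hf : ∀ n, IsProfile F (f n))
    (hlim : ∀ t, Filter.Tendsto (fun n => f n t) Filter.atTop (nhds (h t))) : IsProfile F h := by
  intro m ι _ x α
  exact ge_of_tendsto' (tendsto_finsetSum _ fun i _ => tendsto_finsetSum _ fun j _ =>
    (hlim _).const_mul _) fun n => hf n m ι x α

/-- Use the two points `0` and `√τ` with weights `1` and `-1`. -/
theorem IsProfile.distance_sub_shift {h : ℝ → ℝ} (hh : IsProfile .distance h) {τ : ℝ}
    (hτ : 0 ≤ τ) : IsProfile .distance fun t => h t - h (t + τ) := by
  have h1 := (hh.sum_shift (p := 1) ![0, EuclideanSpace.single 0 (√τ)] ![1, -1]).const_mul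
    (c := 1 / 2) (by norm_num)
  convert h1 using 2 with t
  simp [KernelForm.arg, Real.sq_sqrt hτ]
  ring

/-- Average over `n + 1` points at mutual squared distance `τ`, namely orthogonal vectors of squared
length `τ / 2`. The diagonal contributes a fraction `1 / (n + 1)`, which vanishes in the limit. -/
theorem IsProfile.distance_shift {h : ℝ → ℝ} (hh : IsProfile .distance h) {τ : ℝ}
    (hτ : 0 ≤ τ) : IsProfile .distance fun t => h (t + τ) := by
  obtain ⟨r, hr⟩ : ∃ r : ℝ, r ^ 2 = τ / 2 := ⟨√(τ / 2), Real.sq_sqrt (by positivity)⟩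
  have hn : ∀ n : ℕ, IsProfile .distance fun t =>
      h (t + τ) + (1 / ((n : ℝ) + 1)) * (h t - h (t + τ)) := by
    intro n
    have h1 := hh.sum_shift (p := n + 1)
      (fun a : Fin (n + 1) => EuclideanSpace.single a r) fun _ => 1 / ((n : ℝ) + 1)
    convert h1 using 2 with t
    have harg : ∀ a b : Fin (n + 1), h (t + KernelForm.distance.arg
        (EuclideanSpace.single a r) (EuclideanSpace.single b r)) =
        h (t + τ) + if a = b then h t - h (t + τ) else 0 := by
      intro a b
      by_cases hab : a = b
      · subst hab
        simp [KernelForm.arg]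
      · have : ‖(EuclideanSpace.single a r : EuclideanSpace ℝ (Fin (n + 1))) -
            EuclideanSpace.single b r‖ ^ 2 = τ := by
          rw [norm_sub_sq_real]
          simp [EuclideanSpace.inner_single_left, hab, hr]
        simp [KernelForm.arg, this, hab]
    simp only [harg]
    have hne : (n : ℝ) + 1 ≠ 0 := by positivity
    simp [mul_add, Finset.sum_add_distrib]
    field_simp
  refine IsProfile.of_tendsto hn fun t => ?_
  have := (tendsto_one_div_add_atTop_nhds_zero_nat (𝕜 := ℝ)).mul_const (h t - h (t + τ))
  simpa using this.const_add (h (t + τ))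

theorem IsProfile.distance_nonneg {h : ℝ → ℝ} (hh : IsProfile .distance h) {t : ℝ}
    (ht : 0 ≤ t) : 0 ≤ h t := by
  simpa [KernelForm.arg] using
    hh.distance_shift ht 0 Unit (fun _ => (0 : EuclideanSpace ℝ (Fin 0))) fun _ => 1

/-! ### Completely monotone functions as limits of exponential mixtures -/

/-- Translation of the argument by `τ`, as a linear operator. -/
def shiftOp (τ : ℝ) : Module.End ℝ (ℝ → ℝ) where
  toFun h t := h (t + τ)
  map_add' _ _ := rfl
  map_smul' _ _ := rfl

theorem shiftOp_pow_apply (τ : ℝ) (k : ℕ) (h : ℝ → ℝ) (t : ℝ) :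
    (shiftOp τ ^ k) h t = h (t + k * τ) := by
  induction k generalizing t with
  | zero => simp
  | succ k ih =>
    rw [pow_succ', Module.End.mul_apply]
    change (shiftOp τ ^ k) h (t + τ) = _
    rw [ih]
    congr 1
    push_cast
    ring

/-- Together with `IsProfile.distance_nonneg`, this is complete monotonicity in terms of finite
differences. -/
theorem IsProfile.pow_one_sub_shiftOp {h : ℝ → ℝ} (hh : IsProfile .distance h) {τ : ℝ}
    (hτ : 0 ≤ τ) (k : ℕ) : IsProfile .distance (((1 - shiftOp τ) ^ k) h) := by
  induction k with
  | zero => simpa using hh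
  | succ k ih =>
    rw [pow_succ', Module.End.mul_apply]
    exact ih.distance_sub_shift hτ

/-- Expand `1 = (S + (1 - S)) ^ M` for the shift `S`. -/
theorem sum_choose_mul_shiftOp (τ : ℝ) (h : ℝ → ℝ) (M : ℕ) (s : ℝ) :
    ∑ i ∈ Finset.range (M + 1), (M.choose i : ℝ) * ((1 - shiftOp τ) ^ (M - i)) h (s + i * τ) =
      h s := by
  have hc : Commute (shiftOp τ) (1 - shiftOp τ) :=
    (Commute.one_right _).sub_right (Commute.refl _)
  have h1 := hc.add_pow M
  rw [add_sub_cancel, one_pow] at h1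
  have h2 := congrFun (congrArg (fun A : Module.End ℝ (ℝ → ℝ) => A h) h1) s
  simp only [Module.End.one_apply] at h2
  rw [h2, LinearMap.sum_apply, Finset.sum_apply]
  refine Finset.sum_congr rfl fun i _ => ?_
  rw [← Nat.cast_comm, Module.End.mul_apply, Module.End.natCast_apply, Pi.smul_apply,
    Module.End.mul_apply, shiftOp_pow_apply, nsmul_eq_mul]

/-- The weights of the Bernstein approximation of `h` on the lattice with spacing `τ`. -/
def bernsteinWeight (τ : ℝ) (h : ℝ → ℝ) (N j : ℕ) : ℝ :=
  N.choose j * ((1 - shiftOp τ) ^ (N - j)) h (j * τ)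

theorem bernsteinWeight_nonneg {h : ℝ → ℝ} (hh : IsProfile .distance h) {τ : ℝ} (hτ : 0 ≤ τ)
    (N j : ℕ) : 0 ≤ bernsteinWeight τ h N j :=
  mul_nonneg (by positivity) ((hh.pow_one_sub_shiftOp hτ _).distance_nonneg (by positivity))

/-- As in the Hausdorff moment problem, the binomial moments of the nonnegative weights reproduce
the values of `h` on the lattice exactly. -/
theorem sum_choose_mul_bernsteinWeight (τ : ℝ) (h : ℝ → ℝ) {N k : ℕ} (hk : k ≤ N) :
    ∑ j ∈ Finset.range (N + 1), (j.choose k : ℝ) * bernsteinWeight τ h N j =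
      N.choose k * h (k * τ) := by
  obtain ⟨M, rfl⟩ := Nat.exists_eq_add_of_le hk
  rw [add_assoc, Finset.sum_range_add]
  have h0 : ∑ j ∈ Finset.range k, (j.choose k : ℝ) * bernsteinWeight τ h (k + M) j = 0 :=
    Finset.sum_eq_zero fun j hj => by
      rw [Nat.choose_eq_zero_of_lt (Finset.mem_range.1 hj)]
      simp
  rw [h0, zero_add, ← sum_choose_mul_shiftOp τ h M (k * τ), Finset.mul_sum]
  refine Finset.sum_congr rfl fun i hi => ?_
  have hi' : i ≤ M := Nat.lt_succ_iff.1 (Finset.mem_range.1 hi)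
  have hch : (k + M).choose (k + i) * (k + i).choose k = (k + M).choose k * M.choose i := by
    rw [Nat.choose_mul (Nat.le_add_right k i)]
    simp
  have hch' : ((k + M).choose (k + i) : ℝ) * (k + i).choose k = (k + M).choose k * M.choose i := by
    exact_mod_cast hch
  rw [bernsteinWeight, ← mul_assoc, mul_comm ((k + i).choose k : ℝ), hch', Nat.add_sub_add_left]
  rw [mul_assoc, show ((k + i : ℕ) : ℝ) * τ = k * τ + i * τ by push_cast; ring]

/-- The quotient is a product of `k` factors `(j - i) / (N - i)` (truncated subtraction), each close
to the base of the power. This turns binomial moments into ordinary ones. The base `(j + 1) / (N +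
1)` rather than `j / N` is positive, so it has a logarithm. -/
theorem abs_choose_div_choose_sub_pow_le {N j : ℕ} (hj : j ≤ N) (k : ℕ) (hk : k ≤ N) :
    |(j.choose k : ℝ) / N.choose k - (((j : ℝ) + 1) / (N + 1)) ^ k| ≤ (k : ℝ) ^ 2 / (N + 1) := by
  set x : ℝ := ((j : ℝ) + 1) / (N + 1) with hx
  have hjN : (j : ℝ) ≤ N := by exact_mod_cast hj
  have hx0 : 0 ≤ x := by positivity
  have hx1 : x ≤ 1 := by
    rw [hx, div_le_one (by positivity)]
    linarith
  induction k with
  | zero => simp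
  | succ k ih =>
    have hkN : k < N := hk
    have ih := ih hkN.le
    set y : ℝ := ((j - k : ℕ) : ℝ) / ((N - k : ℕ) : ℝ) with hy
    have hNk : (0 : ℝ) < ((N - k : ℕ) : ℝ) := by exact_mod_cast Nat.sub_pos_of_lt hkN
    have hC : (0 : ℝ) < N.choose k := by exact_mod_cast Nat.choose_pos hkN.le
    have hstep : (j.choose (k + 1) : ℝ) / N.choose (k + 1) = (j.choose k : ℝ) / N.choose k * y := by
      have e1 : (j.choose (k + 1) : ℝ) * (k + 1) = j.choose k * ((j - k : ℕ) : ℝ) := by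
        exact_mod_cast Nat.choose_succ_right_eq j k
      have e2 : (N.choose (k + 1) : ℝ) * (k + 1) = N.choose k * ((N - k : ℕ) : ℝ) := by
        exact_mod_cast Nat.choose_succ_right_eq N k
      have hC' : (0 : ℝ) < N.choose (k + 1) := by exact_mod_cast Nat.choose_pos hk
      rw [hy, div_mul_div_comm, ← e1, ← e2]
      field_simp
    have hy0 : 0 ≤ y := by positivity
    have hy1 : y ≤ 1 := by
      rw [hy, div_le_one hNk]
      exact_mod_cast Nat.sub_le_sub_right hj k
    have hyx : |y - x| ≤ (k + 1) / (N + 1) := by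
      rcases le_or_gt k j with hkj | hkj
      · have hsub : x - y = (k + 1) * (N - j) / ((N + 1) * ((N - k : ℕ) : ℝ)) := by
          rw [hx, hy, Nat.cast_sub hkN.le, Nat.cast_sub hkj]
          have : (N : ℝ) - k ≠ 0 := by rw [← Nat.cast_sub hkN.le]; exact hNk.ne'
          field_simp
          ring
        have hle : (N : ℝ) - j ≤ ((N - k : ℕ) : ℝ) := by
          rw [Nat.cast_sub hkN.le]
          have : (k : ℝ) ≤ j := by exact_mod_cast hkj
          linarith
        have hnn : (0 : ℝ) ≤ N - j := by linarith
        rw [abs_sub_comm, hsub, abs_of_nonneg (by positivity), div_le_div_iff₀ (by positivity)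
          (by positivity)]
        have := mul_le_mul_of_nonneg_left hle (by positivity : (0 : ℝ) ≤ (k + 1) * (N + 1))
        linarith
      · have : y = 0 := by rw [hy, Nat.sub_eq_zero_of_le hkj.le]; simp
        rw [this, zero_sub, abs_neg, abs_of_nonneg hx0, hx]
        have : (j : ℝ) ≤ k := by exact_mod_cast hkj.le
        gcongr
    rw [hstep]
    have e : (j.choose k : ℝ) / N.choose k * y - x ^ (k + 1) =
        ((j.choose k : ℝ) / N.choose k - x ^ k) * y + x ^ k * (y - x) := by ring
    rw [e]
    refine (abs_add_le _ _).trans ?_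
    rw [abs_mul, abs_mul, abs_of_nonneg hy0, abs_of_nonneg (pow_nonneg hx0 k)]
    have b1 := mul_le_of_le_one_right (abs_nonneg ((j.choose k : ℝ) / N.choose k - x ^ k)) hy1
    have b2 := mul_le_of_le_one_left (abs_nonneg (y - x)) (pow_le_one₀ hx0 hx1 (n := k))
    have e3 : (((k + 1 : ℕ) : ℝ)) ^ 2 / (N + 1) =
        (k : ℝ) ^ 2 / (N + 1) + (k + 1) / (N + 1) + k / (N + 1) := by
      push_cast
      field_simp
      ring
    rw [e3]
    have : (0 : ℝ) ≤ k / (N + 1) := by positivity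
    linarith

theorem sum_bernsteinWeight (τ : ℝ) (h : ℝ → ℝ) (N : ℕ) :
    ∑ j ∈ Finset.range (N + 1), bernsteinWeight τ h N j = h 0 := by
  simpa using sum_choose_mul_bernsteinWeight τ h (Nat.zero_le N)

theorem abs_sum_bernsteinWeight_mul_pow_sub_le {h : ℝ → ℝ} (hh : IsProfile .distance h) {τ : ℝ}
    (hτ : 0 ≤ τ) {N k : ℕ} (hk : k ≤ N) :
    |∑ j ∈ Finset.range (N + 1), bernsteinWeight τ h N j * (((j : ℝ) + 1) / (N + 1)) ^ k -
      h (k * τ)| ≤ h 0 * ((k : ℝ) ^ 2 / (N + 1)) := by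
  have hC : (N.choose k : ℝ) ≠ 0 := by exact_mod_cast (Nat.choose_pos hk).ne'
  have e : h (k * τ) = ∑ j ∈ Finset.range (N + 1),
      bernsteinWeight τ h N j * ((j.choose k : ℝ) / N.choose k) := by
    have h1 := sum_choose_mul_bernsteinWeight τ h hk
    have h2 : h (k * τ) = (∑ j ∈ Finset.range (N + 1),
        (j.choose k : ℝ) * bernsteinWeight τ h N j) / N.choose k := by
      rw [h1]
      field_simp
    rw [h2, Finset.sum_div]
    refine Finset.sum_congr rfl fun j _ => by ring
  rw [e, ← Finset.sum_sub_distrib, ← sum_bernsteinWeight τ h N, Finset.sum_mul]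
  refine (Finset.abs_sum_le_sum_abs _ _).trans (Finset.sum_le_sum fun j hj => ?_)
  have hw := bernsteinWeight_nonneg hh hτ N j
  rw [← mul_sub, abs_mul, abs_of_nonneg hw, abs_sub_comm]
  exact mul_le_mul_of_nonneg_left
    (abs_choose_div_choose_sub_pow_le (Nat.lt_succ_iff.1 (Finset.mem_range.1 hj)) k hk) hw

/-- A function of the squared distance that is a continuous positive semidefinite kernel in every
dimension is a limit of mixtures of exponentials. -/
theorem exists_exp_mixture {h : ℝ → ℝ} (hh : IsProfile .distance h)
    (hc : ContinuousOn h (Set.Ici 0)) :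
    ∃ (N : ℕ → ℕ) (w s : ℕ → ℕ → ℝ), (∀ m, ∀ j ∈ Finset.range (N m), 0 ≤ w m j) ∧
      (∀ m, ∀ j ∈ Finset.range (N m), 0 ≤ s m j) ∧
      (∀ m, ∑ j ∈ Finset.range (N m), w m j = h 0) ∧
      ∀ t, 0 ≤ t → Filter.Tendsto
        (fun m => ∑ j ∈ Finset.range (N m), w m j * Real.exp (-(s m j * t)))
        Filter.atTop (nhds (h t)) := by
  -- With spacing `1 / (m + 1)`, the point `t` has lattice index `k` of order `m`, so the cubic
  -- number of nodes makes the error `k² / M` of order `1 / m`.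
  let M : ℕ → ℕ := fun m => (m + 1) ^ 3
  let τ : ℕ → ℝ := fun m => 1 / ((m : ℝ) + 1)
  have hτ : ∀ m, 0 ≤ τ m := fun m => by positivity
  let x : ℕ → ℕ → ℝ := fun m j => ((j : ℝ) + 1) / ((M m : ℝ) + 1)
  have hx0 : ∀ m j, 0 < x m j := fun m j => by positivity
  have hx1 : ∀ m, ∀ j ∈ Finset.range (M m + 1), x m j ≤ 1 := fun m j hj => by
    have : (j : ℝ) ≤ M m := by exact_mod_cast Nat.lt_succ_iff.1 (Finset.mem_range.1 hj)
    simp only [x]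
    rw [div_le_one (by positivity)]
    linarith
  refine ⟨fun m => M m + 1, fun m j => bernsteinWeight (τ m) h (M m) j,
    fun m j => ((m : ℝ) + 1) * -Real.log (x m j),
    fun m j _ => bernsteinWeight_nonneg hh (hτ m) _ _, fun m j hj => ?_,
    fun m => sum_bernsteinWeight _ _ _, fun t ht => ?_⟩
  · have := Real.log_nonpos (hx0 m j).le (hx1 m j hj)
    exact mul_nonneg (by positivity) (by linarith)
  · have hexp : ∀ m j : ℕ, Real.exp (-(((m : ℝ) + 1) * -Real.log (x m j) * t)) =
        x m j ^ (t * ((m : ℝ) + 1)) := fun m j => by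
      rw [Real.rpow_def_of_pos (hx0 m j)]
      congr 1
      ring
    simp only [hexp]
    -- The exponent `t (m + 1)` need not be an integer. As the bases are at most 1, the mixture lies
    -- between the moments of orders `k + 1` and `k`, both of which tend to `h t`.
    let k : ℕ → ℕ := fun m => ⌊t * ((m : ℝ) + 1)⌋₊
    let b : ℕ → ℕ → ℝ := fun m i =>
      ∑ j ∈ Finset.range (M m + 1), bernsteinWeight (τ m) h (M m) j * x m j ^ i
    have hk : ∀ m : ℕ, (k m : ℝ) ≤ t * ((m : ℝ) + 1) := fun m => Nat.floor_le (by positivity)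
    have hk' : ∀ m : ℕ, t * ((m : ℝ) + 1) ≤ ((k m + 1 : ℕ) : ℝ) := fun m => by
      push_cast
      exact (Nat.lt_floor_add_one _).le
    have hlow : ∀ m, b m (k m + 1) ≤ ∑ j ∈ Finset.range (M m + 1),
        bernsteinWeight (τ m) h (M m) j * x m j ^ (t * ((m : ℝ) + 1)) := fun m =>
      Finset.sum_le_sum fun j hj => mul_le_mul_of_nonneg_left (by
        rw [← Real.rpow_natCast]
        exact Real.rpow_le_rpow_of_exponent_ge (hx0 m j) (hx1 m j hj) (hk' m))
        (bernsteinWeight_nonneg hh (hτ m) _ _)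
    have hup : ∀ m, ∑ j ∈ Finset.range (M m + 1),
        bernsteinWeight (τ m) h (M m) j * x m j ^ (t * ((m : ℝ) + 1)) ≤ b m (k m) := fun m =>
      Finset.sum_le_sum fun j hj => mul_le_mul_of_nonneg_left (by
        rw [← Real.rpow_natCast]
        exact Real.rpow_le_rpow_of_exponent_ge (hx0 m j) (hx1 m j hj) (hk m))
        (bernsteinWeight_nonneg hh (hτ m) _ _)
    have hinv := tendsto_one_div_add_atTop_nhds_zero_nat (𝕜 := ℝ)
    have hlim : ∀ a : ℕ, a ≤ 1 → Filter.Tendsto (fun m => b m (k m + a)) Filter.atTop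
        (nhds (h t)) := by
      intro a ha
      have ha' : (a : ℝ) ≤ 1 := by exact_mod_cast ha
      have hkt : Filter.Tendsto (fun m => ((k m + a : ℕ) : ℝ) * τ m) Filter.atTop (nhds t) := by
        have hlo : Filter.Tendsto (fun m : ℕ => t - 1 / ((m : ℝ) + 1)) Filter.atTop (nhds t) := by
          simpa using hinv.const_sub t
        have hhi : Filter.Tendsto (fun m : ℕ => t + 1 / ((m : ℝ) + 1)) Filter.atTop (nhds t) := by
          simpa using hinv.const_add t
        refine tendsto_of_tendsto_of_tendsto_of_le_of_le hlo hhi (fun m => ?_) fun m => ?_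
        · have h1 := hk' m
          have ha0 : (0 : ℝ) ≤ a := by positivity
          push_cast at h1 ⊢
          simp only [τ]
          rw [mul_one_div, le_div_iff₀ (by positivity)]
          have : 1 / ((m : ℝ) + 1) * ((m : ℝ) + 1) = 1 := by field_simp
          linarith
        · have h1 := hk m
          push_cast
          simp only [τ]
          rw [mul_one_div, div_le_iff₀ (by positivity)]
          have : 1 / ((m : ℝ) + 1) * ((m : ℝ) + 1) = 1 := by field_simp
          linarith
      have hcont : Filter.Tendsto (fun m => h (((k m + a : ℕ) : ℝ) * τ m)) Filter.atTop
          (nhds (h t)) := by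
        refine (hc t ht).tendsto.comp (tendsto_nhdsWithin_iff.2 ⟨hkt, ?_⟩)
        exact Filter.Eventually.of_forall fun m => mul_nonneg (by positivity) (hτ m)
      have herr : Filter.Tendsto (fun m : ℕ => h 0 * ((t + 1) ^ 2 * (1 / ((m : ℝ) + 1))))
          Filter.atTop (nhds 0) := by
        simpa using (hinv.const_mul ((t + 1) ^ 2)).const_mul (h 0)
      have hdiff : Filter.Tendsto (fun m => b m (k m + a) - h (((k m + a : ℕ) : ℝ) * τ m))
          Filter.atTop (nhds 0) := by
        refine squeeze_zero_norm' ?_ herr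
        obtain ⟨m₀, hm₀⟩ := exists_nat_ge (t + 1)
        filter_upwards [Filter.eventually_ge_atTop m₀] with m hm
        have hm' : t + 1 ≤ (m : ℝ) + 1 := by
          have : (m₀ : ℝ) ≤ m := by exact_mod_cast hm
          linarith
        have hm1 : (1 : ℝ) ≤ (m : ℝ) + 1 := by
          have : (0 : ℝ) ≤ m := by positivity
          linarith
        have hkm : ((k m + a : ℕ) : ℝ) ≤ (t + 1) * ((m : ℝ) + 1) := by
          have := hk m
          push_cast
          linarith
        have hkM : k m + a ≤ M m := by
          have : ((k m + a : ℕ) : ℝ) ≤ ((M m : ℕ) : ℝ) := by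
            refine hkm.trans ?_
            simp only [M]
            push_cast
            calc (t + 1) * ((m : ℝ) + 1) ≤ ((m : ℝ) + 1) * ((m : ℝ) + 1) := by gcongr
              _ = ((m : ℝ) + 1) ^ 2 := by ring
              _ ≤ ((m : ℝ) + 1) ^ 3 := pow_le_pow_right₀ hm1 (by norm_num)
          exact_mod_cast this
        have h1 := abs_sum_bernsteinWeight_mul_pow_sub_le hh (hτ m) hkM
        rw [Real.norm_eq_abs]
        refine h1.trans (mul_le_mul_of_nonneg_left ?_ (hh.distance_nonneg le_rfl))
        rw [mul_one_div, div_le_div_iff₀ (by positivity) (by positivity)]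
        have h2 : ((k m + a : ℕ) : ℝ) ^ 2 ≤ ((t + 1) * ((m : ℝ) + 1)) ^ 2 := by gcongr
        have h3 : ((M m : ℕ) : ℝ) = ((m : ℝ) + 1) ^ 3 := by simp [M]
        rw [h3]
        have h4 := mul_le_mul_of_nonneg_right h2 (by positivity : (0 : ℝ) ≤ (m : ℝ) + 1)
        nlinarith [sq_nonneg (t + 1)]
      simpa using hdiff.add hcont
    exact tendsto_of_tendsto_of_tendsto_of_le_of_le (hlim 1 le_rfl) (hlim 0 zero_le_one) hlow hup

/-! ### Lipschitz functions of the inner product -/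

/-- Use two orthogonal vectors of length `√τ` with weights `1` and `-1`: the diagonal gives `t + τ`,
the off-diagonal `t`. -/
theorem IsProfile.innerProduct_shift_sub {h : ℝ → ℝ} (hh : IsProfile .innerProduct h) {τ : ℝ}
    (hτ : 0 ≤ τ) : IsProfile .innerProduct fun t => h (t + τ) - h t := by
  have h1 := (hh.sum_shift (p := 2) (fun a : Fin 2 => EuclideanSpace.single a (√τ))
    ![1, -1]).const_mul (c := 1 / 2) (by norm_num)
  convert h1 using 2 with t
  simp [KernelForm.arg, EuclideanSpace.inner_single_left, Real.mul_self_sqrt hτ]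
  ring

theorem IsProfile.innerProduct_nonneg {h : ℝ → ℝ} (hh : IsProfile .innerProduct h) {t : ℝ}
    (ht : 0 ≤ t) : 0 ≤ h t := by
  simpa [KernelForm.arg, EuclideanSpace.inner_single_left, Real.sq_sqrt ht] using
    hh 1 Unit (fun _ => EuclideanSpace.single 0 (√t)) fun _ => 1

/-- For the vectors `t • e` and `e` the diagonal entries `h (t²)` and `h 1` vanish, which forces the
off-diagonal entry `h t` to vanish. -/
theorem IsProfile.innerProduct_eq_zero {h : ℝ → ℝ} (hh : IsProfile .innerProduct h)
    (h0 : ∀ t, 0 ≤ t → h t = 0) (t : ℝ) : h t = 0 := by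
  have key : ∀ s : ℝ, 0 ≤ 2 * s * h t := by
    intro s
    have := hh 1 (Fin 2) ![EuclideanSpace.single 0 t, EuclideanSpace.single 0 1] ![1, s]
    simp [KernelForm.arg, EuclideanSpace.inner_single_left, h0 (t ^ 2) (sq_nonneg t),
      h0 1 zero_le_one] at this
    linarith
  have h1 := key 1
  have h2 := key (-1)
  linarith

/-- A Lipschitz function of the inner product that is a positive semidefinite kernel in every
dimension is affine. -/
theorem IsProfile.innerProduct_affine {h : ℝ → ℝ} (hh : IsProfile .innerProduct h) {L : ℝ≥0}
    (hL : LipschitzWith L h) : ∃ a b : ℝ, 0 ≤ a ∧ 0 ≤ b ∧ ∀ t, h t = a + b * t := by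
  have hdiff : ∀ τ, 0 ≤ τ → ∀ σ, 0 ≤ σ → ∀ t,
      (h (t + σ + τ) - h (t + σ)) - (h (t + τ) - h t) = 0 := by
    intro τ hτ σ hσ
    have hg := hh.innerProduct_shift_sub hτ
    have hf := hg.innerProduct_shift_sub hσ
    have hf2 := hf.innerProduct_shift_sub hσ
    -- Second differences are profiles, so it suffices to treat `t ≥ 0`. If one were positive there,
    -- it could not decrease along the progression with step `σ`, since third differences are
    -- nonnegative. The first difference would then be unbounded, against the Lipschitz bound.
    refine hf.innerProduct_eq_zero fun t ht => ?_
    refine le_antisymm ?_ (hf.innerProduct_nonneg ht)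
    by_contra! hpos
    set g : ℝ → ℝ := fun t => h (t + τ) - h t with hgdef
    set e := g (t + σ) - g t with he
    have hmono : ∀ k : ℕ, e ≤ g (t + k * σ + σ) - g (t + k * σ) := by
      intro k
      induction k with
      | zero => simp [he]
      | succ k ih =>
        have := hf2.innerProduct_nonneg (t := t + k * σ) (by positivity)
        have e1 : t + ((k + 1 : ℕ) : ℝ) * σ = t + k * σ + σ := by push_cast; ring
        rw [e1]
        simp only [hgdef] at *
        linarith
    have hgrow : ∀ k : ℕ, g t + k * e ≤ g (t + k * σ) := by
      intro k
      induction k with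
      | zero => simp
      | succ k ih =>
        have := hmono k
        have e1 : t + ((k + 1 : ℕ) : ℝ) * σ = t + k * σ + σ := by push_cast; ring
        rw [e1]
        push_cast
        linarith
    have hbound : ∀ s, |g s| ≤ L * τ := by
      intro s
      have := hL.dist_le_mul (s + τ) s
      rw [Real.dist_eq, Real.dist_eq] at this
      simpa [abs_of_nonneg hτ] using this
    obtain ⟨k, hk⟩ := exists_nat_gt (2 * (L * τ) / e)
    rw [div_lt_iff₀ hpos] at hk
    have b1 := abs_le.1 (hbound t)
    have b2 := abs_le.1 (hbound (t + k * σ))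
    have := hgrow k
    linarith
  have hadd' : ∀ τ, 0 ≤ τ → ∀ t, h (t + τ) - h t = h τ - h 0 := by
    intro τ hτ t
    rcases le_total 0 t with ht | ht
    · have := hdiff τ hτ t ht 0
      simp only [zero_add] at this
      linarith
    · have := hdiff τ hτ (-t) (by linarith) t
      simp only [add_neg_cancel, zero_add] at this
      linarith
  have hadd : ∀ s t, h (s + t) - h 0 = (h s - h 0) + (h t - h 0) := by
    intro s t
    rcases le_total 0 t with ht | ht
    · have := hadd' t ht s
      linarith
    · have h1 := hadd' (-t) (by linarith) (s + t)
      have h2 := hadd' (-t) (by linarith) t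
      simp only [add_neg_cancel_right, add_neg_cancel] at h1 h2
      linarith
  -- A continuous additive function on `ℝ` is linear.
  let φ : ℝ →+ ℝ := AddMonoidHom.mk' (fun t => h t - h 0) hadd
  have hφ : Continuous φ := hL.continuous.sub continuous_const
  refine ⟨h 0, h 1 - h 0, hh.innerProduct_nonneg le_rfl, ?_, fun t => ?_⟩
  · have := (hh.innerProduct_shift_sub zero_le_one).innerProduct_nonneg (t := 0) le_rfl
    simpa using this
  · have h1 := (φ.toRealLinearMap hφ).map_smul t 1
    simp only [smul_eq_mul, mul_one, AddMonoidHom.coe_toRealLinearMap] at h1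
    have h2 : h t - h 0 = t * (h 1 - h 0) := h1
    linarith

end Profiles

/-! ### Domination of the mode kernels under near isometries -/

section ModeDomination

/-- Domination holds for every exponential with the same constant, whatever its width, so it passes
to mixtures and their limits. The weights always sum to `h 0`, which keeps the error uniform. -/
theorem IsProfile.exists_isDominated_distance {h : ℝ → ℝ} (hh : IsProfile .distance h)
    (hc : ContinuousOn h (Set.Ici 0)) (m : ℕ) : ∃ C : ℝ, 0 ≤ C ∧
    ∀ (ι : Type) [Fintype ι] (p : ℕ) (T : EuclideanSpace ℝ (Fin m) →ₗ[ℝ] EuclideanSpace ℝ (Fin p))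
      (θ : ℝ), 0 < θ → θ ≤ 1 / 2 → IsNearIsometry θ T → ∀ x : ι → EuclideanSpace ℝ (Fin m),
        IsDominated C (C * gaussianTail θ)
          (Matrix.of fun i j => h (‖x i - x j‖ ^ 2))
          (Matrix.of fun i j => h (‖T (x i) - T (x j)‖ ^ 2)) := by
  obtain ⟨C, hC, hdom⟩ := exists_isDominated_gaussian m
  obtain ⟨N, w, s, hw, hs, hsum, hlim⟩ := exists_exp_mixture hh hc
  have h0 := hh.distance_nonneg le_rfl
  refine ⟨C + C * h 0, by positivity, fun ι _ p T θ hθ hθ' hT x => ?_⟩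
  refine IsDominated.mono (C := C) (e := C * gaussianTail θ * h 0) ?_ (hh.posSemidef fun i => T (x i))
    (by have := mul_nonneg hC h0; linarith) ?_
  · refine IsDominated.of_tendsto
      (K := fun n => ∑ a ∈ Finset.range (N n), w n a •
        Matrix.of fun i j => Real.exp (-(s n a * ‖x i - x j‖ ^ 2)))
      (K' := fun n => ∑ a ∈ Finset.range (N n), w n a •
        Matrix.of fun i j => Real.exp (-(s n a * ‖T (x i) - T (x j)‖ ^ 2))) ?_ ?_ ?_
    · intro n
      rw [← hsum n]
      exact IsDominated.sum _ (hw n) fun a ha => hdom ι p T θ hθ hθ' hT x _ (hs n a ha)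
    · intro i j
      simpa [Matrix.sum_apply] using hlim (‖x i - x j‖ ^ 2) (sq_nonneg _)
    · intro i j
      simpa [Matrix.sum_apply] using hlim (‖T (x i) - T (x j)‖ ^ 2) (sq_nonneg _)
  · have h1 := gaussianTail_nonneg θ
    have := mul_nonneg hC h1
    linarith

/-- Here no error matrix is needed: `‖v‖² ≤ 2 ‖T v‖²` as soon as `θ ≤ 1 / 2`. -/
theorem isDominated_affine {a b : ℝ} (ha : 0 ≤ a) (hb : 0 ≤ b) {m p : ℕ} {ι : Type} [Fintype ι]
    {T : EuclideanSpace ℝ (Fin m) →ₗ[ℝ] EuclideanSpace ℝ (Fin p)} {θ : ℝ} (hθ : θ ≤ 1 / 2)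
    (hT : IsNearIsometry θ T) (x : ι → EuclideanSpace ℝ (Fin m)) {e : ℝ} (he : 0 ≤ e) :
    IsDominated 2 e (Matrix.of fun i j => a + b * ⟪x i, x j⟫_ℝ)
      (Matrix.of fun i j => a + b * ⟪T (x i), T (x j)⟫_ℝ) := by
  refine ⟨0, Matrix.PosSemidef.zero, fun i => by simpa using he,
    posSemidef_iff_sum.2 ⟨fun i j => ?_, fun α => ?_⟩⟩
  · simp [real_inner_comm]
  · have e1 : ∑ i, ∑ j, α i * α j * ((2 : ℝ) • (Matrix.of fun i j =>
        a + b * ⟪T (x i), T (x j)⟫_ℝ) + 0 - Matrix.of fun i j => a + b * ⟪x i, x j⟫_ℝ) i j =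
        a * (∑ i, α i) ^ 2 + b * (2 * ‖T (∑ i, α i • x i)‖ ^ 2 - ‖∑ i, α i • x i‖ ^ 2) := by
      rw [← real_inner_self_eq_norm_sq, ← real_inner_self_eq_norm_sq, sq, Finset.sum_mul_sum]
      simp only [map_sum, map_smul, sum_inner, inner_sum, inner_smul_left, inner_smul_right]
      simp only [Finset.mul_sum, ← Finset.sum_sub_distrib, ← Finset.sum_add_distrib]
      refine Finset.sum_congr rfl fun i _ => Finset.sum_congr rfl fun j _ => ?_
      simp [real_inner_comm (x i), real_inner_comm (T (x i))]
      ring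
    rw [e1]
    have h1 := (hT (∑ i, α i • x i)).1
    have h2 := sq_nonneg ‖∑ i, α i • x i‖
    have h3 : 0 ≤ 2 * ‖T (∑ i, α i • x i)‖ ^ 2 - ‖∑ i, α i • x i‖ ^ 2 := by nlinarith
    positivity

variable {κ : ModeKernel} {L : ℝ≥0}

/-- The kernel of one mode is dominated by its image under a near isometry. -/
theorem ModeKernel.exists_isDominated (hL : LipschitzOnWith L κ.profile κ.form.range) (m : ℕ)
    (B : ℝ) : ∃ C : ℝ, 0 ≤ C ∧
    ∀ (ι : Type) [Fintype ι] (p : ℕ) (T : EuclideanSpace ℝ (Fin m) →ₗ[ℝ] EuclideanSpace ℝ (Fin p))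
      (θ : ℝ), 0 < θ → θ ≤ 1 / 2 → IsNearIsometry θ T →
      ∀ x : ι → EuclideanSpace ℝ (Fin m), (∀ i, ‖x i‖ ^ 2 ≤ B) →
        IsDominated C (C * gaussianTail θ) (Matrix.of fun i j => κ.eval (x i) (x j))
          (Matrix.of fun i j => κ.eval (T (x i)) (T (x j))) ∧
        (∀ i, κ.eval (T (x i)) (T (x i)) ≤ C) := by
  obtain ⟨F, h, hpos⟩ := κ
  have hh : IsProfile F h := ModeKernel.isProfile ⟨F, h, hpos⟩
  cases F with
  | distance =>
    obtain ⟨C, hC, hdom⟩ := hh.exists_isDominated_distance hL.continuousOn m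
    have h0 := hh.distance_nonneg le_rfl
    refine ⟨C + h 0, by positivity, fun ι _ p T θ hθ hθ' hT x _ => ⟨?_, fun i => ?_⟩⟩
    · have h1 := gaussianTail_nonneg θ
      exact (hdom ι p T θ hθ hθ' hT x).mono (hh.posSemidef fun i => T (x i)) (by linarith)
        (mul_le_mul_of_nonneg_right (by linarith) h1)
    · simp [ModeKernel.eval, KernelForm.arg, hC]
  | innerProduct =>
    obtain ⟨a, b, ha, hb, hab⟩ := hh.innerProduct_affine (lipschitzOnWith_univ.1 hL)
    refine ⟨2 + a + 2 * b * |B|, by positivity, fun ι _ p T θ hθ hθ' hT x hx => ⟨?_, fun i => ?_⟩⟩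
    · have h1 := gaussianTail_nonneg θ
      have hpsd := hh.posSemidef fun i => T (x i)
      simp only [ModeKernel.eval, KernelForm.arg, hab] at hpsd ⊢
      have h2 : 0 ≤ 2 * b * |B| := by positivity
      exact (isDominated_affine ha hb hθ' hT x (by positivity)).mono hpsd (by linarith) le_rfl
    · simp only [ModeKernel.eval, KernelForm.arg, hab, real_inner_self_eq_norm_sq]
      have h1 := (hT (x i)).2
      have h2 : ‖T (x i)‖ ^ 2 ≤ 2 * |B| := by
        have := sq_nonneg ‖x i‖
        have := (hx i).trans (le_abs_self B)
        nlinarith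
      have := mul_le_mul_of_nonneg_left h2 hb
      linarith

theorem ModeKernel.continuous_eval (hL : LipschitzOnWith L κ.profile κ.form.range) (m : ℕ) :
    Continuous fun q : EuclideanSpace ℝ (Fin m) × EuclideanSpace ℝ (Fin m) => κ.eval q.1 q.2 := by
  have hc := hL.continuousOn
  obtain ⟨F, h, hpos⟩ := κ
  cases F with
  | distance =>
    refine hc.comp_continuous (by simp only [KernelForm.arg]; fun_prop) fun q => ?_
    exact sq_nonneg ‖q.1 - q.2‖
  | innerProduct =>
    refine hc.comp_continuous (by simp only [KernelForm.arg]; fun_prop) fun q => ?_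
    exact Set.mem_univ _

/-- On bounded sets the kernel of one mode is bounded, uniformly in the dimension. -/
theorem ModeKernel.exists_eval_self_le (hL : LipschitzOnWith L κ.profile κ.form.range) (B : ℝ) :
    ∃ M : ℝ, 0 ≤ M ∧ ∀ (m : ℕ) (a : EuclideanSpace ℝ (Fin m)), ‖a‖ ^ 2 ≤ B → κ.eval a a ≤ M := by
  refine ⟨|κ.profile 0| + L * |B|, by positivity, fun m a ha => ?_⟩
  obtain ⟨F, h, hpos⟩ := κ
  cases F with
  | distance =>
    simp only [ModeKernel.eval, KernelForm.arg, sub_self, norm_zero]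
    have : (0 : ℝ) ≤ L * |B| := by positivity
    have := le_abs_self (h 0)
    norm_num
    linarith
  | innerProduct =>
    simp only [ModeKernel.eval, KernelForm.arg, real_inner_self_eq_norm_sq]
    have h1 := (lipschitzOnWith_univ.1 hL).dist_le_mul (‖a‖ ^ 2) 0
    rw [Real.dist_eq, Real.dist_eq, sub_zero, abs_of_nonneg (sq_nonneg ‖a‖)] at h1
    have h2 := mul_le_mul_of_nonneg_left (ha.trans (le_abs_self B)) L.coe_nonneg
    have h3 := le_abs_self (h (‖a‖ ^ 2) - h 0)
    have h4 := le_abs_self (h 0)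
    simp only at h1 ⊢
    linarith

end ModeDomination

/-! ### The random projection is a near isometry -/

section RandomMatrix

theorem integrable_pow_four_gaussianReal (v : ℝ≥0) :
    Integrable (fun x : ℝ => x ^ 4) (gaussianReal 0 v) := by
  have h := (memLp_id_gaussianReal (μ := 0) (v := v) ((4 : ℕ) : ℝ≥0)).integrable_norm_pow'
  refine h.congr (Filter.Eventually.of_forall fun g => ?_)
  simp only [id, Real.norm_eq_abs]
  exact (by decide : Even 4).pow_abs g

/-- The fourth moment of a standard Gaussian. -/
def gaussianMoment4 : ℝ := ∫ x, x ^ 4 ∂(gaussianReal 0 1)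

theorem gaussianMoment4_nonneg : 0 ≤ gaussianMoment4 :=
  integral_nonneg fun x => by positivity

theorem integral_pow_four_gaussianReal (v : ℝ≥0) :
    ∫ x, x ^ 4 ∂(gaussianReal 0 v) = gaussianMoment4 * (v : ℝ) ^ 2 := by
  have h := gaussianReal_map_const_mul (μ := 0) (v := 1) (√(v : ℝ))
  have hv : NNReal.mk (√(v : ℝ) ^ 2) (sq_nonneg _) * 1 = v := by
    rw [mul_one]
    exact NNReal.eq (Real.sq_sqrt v.coe_nonneg)
  rw [mul_zero, hv] at h
  rw [← h, integral_map (by fun_prop) (by fun_prop), gaussianMoment4, ← integral_mul_const]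
  refine integral_congr_ae (Filter.Eventually.of_forall fun x => ?_)
  simp only
  rw [mul_pow, show √(v : ℝ) ^ 4 = (√(v : ℝ) ^ 2) ^ 2 by ring, Real.sq_sqrt v.coe_nonneg]
  ring

variable {n p : ℕ} (v : ℝ≥0)

theorem integrable_coord_pow_four (i : Fin n) :
    Integrable (fun a : Fin n → ℝ => a i ^ 4) (Measure.pi fun _ => gaussianReal 0 v) :=
  (measurePreserving_eval (fun _ : Fin n => gaussianReal 0 v) i).integrable_comp_of_integrable
    (integrable_pow_four_gaussianReal v)

theorem integral_coord_comp (i : Fin n) {f : ℝ → ℝ} (hf : Measurable f) :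
    ∫ a : Fin n → ℝ, f (a i) ∂(Measure.pi fun _ => gaussianReal 0 v) =
      ∫ x, f x ∂(gaussianReal 0 v) := by
  have h := measurePreserving_eval (fun _ : Fin n => gaussianReal 0 v) i
  conv_rhs => rw [← h.map_eq]
  rw [integral_map h.measurable.aemeasurable hf.aestronglyMeasurable]

theorem mul_sq_le_pow_four (x y : ℝ) : (x * y) ^ 2 ≤ x ^ 4 / 2 + y ^ 4 / 2 := by
  nlinarith [sq_nonneg (x ^ 2 - y ^ 2)]

theorem memLp_coord_mul (i k : Fin n) :
    MemLp (fun a : Fin n → ℝ => a i * a k) 2 (Measure.pi fun _ => gaussianReal 0 v) := by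
  rw [memLp_two_iff_integrable_sq (by fun_prop)]
  refine (((integrable_coord_pow_four v i).div_const 2).add
    ((integrable_coord_pow_four v k).div_const 2)).mono' (by fun_prop)
    (Filter.Eventually.of_forall fun a => ?_)
  rw [Real.norm_eq_abs, abs_of_nonneg (sq_nonneg _)]
  exact mul_sq_le_pow_four _ _

theorem variance_coord_mul_le (i k : Fin n) :
    Var[fun a : Fin n → ℝ => a i * a k; Measure.pi fun _ => gaussianReal 0 v] ≤
      gaussianMoment4 * (v : ℝ) ^ 2 := by
  refine (variance_le_expectation_sq (memLp_coord_mul v i k).aestronglyMeasurable).trans ?_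
  have h1 := (integrable_coord_pow_four v i).div_const 2
  have h2 := (integrable_coord_pow_four v k).div_const 2
  have h3 : ∀ i : Fin n, ∫ a : Fin n → ℝ, a i ^ 4 ∂(Measure.pi fun _ => gaussianReal 0 v) =
      gaussianMoment4 * (v : ℝ) ^ 2 := fun i => by
    rw [integral_coord_comp v i (f := fun x => x ^ 4) (by fun_prop),
      integral_pow_four_gaussianReal]
  calc _ ≤ ∫ a : Fin n → ℝ, (a i ^ 4 / 2 + a k ^ 4 / 2)
        ∂(Measure.pi fun _ => gaussianReal 0 v) := by
        refine integral_mono (memLp_coord_mul v i k).integrable_sq (h1.add h2) fun a => ?_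
        exact mul_sq_le_pow_four _ _
    _ = _ := by
        rw [integral_add h1 h2, integral_div, integral_div, h3, h3]
        ring

theorem integral_coord_mul (i k : Fin n) :
    ∫ a : Fin n → ℝ, a i * a k ∂(Measure.pi fun _ => gaussianReal 0 v) =
      if i = k then (v : ℝ) else 0 := by
  by_cases hik : i = k
  · subst hik
    simp only [if_true]
    rw [integral_coord_comp v i (f := fun x => x * x) (by fun_prop)]
    have h := variance_fun_id_gaussianReal (μ := 0) (v := v)
    have hmem : MemLp (fun x : ℝ => x) 2 (gaussianReal 0 v) := memLp_id_gaussianReal 2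
    rw [variance_eq_sub hmem] at h
    simp [integral_id_gaussianReal] at h
    rw [← h]
    refine integral_congr_ae (Filter.Eventually.of_forall fun x => ?_)
    simp only
    ring
  · have hind := (iIndepFun_pi (μ := fun _ : Fin n => gaussianReal 0 v)
      (X := fun _ x => x) fun _ => aemeasurable_id).indepFun hik
    have h := hind.integral_mul_eq_mul_integral
      (measurable_pi_apply i).aestronglyMeasurable (measurable_pi_apply k).aestronglyMeasurable
    have h2 : ∀ i : Fin n, ∫ a : Fin n → ℝ, a i ∂(Measure.pi fun _ => gaussianReal 0 v) = 0 :=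
      fun i => by
        rw [integral_coord_comp v i (f := fun x => x) (by fun_prop), integral_id_gaussianReal]
    simp only [hik, if_false]
    simpa [h2] using h

/-- The deviation of an entry of the Gram matrix of the columns of `A` from the identity. -/
def gramError (A : Fin p → Fin n → ℝ) (i k : Fin n) : ℝ :=
  ∑ q, A q i * A q k - if i = k then 1 else 0

/-- Chebyshev's inequality: the `p` rows are independent, each contributing variance at most
`gaussianMoment4 / p²`. The polynomial tail suffices, because the dimensions of the original factors
are fixed. -/
theorem measure_gramError_ge_le (hp : 0 < p) (i k : Fin n) {t : ℝ} (ht : 0 < t) :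
    (Measure.pi fun _ : Fin p => Measure.pi fun _ : Fin n => gaussianReal 0 ((p : ℝ≥0)⁻¹))
      {A | t ≤ |gramError A i k|} ≤ ENNReal.ofReal (gaussianMoment4 / (p * t ^ 2)) := by
  have hp' : (p : ℝ) ≠ 0 := by positivity
  have hX := fun _ : Fin p => memLp_coord_mul ((p : ℝ≥0)⁻¹) i k
  have hvar := variance_sum_pi (μ := fun _ : Fin p =>
    Measure.pi fun _ : Fin n => gaussianReal 0 ((p : ℝ≥0)⁻¹)) hX
  set μ := Measure.pi fun _ : Fin p => Measure.pi fun _ : Fin n => gaussianReal 0 ((p : ℝ≥0)⁻¹)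
  have hmem : ∀ q : Fin p, MemLp (fun A : Fin p → Fin n → ℝ => A q i * A q k) 2 μ := fun q =>
    (hX q).comp_measurePreserving (measurePreserving_eval _ q)
  have hmean : ∫ A, (∑ q, fun A : Fin p → Fin n → ℝ => A q i * A q k) A ∂μ =
      if i = k then 1 else 0 := by
    simp only [Finset.sum_apply]
    rw [integral_finsetSum _ fun q _ => (hmem q).integrable (by norm_num)]
    have : ∀ q : Fin p, ∫ A : Fin p → Fin n → ℝ, A q i * A q k ∂μ =
        if i = k then (p : ℝ)⁻¹ else 0 := by
      intro q
      have h := measurePreserving_eval (fun _ : Fin p =>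
        Measure.pi fun _ : Fin n => gaussianReal 0 ((p : ℝ≥0)⁻¹)) q
      have h2 := integral_coord_mul ((p : ℝ≥0)⁻¹) i k
      rw [← h.map_eq, integral_map h.measurable.aemeasurable (by fun_prop)] at h2
      simpa using h2
    simp only [this]
    by_cases hik : i = k <;> simp [hik, hp']
  have hcheb := meas_ge_le_variance_div_sq (μ := μ) (memLp_finsetSum' Finset.univ
    fun q _ => hmem q) ht
  rw [hmean, hvar] at hcheb
  refine le_trans (le_of_eq ?_) (hcheb.trans (ENNReal.ofReal_le_ofReal ?_))
  · simp only [gramError, Finset.sum_apply]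
  · have h1 : ∑ _q : Fin p, Var[fun a : Fin n → ℝ => a i * a k;
        Measure.pi fun _ => gaussianReal 0 ((p : ℝ≥0)⁻¹)] ≤
        ∑ _q : Fin p, gaussianMoment4 * (((p : ℝ≥0)⁻¹ : ℝ≥0) : ℝ) ^ 2 :=
      Finset.sum_le_sum fun _ _ => variance_coord_mul_le _ i k
    have h2 : ∑ _q : Fin p, gaussianMoment4 * (((p : ℝ≥0)⁻¹ : ℝ≥0) : ℝ) ^ 2 =
        gaussianMoment4 / p := by
      simp
      field_simp
    rw [h2] at h1
    calc _ ≤ gaussianMoment4 / p / t ^ 2 := by gcongr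
      _ = _ := by rw [div_div]

/-- The defect `‖A x‖² - ‖x‖²` is the quadratic form of the Gram error, and `(∑ |x i|)² ≤ n ‖x‖²`.
The denominator `n + 1` also covers `n = 0`. -/
theorem isNearIsometry_of_gramError {A : Fin p → Fin n → ℝ} {θ : ℝ} (hθ : 0 ≤ θ)
    (h : ∀ i k, |gramError A i k| ≤ θ / (n + 1)) :
    IsNearIsometry θ (Matrix.toEuclideanLin (Matrix.of A)) := by
  intro x
  have e : ‖Matrix.toEuclideanLin (Matrix.of A) x‖ ^ 2 - ‖x‖ ^ 2 =
      ∑ i, ∑ k, x i * x k * gramError A i k := by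
    rw [EuclideanSpace.real_norm_sq_eq, EuclideanSpace.real_norm_sq_eq]
    have h1 : ∀ q, (Matrix.toEuclideanLin (Matrix.of A) x) q ^ 2 =
        ∑ i, ∑ k, x i * x k * (A q i * A q k) := by
      intro q
      change ((Matrix.of A).mulVec x q) ^ 2 = _
      rw [Matrix.mulVec, dotProduct, sq, Finset.sum_mul_sum]
      refine Finset.sum_congr rfl fun i _ => Finset.sum_congr rfl fun k _ => ?_
      simp only [Matrix.of_apply]
      ring
    simp only [h1, gramError, mul_sub, Finset.sum_sub_distrib, Finset.mul_sum]
    congr 1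
    · rw [Finset.sum_comm]
      refine Finset.sum_congr rfl fun i _ => ?_
      rw [Finset.sum_comm]
    · simp [sq]
  have hle : |∑ i, ∑ k, x i * x k * gramError A i k| ≤ θ * ‖x‖ ^ 2 := by
    have h1 : |∑ i, ∑ k, x i * x k * gramError A i k| ≤
        ∑ i, ∑ k, (|x i| * |x k|) * (θ / (n + 1)) := by
      refine (Finset.abs_sum_le_sum_abs _ _).trans (Finset.sum_le_sum fun i _ => ?_)
      refine (Finset.abs_sum_le_sum_abs _ _).trans (Finset.sum_le_sum fun k _ => ?_)
      rw [abs_mul, abs_mul]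
      exact mul_le_mul_of_nonneg_left (h i k) (by positivity)
    have h2 : ∑ i, ∑ k, (|x i| * |x k|) * (θ / ((n : ℝ) + 1)) =
        (∑ i, |x i|) ^ 2 * (θ / (n + 1)) := by
      rw [sq, Finset.sum_mul_sum, Finset.sum_mul]
      refine Finset.sum_congr rfl fun i _ => ?_
      rw [Finset.sum_mul]
    have h3 : (∑ i, |x i|) ^ 2 ≤ n * ‖x‖ ^ 2 := by
      have := sq_sum_le_card_mul_sum_sq (s := (Finset.univ : Finset (Fin n))) (f := fun i => |x i|)
      simpa [EuclideanSpace.real_norm_sq_eq] using this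
    rw [h2] at h1
    refine h1.trans ((mul_le_mul_of_nonneg_right h3 (by positivity)).trans ?_)
    have h4 : (n : ℝ) * ‖x‖ ^ 2 * (θ / (n + 1)) = θ * ‖x‖ ^ 2 * (n / (n + 1)) := by ring
    rw [h4]
    refine mul_le_of_le_one_right (by positivity) ?_
    rw [div_le_one (by positivity)]
    linarith
  rw [← e, abs_le] at hle
  constructor <;> linarith

/-- The matrix of mode `j`, as a linear map. -/
def modeMap {d : ℕ} {P I : Fin d → ℕ} (A : ModeMatrices P I) (j : Fin d) :
    EuclideanSpace ℝ (Fin (I j)) →ₗ[ℝ] EuclideanSpace ℝ (Fin (P j)) :=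
  Matrix.toEuclideanLin (Matrix.of (A j))

theorem project_apply {d r : ℕ} {P I : Fin d → ℕ} (A : ModeMatrices P I) (x : CPTensor d r I)
    (j : Fin d) (k : Fin r) : project A x j k = modeMap A j (x j k) := rfl

instance {d : ℕ} (P I : Fin d → ℕ) : IsProbabilityMeasure (projectionLaw P I) := by
  unfold projectionLaw
  infer_instance

/-- With high probability all the matrices of the random projection are near isometries. -/
theorem exists_measure_not_isNearIsometry_le {d : ℕ} (I : Fin d → ℕ) : ∃ c : ℝ, 0 ≤ c ∧
    ∀ (P : ℕ) (θ : ℝ), 0 < P → 0 < θ → ∃ S : Set (ModeMatrices (fun _ : Fin d => P) I),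
      MeasurableSet S ∧ projectionLaw (fun _ => P) I Sᶜ ≤ ENNReal.ofReal (c / (P * θ ^ 2)) ∧
      ∀ A ∈ S, ∀ j, IsNearIsometry θ (modeMap A j) := by
  have hm := gaussianMoment4_nonneg
  refine ⟨∑ j, ∑ _i : Fin (I j), ∑ _k : Fin (I j), gaussianMoment4 * ((I j : ℝ) + 1) ^ 2,
    by positivity, fun P θ hP hθ => ?_⟩
  let bad : (j : Fin d) → Fin (I j) → Fin (I j) → Set (ModeMatrices (fun _ : Fin d => P) I) :=
    fun j i k => {A | θ / (I j + 1) ≤ |gramError (A j) i k|}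
  have hbadm : ∀ j i k, MeasurableSet (bad j i k) := by
    intro j i k
    refine measurableSet_le measurable_const ?_
    simp only [gramError]
    fun_prop
  refine ⟨(⋃ j, ⋃ i, ⋃ k, bad j i k)ᶜ, ?_, ?_, ?_⟩
  · exact (MeasurableSet.iUnion fun j => MeasurableSet.iUnion fun i =>
      MeasurableSet.iUnion fun k => hbadm j i k).compl
  · rw [compl_compl, Finset.sum_div, ENNReal.ofReal_sum_of_nonneg fun j _ => by positivity]
    refine (measure_iUnion_fintype_le _ _).trans (Finset.sum_le_sum fun j _ => ?_)
    rw [Finset.sum_div, ENNReal.ofReal_sum_of_nonneg fun i _ => by positivity]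
    refine (measure_iUnion_fintype_le _ _).trans (Finset.sum_le_sum fun i _ => ?_)
    rw [Finset.sum_div, ENNReal.ofReal_sum_of_nonneg fun k _ => by positivity]
    refine (measure_iUnion_fintype_le _ _).trans (Finset.sum_le_sum fun k _ => ?_)
    have h := measure_gramError_ge_le hP i k (t := θ / (I j + 1)) (by positivity)
    have hmp := measurePreserving_eval (fun j : Fin d => Measure.pi fun _ : Fin P =>
      Measure.pi fun _ : Fin (I j) => gaussianReal 0 ((P : ℝ≥0)⁻¹)) j
    have hset : MeasurableSet {A : Fin P → Fin (I j) → ℝ | θ / (I j + 1) ≤ |gramError A i k|} := by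
      refine measurableSet_le measurable_const ?_
      simp only [gramError]
      fun_prop
    rw [← hmp.measure_preimage hset.nullMeasurableSet] at h
    refine h.trans (le_of_eq ?_)
    congr 1
    field_simp
  · intro A hA j
    refine isNearIsometry_of_gramError hθ.le fun i k => ?_
    by_contra! hlt
    refine hA (Set.mem_iUnion.2 ⟨j, Set.mem_iUnion.2 ⟨i, Set.mem_iUnion.2 ⟨k, hlt.le⟩⟩⟩)

end RandomMatrix

/-! ### The feature map of the tensor kernel -/

section Features

variable {d r : ℕ} (κ : Fin d → ModeKernel) {I : Fin d → ℕ}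

/-- The canonical feature of a tensor in the reproducing kernel Hilbert space. -/
def tensorFeature (x : CPTensor d r I) : TensorRKHS r κ I :=
  RKHS.kerFun (TensorRKHS r κ I) x (1 : ℝ)

theorem inner_tensorFeature (x : CPTensor d r I) (f : TensorRKHS r κ I) :
    ⟪tensorFeature κ x, f⟫_ℝ = f x := by
  rw [tensorFeature, RKHS.kerFun_inner]
  simp

theorem inner_tensorFeature_tensorFeature (x y : CPTensor d r I) :
    ⟪tensorFeature κ x, tensorFeature κ y⟫_ℝ = tensorKernel κ x y := by
  rw [inner_tensorFeature, tensorFeature, RKHS.kerFun_apply, RKHS.OfKernel.kernel_ofKernel]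
  simp [operatorKernel]

/-- The feature of a labelled tensor, multiplied by its label. -/
def labelledFeature (z : CPTensor d r I × ℝ) : TensorRKHS r κ I :=
  z.2 • tensorFeature κ z.1

theorem inner_labelledFeature (z : CPTensor d r I × ℝ) (f : TensorRKHS r κ I) :
    ⟪labelledFeature κ z, f⟫_ℝ = z.2 * f z.1 := by
  rw [labelledFeature, inner_smul_left, inner_tensorFeature]
  simp

theorem hinge_inner_labelledFeature (z : CPTensor d r I × ℝ) (f : TensorRKHS r κ I) :
    hinge 1 ⟪labelledFeature κ z, f⟫_ℝ = hinge z.2 (f z.1) := by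
  rw [inner_labelledFeature, hinge_one_mul]

theorem regEmpiricalRisk_eq {P : Fin d → ℕ} {n : ℕ} (A : ModeMatrices P I)
    (T : Fin n → CPTensor d r I × ℝ) (lam : ℝ) (g : TensorRKHS r κ P) :
    regEmpiricalRisk κ A T lam g =
      svmObjective lam (fun i => labelledFeature κ (project A (T i).1, (T i).2)) g := by
  simp only [regEmpiricalRisk, svmObjective, hinge_inner_labelledFeature]

theorem isRPSTM_iff_isSVM {P : Fin d → ℕ} {n : ℕ} (A : ModeMatrices P I)
    (T : Fin n → CPTensor d r I × ℝ) (lam : ℝ) (g : TensorRKHS r κ P) :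
    IsRPSTM κ A T lam g ↔
      IsSVM lam (fun i => labelledFeature κ (project A (T i).1, (T i).2)) g := by
  simp only [IsRPSTM, IsSVM, regEmpiricalRisk_eq]

/-- Existence and uniqueness of the minimizer reduce the claim about every minimizer to the chosen
one, `svm`. -/
theorem excessRiskAtMost_of_svm {P : Fin d → ℕ} {n : ℕ} {ρ : Measure (CPTensor d r I × ℝ)}
    {A : ModeMatrices P I} {T : Fin n → CPTensor d r I × ℝ} {lam b : ℝ} (hlam : 0 < lam)
    (h : ∫⁻ z, ENNReal.ofReal (hinge 1 ⟪labelledFeature κ (project A z.1, z.2),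
      svm lam fun i => labelledFeature κ (project A (T i).1, (T i).2)⟫_ℝ) ∂ρ ≤
      bayesRisk ρ + ENNReal.ofReal b) :
    ExcessRiskAtMost κ ρ A T lam b := by
  have hsvm := isSVM_svm hlam fun i => labelledFeature κ (project A (T i).1, (T i).2)
  refine ⟨⟨_, (isRPSTM_iff_isSVM κ A T lam _).2 hsvm⟩, fun g hg => ?_⟩
  rw [((isRPSTM_iff_isSVM κ A T lam g).1 hg).eq hlam hsvm]
  simp only [hinge_inner_labelledFeature] at h
  exact h

/-- Expand `‖φ y - φ x‖²` into inner products. -/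
theorem continuous_of_inner {X H : Type*} [TopologicalSpace X] [NormedAddCommGroup H]
    [InnerProductSpace ℝ H] {φ : X → H} (h : Continuous fun p : X × X => ⟪φ p.1, φ p.2⟫_ℝ) :
    Continuous φ := by
  refine continuous_iff_continuousAt.2 fun x => ?_
  rw [ContinuousAt, tendsto_iff_norm_sub_tendsto_zero]
  have e : ∀ y, ‖φ y - φ x‖ = √(⟪φ y, φ y⟫_ℝ - 2 * ⟪φ y, φ x⟫_ℝ + ⟪φ x, φ x⟫_ℝ) := by
    intro y
    rw [real_inner_self_eq_norm_sq, real_inner_self_eq_norm_sq, ← norm_sub_sq_real,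
      Real.sqrt_sq (norm_nonneg _)]
  simp only [e]
  have h1 : Continuous fun y => ⟪φ y, φ y⟫_ℝ := h.comp (continuous_id.prodMk continuous_id)
  have h2 : Continuous fun y => ⟪φ y, φ x⟫_ℝ := h.comp (continuous_id.prodMk continuous_const)
  have h3 : Continuous fun y =>
      √(⟪φ y, φ y⟫_ℝ - 2 * ⟪φ y, φ x⟫_ℝ + ⟪φ x, φ x⟫_ℝ) := by fun_prop
  have h4 := h3.tendsto x
  have h5 : ⟪φ x, φ x⟫_ℝ - 2 * ⟪φ x, φ x⟫_ℝ + ⟪φ x, φ x⟫_ℝ = 0 := by ring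
  rwa [h5, Real.sqrt_zero] at h4

variable {κ} {L : Fin d → ℝ≥0}

theorem continuous_tensorFeature
    (hL : ∀ j, LipschitzOnWith (L j) (κ j).profile (κ j).form.range) :
    Continuous (tensorFeature κ : CPTensor d r I → TensorRKHS r κ I) := by
  refine continuous_of_inner ?_
  simp only [inner_tensorFeature_tensorFeature, tensorKernel]
  refine continuous_finsetSum _ fun k _ => continuous_finsetSum _ fun l _ =>
    continuous_finsetProd _ fun j _ => ?_
  exact ((κ j).continuous_eval (hL j) (I j)).comp
    (f := fun p : CPTensor d r I × CPTensor d r I => (p.1 j k, p.2 j l)) (by fun_prop)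

theorem continuous_labelledFeature
    (hL : ∀ j, LipschitzOnWith (L j) (κ j).profile (κ j).form.range) :
    Continuous (labelledFeature κ : CPTensor d r I × ℝ → TensorRKHS r κ I) :=
  continuous_snd.smul ((continuous_tensorFeature hL).comp continuous_fst)

theorem continuous_project {P : Fin d → ℕ} :
    Continuous fun q : ModeMatrices P I × CPTensor d r I => project q.1 q.2 := by
  refine continuous_pi fun j => continuous_pi fun k => ?_
  refine (PiLp.continuous_toLp 2 _).comp (continuous_pi fun i => ?_)
  simp only [Matrix.mulVec, dotProduct, Matrix.of_apply]
  fun_prop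

/-- On bounded sets the tensor kernel is bounded, uniformly in the mode dimensions. -/
theorem exists_norm_labelledFeature_le (r : ℕ)
    (hL : ∀ j, LipschitzOnWith (L j) (κ j).profile (κ j).form.range) (B : ℝ) :
    ∃ M : ℝ, 0 ≤ M ∧ ∀ (I : Fin d → ℕ) (z : CPTensor d r I × ℝ), (z.2 = 1 ∨ z.2 = -1) →
      (∀ j k, ‖z.1 j k‖ ^ 2 ≤ B) → ‖labelledFeature κ z‖ ≤ M := by
  choose M hM hMle using fun j => (κ j).exists_eval_self_le (hL j) B
  refine ⟨√((r : ℝ) ^ 2 * ∏ j, M j), Real.sqrt_nonneg _, fun I z hz hB => ?_⟩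
  refine Real.le_sqrt_of_sq_le ?_
  have hz2 : z.2 ^ 2 = 1 := by rcases hz with h | h <;> rw [h] <;> norm_num
  rw [labelledFeature, norm_smul, mul_pow, Real.norm_eq_abs, sq_abs, hz2, one_mul,
    ← real_inner_self_eq_norm_sq, inner_tensorFeature_tensorFeature]
  have heval : ∀ j k l, |(κ j).eval (z.1 j k) (z.1 j l)| ≤ M j := fun j =>
    ((κ j).isProfile.posSemidef fun k => z.1 j k).abs_apply_le fun k => hMle j _ _ (hB j k)
  have hprod : ∀ k l, ∏ j, (κ j).eval (z.1 j k) (z.1 j l) ≤ ∏ j, M j := by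
    intro k l
    refine (le_abs_self _).trans ?_
    rw [Finset.abs_prod]
    exact Finset.prod_le_prod (fun _ _ => abs_nonneg _) fun j _ => heval j k l
  refine (Finset.sum_le_sum fun k _ => Finset.sum_le_sum fun l _ => hprod k l).trans (le_of_eq ?_)
  simp
  ring

/-- The sum over CP components becomes a quadratic form of a plain product kernel on the `n r`
component vectors, to which `exists_isDominated_prod` applies. -/
theorem norm_sq_sum_smul_labelledFeature {n : ℕ} (α : Fin n → ℝ)
    (T : Fin n → CPTensor d r I × ℝ) :
    ‖∑ i, α i • labelledFeature κ (T i)‖ ^ 2 =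
      ∑ p : Fin n × Fin r, ∑ q : Fin n × Fin r, (α p.1 * (T p.1).2) * (α q.1 * (T q.1).2) *
        ∏ j, (κ j).eval ((T p.1).1 j p.2) ((T q.1).1 j q.2) := by
  have h : ∀ i j, ⟪α i • labelledFeature κ (T i), α j • labelledFeature κ (T j)⟫_ℝ =
      ∑ k, ∑ l, (α i * (T i).2) * (α j * (T j).2) *
        ∏ m, (κ m).eval ((T i).1 m k) ((T j).1 m l) := by
    intro i j
    simp only [labelledFeature, inner_smul_left, inner_smul_right,
      inner_tensorFeature_tensorFeature, tensorKernel, conj_trivial, ← Finset.mul_sum]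
    ring
  rw [← real_inner_self_eq_norm_sq, sum_inner]
  simp only [inner_sum, h, Fintype.sum_prod_type]
  exact Finset.sum_congr rfl fun i _ => Finset.sum_comm

/-- The regularized empirical risk of the machine on the projected data is at most that of any
function on the original data, up to a constant factor in the regularization and to a term of the
order of the Gaussian tail. -/
theorem exists_svmObjective_project_le (r : ℕ) (I : Fin d → ℕ)
    (hL : ∀ j, LipschitzOnWith (L j) (κ j).profile (κ j).form.range) (B : ℝ) :
    ∃ C : ℝ, 1 ≤ C ∧ ∀ (P : Fin d → ℕ) (A : ModeMatrices P I) (θ : ℝ), 0 < θ → θ ≤ 1 / 2 →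
      (∀ j, IsNearIsometry θ (modeMap A j)) → ∀ (n : ℕ), 0 < n →
      ∀ T : Fin n → CPTensor d r I × ℝ, (∀ i, (T i).2 = 1 ∨ (T i).2 = -1) →
      (∀ i j k, ‖(T i).1 j k‖ ^ 2 ≤ B) → ∀ lam : ℝ, 0 < lam → ∀ f : TensorRKHS r κ I,
        svmObjective lam (fun i => labelledFeature κ (project A (T i).1, (T i).2))
          (svm lam fun i => labelledFeature κ (project A (T i).1, (T i).2)) ≤
        svmObjective (C * lam) (fun i => labelledFeature κ (T i)) f +
          gaussianTail θ * (r : ℝ) ^ 2 / (4 * lam) := by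
  choose c hc hdom using fun j => (κ j).exists_isDominated (hL j) (I j) B
  obtain ⟨C₀, hC₀, hprod⟩ := exists_isDominated_prod (Finset.univ : Finset (Fin d)) c hc
  refine ⟨C₀ + 1, by linarith, fun P A θ hθ hθ' hA n hn T hlab hB lam hlam f => ?_⟩
  set τ := gaussianTail θ with hτ
  have hτ0 : 0 ≤ τ := gaussianTail_nonneg θ
  have hxB : ∀ j (p : Fin n × Fin r), ‖(T p.1).1 j p.2‖ ^ 2 ≤ B := fun j p => hB _ _ _
  have hd := (hprod (Fin n × Fin r) τ hτ0 (gaussianTail_le_one θ)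
    (fun j => Matrix.of fun p q => (κ j).eval ((T p.1).1 j p.2) ((T q.1).1 j q.2))
    (fun j => Matrix.of fun p q => (κ j).eval (modeMap A j ((T p.1).1 j p.2))
      (modeMap A j ((T q.1).1 j q.2)))
    (fun j _ => (κ j).isProfile.posSemidef fun p : Fin n × Fin r => (T p.1).1 j p.2)
    (fun j _ => (κ j).isProfile.posSemidef fun p : Fin n × Fin r =>
      modeMap A j ((T p.1).1 j p.2))
    (fun j _ => (hdom j (Fin n × Fin r) (P j) (modeMap A j) θ hθ hθ' (hA j)
      (fun p => (T p.1).1 j p.2) (hxB j)).2)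
    (fun j _ => (hdom j (Fin n × Fin r) (P j) (modeMap A j) θ hθ hθ' (hA j)
      (fun p => (T p.1).1 j p.2) (hxB j)).1)).1
  -- The dual optimum of the projected problem is used as a feasible dual point of the original one
  -- with regularization `(C₀ + 1) * lam`; this enlarged parameter compensates the factor lost in
  -- the domination.
  obtain ⟨α, g, hα, hg⟩ := exists_dual hlam
    fun i => labelledFeature κ (project A (T i).1, (T i).2)
  have hweak := weak_duality (lam := (C₀ + 1) * lam) (by positivity)
    (fun i => labelledFeature κ (T i)) f hα
  have hcmp := hd.sum_le fun p => α p.1 * (T p.1).2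
  -- Each `α i` is at most `1 / n` and occurs for `r` components.
  have hl1 : ∑ p : Fin n × Fin r, |α p.1 * (T p.1).2| ≤ r := by
    have : ∀ i, |α i * (T i).2| ≤ 1 / n := fun i => by
      rw [abs_mul, abs_of_nonneg (hα i).1]
      rcases hlab i with h | h <;> rw [h] <;> simpa using (hα i).2
    rw [Fintype.sum_prod_type]
    simp only [Finset.sum_const, Finset.card_univ, Fintype.card_fin, nsmul_eq_mul]
    refine (Finset.sum_le_sum fun i _ => mul_le_mul_of_nonneg_left (this i)
      (by positivity : (0 : ℝ) ≤ r)).trans (le_of_eq ?_)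
    have : (n : ℝ) ≠ 0 := by positivity
    simp
    field_simp
  have hl2 : (∑ p : Fin n × Fin r, |α p.1 * (T p.1).2|) ^ 2 ≤ (r : ℝ) ^ 2 :=
    pow_le_pow_left₀ (Finset.sum_nonneg fun _ _ => abs_nonneg _) hl1 2
  have e1 := norm_sq_sum_smul_labelledFeature (κ := κ) α T
  have e2 := norm_sq_sum_smul_labelledFeature (κ := κ) α
    fun i => ((project A (T i).1, (T i).2) : CPTensor d r P × ℝ)
  simp only [Matrix.of_apply, ← project_apply] at hcmp
  rw [← e1, ← e2] at hcmp
  set sA := ‖∑ i, α i • labelledFeature κ (project A (T i).1, (T i).2)‖ ^ 2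
  set s0 := ‖∑ i, α i • labelledFeature κ (T i)‖ ^ 2
  have hsA : 0 ≤ sA := by positivity
  have h1 : s0 ≤ (C₀ + 1) * sA + (C₀ + 1) * τ * (r : ℝ) ^ 2 := by
    have := mul_le_mul_of_nonneg_left hl2 (by positivity : 0 ≤ C₀ * τ)
    have : 0 ≤ τ * (r : ℝ) ^ 2 := by positivity
    linarith
  have h2 : 1 / (4 * ((C₀ + 1) * lam)) * s0 ≤ 1 / (4 * lam) * sA + τ * (r : ℝ) ^ 2 / (4 * lam) := by
    refine (mul_le_mul_of_nonneg_left h1 (by positivity)).trans (le_of_eq ?_)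
    field_simp
  have h3 := isSVM_svm hlam (fun i => labelledFeature κ (project A (T i).1, (T i).2)) g
  rw [hg] at h3
  linarith

end Features

/-! ### The excess risk for a fixed sample size -/

section FixedSampleSize

variable {d r : ℕ} {κ : Fin d → ModeKernel} {I : Fin d → ℕ} {L : Fin d → ℝ≥0}
  {ρ : Measure (CPTensor d r I × ℝ)} [IsProbabilityMeasure ρ]

/-- The label is `±1` and all factors have squared norm at most `B`. -/
def IsAdmissible (B : ℝ) (z : CPTensor d r I × ℝ) : Prop :=
  (z.2 = 1 ∨ z.2 = -1) ∧ ∀ j k, ‖z.1 j k‖ ^ 2 ≤ B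

/-- The bounded differences inequality requires bounds for all samples, not almost all. Composition
with `π` makes the features bounded everywhere without changing anything almost surely. -/
theorem exists_admissible_retraction {B : ℝ} (h : ∀ᵐ z ∂ρ, IsAdmissible B z) :
    ∃ π : CPTensor d r I × ℝ → CPTensor d r I × ℝ, Measurable π ∧ (∀ z, IsAdmissible B (π z)) ∧
      ∀ᵐ z ∂ρ, π z = z := by
  classical
  obtain ⟨z₀, hz₀⟩ := h.exists
  have hm : MeasurableSet {z : CPTensor d r I × ℝ | IsAdmissible B z} := by
    have e : {z : CPTensor d r I × ℝ | IsAdmissible B z} =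
        ({z | z.2 = 1} ∪ {z | z.2 = -1}) ∩ ⋂ j, ⋂ k, {z | ‖z.1 j k‖ ^ 2 ≤ B} := by
      ext z
      simp [IsAdmissible]
    rw [e]
    refine ((measurableSet_eq_fun measurable_snd measurable_const).union
      (measurableSet_eq_fun measurable_snd measurable_const)).inter
      (MeasurableSet.iInter fun j => MeasurableSet.iInter fun k => ?_)
    exact measurableSet_le (by fun_prop) measurable_const
  refine ⟨fun z => if IsAdmissible B z then z else z₀,
    Measurable.ite hm measurable_id measurable_const, fun z => ?_, ?_⟩
  · by_cases hz : IsAdmissible B z <;> simp [hz, hz₀]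
  · filter_upwards [h] with z hz
    simp [hz]

theorem bayesRisk_le_one {X : Type} [MeasurableSpace X] (ρ : Measure (X × ℝ))
    [IsProbabilityMeasure ρ] : bayesRisk ρ ≤ 1 := by
  refine (iInf₂_le (fun _ => (0 : ℝ)) measurable_const).trans (le_of_eq ?_)
  simp [risk, hinge_zero]

theorem exists_risk_add_le_of_approxError_lt {lam X : ℝ}
    (h : approxError κ ρ lam < ENNReal.ofReal X) : ∃ f : TensorRKHS r κ I,
      risk ρ f + ENNReal.ofReal (lam * ‖f‖ ^ 2) ≤ bayesRisk ρ + ENNReal.ofReal X := by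
  have hb : bayesRisk ρ ≠ ⊤ := ((bayesRisk_le_one ρ).trans_lt ENNReal.one_lt_top).ne
  have h1 : (⨅ f : TensorRKHS r κ I, (risk ρ f + ENNReal.ofReal (lam * ‖f‖ ^ 2))) <
      bayesRisk ρ + ENNReal.ofReal X := by
    refine (tsub_le_iff_left.1 le_rfl).trans_lt (ENNReal.add_lt_add_left hb h)
  obtain ⟨f, hf⟩ := iInf_lt_iff.1 h1
  exact ⟨f, hf.le⟩

theorem continuous_svmLoss_project
    (hL : ∀ j, LipschitzOnWith (L j) (κ j).profile (κ j).form.range) {P : Fin d → ℕ} {n : ℕ}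
    {lam : ℝ} (hlam : 0 < lam) :
    Continuous fun p : (ModeMatrices P I × (Fin n → CPTensor d r I × ℝ)) × (CPTensor d r I × ℝ) =>
      hinge 1 ⟪labelledFeature κ (project p.1.1 p.2.1, p.2.2), svm lam fun i =>
        labelledFeature κ (project p.1.1 (p.1.2 i).1, (p.1.2 i).2)⟫_ℝ := by
  have hlf := continuous_labelledFeature (I := P) (r := r) hL
  have hpr := continuous_project (d := d) (r := r) (I := I) (P := P)
  refine continuous_hinge_one.comp (Continuous.inner ?_ ?_)
  · exact hlf.comp ((hpr.comp (by fun_prop :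
      Continuous fun p : (ModeMatrices P I × (Fin n → CPTensor d r I × ℝ)) × (CPTensor d r I × ℝ)
        => (p.1.1, p.2.1))).prodMk (by fun_prop))
  · refine (continuous_svm hlam).comp (continuous_pi fun i => ?_)
    exact hlf.comp ((hpr.comp (by fun_prop :
      Continuous fun p : (ModeMatrices P I × (Fin n → CPTensor d r I × ℝ)) × (CPTensor d r I × ℝ)
        => (p.1.1, (p.1.2 i).1))).prodMk (by fun_prop))

/-- The label-weighted feature of the projection of the retracted observation. -/
def projectedFeature {P : Fin d → ℕ} (κ : Fin d → ModeKernel)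
    (π : CPTensor d r I × ℝ → CPTensor d r I × ℝ) (A : ModeMatrices P I)
    (z : CPTensor d r I × ℝ) : TensorRKHS r κ P :=
  labelledFeature κ (project A (π z).1, (π z).2)

theorem opensMeasurableSpace_projection_sample_observation {P : Fin d → ℕ} {n : ℕ} :
    OpensMeasurableSpace
      ((ModeMatrices P I × (Fin n → CPTensor d r I × ℝ)) × (CPTensor d r I × ℝ)) := by
  have h1 : OpensMeasurableSpace (Fin n → CPTensor d r I × ℝ) := inferInstance
  have h2 : OpensMeasurableSpace (ModeMatrices P I) := inferInstance
  have h3 : SecondCountableTopology (Fin n → CPTensor d r I × ℝ) := inferInstance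
  have h4 : OpensMeasurableSpace (ModeMatrices P I × (Fin n → CPTensor d r I × ℝ)) :=
    Prod.opensMeasurableSpace
  have h5 : OpensMeasurableSpace (CPTensor d r I × ℝ) := inferInstance
  exact Prod.opensMeasurableSpace

theorem measurable_svmLoss_projectedFeature
    (hL : ∀ j, LipschitzOnWith (L j) (κ j).profile (κ j).form.range) {P : Fin d → ℕ} {n : ℕ}
    {lam : ℝ} (hlam : 0 < lam) {π : CPTensor d r I × ℝ → CPTensor d r I × ℝ}
    (hπ : Measurable π) :
    Measurable fun p : (ModeMatrices P I × (Fin n → CPTensor d r I × ℝ)) × (CPTensor d r I × ℝ) =>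
      svmLoss lam (projectedFeature κ π p.1.1) p.1.2 p.2 := by
  have hmap : Measurable fun p :
      (ModeMatrices P I × (Fin n → CPTensor d r I × ℝ)) × (CPTensor d r I × ℝ) =>
      (((p.1.1, fun i => π (p.1.2 i)), π p.2) :
        (ModeMatrices P I × (Fin n → CPTensor d r I × ℝ)) × (CPTensor d r I × ℝ)) := by
    refine ((measurable_fst.comp measurable_fst).prodMk (measurable_pi_iff.2 fun i => ?_)).prodMk
      (hπ.comp measurable_snd)
    exact hπ.comp ((measurable_pi_apply i).comp (measurable_snd.comp measurable_fst))
  have := opensMeasurableSpace_projection_sample_observation (r := r) (I := I) (P := P) (n := n)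
  have hc := (continuous_svmLoss_project (n := n) (P := P) (I := I) (r := r) hL hlam).measurable
  have h := hc.comp hmap
  simp only [Function.comp_def] at h
  unfold svmLoss projectedFeature
  exact h

theorem measurable_svmLoss_projectedFeature_fixed
    (hL : ∀ j, LipschitzOnWith (L j) (κ j).profile (κ j).form.range) {P : Fin d → ℕ} {n : ℕ}
    {lam : ℝ} (hlam : 0 < lam) {π : CPTensor d r I × ℝ → CPTensor d r I × ℝ}
    (hπ : Measurable π) (A : ModeMatrices P I) :
    Measurable fun p : (Fin n → CPTensor d r I × ℝ) × (CPTensor d r I × ℝ) =>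
      svmLoss lam (projectedFeature κ π A) p.1 p.2 := by
  have h1 := measurable_svmLoss_projectedFeature (P := P) (n := n) hL hlam hπ
  have h2 : Measurable fun p : (Fin n → CPTensor d r I × ℝ) × (CPTensor d r I × ℝ) =>
      ((A, p.1), p.2) := (measurable_const.prodMk measurable_fst).prodMk measurable_snd
  have h := h1.comp h2
  simp only [Function.comp_def] at h
  exact h

theorem measurable_generalizationGap_projectedFeature
    (hL : ∀ j, LipschitzOnWith (L j) (κ j).profile (κ j).form.range) {P : Fin d → ℕ} {n : ℕ}
    {lam : ℝ} (hlam : 0 < lam) {π : CPTensor d r I × ℝ → CPTensor d r I × ℝ}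
    (hπ : Measurable π) {q : CPTensor d r I × ℝ → ℝ} (hq : Measurable q) :
    Measurable fun ω : ModeMatrices P I × (Fin n → CPTensor d r I × ℝ) =>
      generalizationGap ρ n lam (projectedFeature κ π ω.1) q ω.2 := by
  have h1 := measurable_svmLoss_projectedFeature (P := P) (n := n) hL hlam hπ
  unfold generalizationGap
  refine (Measurable.sub ?_ (Measurable.const_mul (Finset.measurable_sum _ fun i _ => ?_) _)).add
    (Measurable.sub_const (Measurable.const_mul (Finset.measurable_sum _ fun i _ => ?_) _) _)
  · exact h1.stronglyMeasurable.integral_prod_right.measurable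
  · have h2 : Measurable fun ω : ModeMatrices P I × (Fin n → CPTensor d r I × ℝ) =>
        (ω, ω.2 i) := measurable_id.prodMk ((measurable_pi_apply i).comp measurable_snd)
    have h := h1.comp h2
    simp only [Function.comp_def] at h
    exact h
  · exact hq.comp ((measurable_pi_apply i).comp measurable_snd)

theorem norm_projectedFeature_le {B M θ : ℝ}
    (hM : ∀ (I : Fin d → ℕ) (z : CPTensor d r I × ℝ), (z.2 = 1 ∨ z.2 = -1) →
      (∀ j k, ‖z.1 j k‖ ^ 2 ≤ B) → ‖labelledFeature κ z‖ ≤ M)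
    {B' : ℝ} {π : CPTensor d r I × ℝ → CPTensor d r I × ℝ} (hπ : ∀ z, IsAdmissible B' (π z))
    (hθ : 0 ≤ θ) (hB : (1 + θ) * |B'| ≤ B) {P : Fin d → ℕ} {A : ModeMatrices P I}
    (hA : ∀ j, IsNearIsometry θ (modeMap A j)) (z : CPTensor d r I × ℝ) :
    ‖projectedFeature κ π A z‖ ≤ M := by
  refine hM P _ (hπ z).1 fun j k => ?_
  simp only [project_apply]
  refine ((hA j _).2.trans (mul_le_mul_of_nonneg_left ?_ (by linarith))).trans hB
  exact ((hπ z).2 j k).trans (le_abs_self _)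

theorem lintegral_ofReal_eq_ofReal_integral {X : Type*} [MeasurableSpace X] {μ : Measure X}
    [IsProbabilityMeasure μ] {q : X → ℝ} (hq : Measurable q) {M : ℝ}
    (h : ∀ z, 0 ≤ q z ∧ q z ≤ M) :
    ∫⁻ z, ENNReal.ofReal (q z) ∂μ = ENNReal.ofReal (∫ z, q z ∂μ) := by
  refine (ofReal_integral_eq_lintegral_ofReal (integrable_of_measurable_of_abs_le hq (M := M)
    fun z => ?_) (Filter.Eventually.of_forall fun z => (h z).1)).symm
  rw [abs_of_nonneg (h z).1]
  exact (h z).2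

/-- If the generalization gap is below `v`, the excess risk is controlled. -/
theorem excessRiskAtMost_of_generalizationGap_lt {P : Fin d → ℕ} {A : ModeMatrices P I} {n : ℕ}
    {T : Fin n → CPTensor d r I × ℝ} {lam X M C τ v : ℝ} (hlam : 0 < lam) (hC : 0 < C)
    {π : CPTensor d r I × ℝ → CPTensor d r I × ℝ} (hπ : ∀ᵐ z ∂ρ, π z = z)
    (hT : ∀ i, π (T i) = T i)
    (hψ : ∀ z, ‖projectedFeature κ π A z‖ ≤ M)
    (hmeas : Measurable (svmLoss lam (projectedFeature κ π A) T)) {f : TensorRKHS r κ I}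
    {q : CPTensor d r I × ℝ → ℝ} (hq : ∀ z, q z = hinge 1 ⟪labelledFeature κ (π z), f⟫_ℝ)
    (hqm : Measurable q) {Mq : ℝ} (hqM : ∀ z, q z ≤ Mq)
    (hf : risk ρ f + ENNReal.ofReal (C * lam * ‖f‖ ^ 2) ≤ bayesRisk ρ + ENNReal.ofReal X)
    (hX : 0 ≤ X)
    (hcmp : svmObjective lam (fun i => labelledFeature κ (project A (T i).1, (T i).2))
          (svm lam fun i => labelledFeature κ (project A (T i).1, (T i).2)) ≤
        svmObjective (C * lam) (fun i => labelledFeature κ (T i)) f + τ)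
    (hgap : generalizationGap ρ n lam (projectedFeature κ π A) q T < v) :
    ExcessRiskAtMost κ ρ A T lam (X + τ + v) := by
  refine excessRiskAtMost_of_svm κ hlam ?_
  have hψT : (fun i => projectedFeature κ π A (T i)) =
      fun i => labelledFeature κ (project A (T i).1, (T i).2) := by
    ext1 i
    rw [projectedFeature, hT i]
  have e1 : ∫⁻ z, ENNReal.ofReal (hinge 1 ⟪labelledFeature κ (project A z.1, z.2),
      svm lam fun i => labelledFeature κ (project A (T i).1, (T i).2)⟫_ℝ) ∂ρ =
      ∫⁻ z, ENNReal.ofReal (svmLoss lam (projectedFeature κ π A) T z) ∂ρ := by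
    refine lintegral_congr_ae ?_
    filter_upwards [hπ] with z hz
    rw [svmLoss, hψT, projectedFeature, hz]
  have e2 : risk ρ f = ∫⁻ z, ENNReal.ofReal (q z) ∂ρ := by
    refine lintegral_congr_ae ?_
    filter_upwards [hπ] with z hz
    rw [hq, hz, hinge_inner_labelledFeature]
  have hb : bayesRisk ρ ≠ ⊤ := ((bayesRisk_le_one ρ).trans_lt ENNReal.one_lt_top).ne
  have hq0 : ∀ z, 0 ≤ q z := fun z => by rw [hq]; exact hinge_nonneg _ _
  rw [e2, lintegral_ofReal_eq_ofReal_integral hqm fun z => ⟨hq0 z, hqM z⟩,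
    ← ENNReal.ofReal_add (integral_nonneg hq0) (by positivity), ← ENNReal.ofReal_toReal hb,
    ← ENNReal.ofReal_add ENNReal.toReal_nonneg hX,
    ENNReal.ofReal_le_ofReal_iff (by positivity)] at hf
  rw [e1, lintegral_ofReal_eq_ofReal_integral hmeas
    fun z => ⟨svmLoss_nonneg _ _, svmLoss_le hlam hψ T z⟩]
  nth_rewrite 1 [← ENNReal.ofReal_toReal hb]
  have hmain : ∫ z, svmLoss lam (projectedFeature κ π A) T z ∂ρ ≤
      (bayesRisk ρ).toReal + (X + τ + v) := by
    have hs : ∀ i, svmLoss lam (projectedFeature κ π A) T (T i) =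
        hinge 1 ⟪labelledFeature κ (project A (T i).1, (T i).2),
          svm lam fun i => labelledFeature κ (project A (T i).1, (T i).2)⟫_ℝ := fun i => by
      rw [svmLoss, hψT, projectedFeature, hT i]
    have hq' : ∀ i, q (T i) = hinge 1 ⟪labelledFeature κ (T i), f⟫_ℝ := fun i => by
      rw [hq, hT i]
    simp only [generalizationGap, hs, hq'] at hgap
    simp only [svmObjective] at hcmp
    have : 0 ≤ lam * ‖svm lam fun i => labelledFeature κ (project A (T i).1, (T i).2)‖ ^ 2 := by
      positivity
    linarith
  refine (ENNReal.ofReal_le_ofReal hmain).trans ENNReal.ofReal_add_le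

/-- The set `Z` need not be measurable. It is covered by the bad projections, the null set of
samples moved by `π`, and the part of `W` over the good projections, which is estimated by Fubini.
-/
theorem jointLaw_not_le {P : Fin d → ℕ} {n : ℕ} {S : Set (ModeMatrices P I)}
    (hS : MeasurableSet S) {W : Set (ModeMatrices P I × (Fin n → CPTensor d r I × ℝ))}
    (hW : MeasurableSet W) {δ : ℝ≥0∞}
    (hWδ : ∀ A ∈ S, (Measure.pi fun _ : Fin n => ρ) (Prod.mk A ⁻¹' W) ≤ δ)
    {π : CPTensor d r I × ℝ → CPTensor d r I × ℝ} (hπ : ∀ᵐ z ∂ρ, π z = z)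
    {Z : Set (ModeMatrices P I × (Fin n → CPTensor d r I × ℝ))}
    (hZ : ∀ A ∈ S, ∀ T, (∀ i, π (T i) = T i) → (A, T) ∉ W → (A, T) ∉ Z) :
    jointLaw P I ρ n Z ≤ projectionLaw P I Sᶜ + δ * projectionLaw P I S := by
  set N : Set (Fin n → CPTensor d r I × ℝ) := {T | ∃ i, π (T i) ≠ T i} with hN
  have hN0 : (Measure.pi fun _ : Fin n => ρ) N = 0 := by
    have : ∀ i : Fin n, ∀ᵐ T ∂(Measure.pi fun _ : Fin n => ρ), π (T i) = T i := fun i =>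
      (measurePreserving_eval (fun _ : Fin n => ρ) i).quasiMeasurePreserving.ae hπ
    have h2 := ae_all_iff.2 this
    rw [ae_iff] at h2
    simpa [hN] using h2
  have hsub : Z ⊆ (Sᶜ ×ˢ Set.univ) ∪ (Set.univ ×ˢ N) ∪ (W ∩ S ×ˢ Set.univ) := by
    rintro ⟨A, T⟩ hAT
    by_cases hA : A ∈ S
    · by_cases hT : T ∈ N
      · exact Or.inl (Or.inr ⟨trivial, hT⟩)
      · refine Or.inr ⟨?_, hA, trivial⟩
        by_contra hWn
        exact hZ A hA T (by simpa [hN] using hT) hWn hAT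
    · exact Or.inl (Or.inl ⟨hA, trivial⟩)
  refine (measure_mono hsub).trans ((measure_union_le _ _).trans (add_le_add
    ((measure_union_le _ _).trans ?_) ?_))
  · rw [jointLaw, Measure.prod_prod, Measure.prod_prod, hN0, measure_univ]
    simp
  · rw [jointLaw, Measure.prod_apply (hW.inter (hS.prod MeasurableSet.univ)),
      ← lintegral_indicator_const hS]
    refine lintegral_mono fun A => ?_
    by_cases hA : A ∈ S
    · simp only [hA, Set.indicator_of_mem]
      exact (measure_mono fun T hT => hT.1).trans (hWδ A hA)
    · have : Prod.mk A ⁻¹' (W ∩ S ×ˢ Set.univ) = ∅ := by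
        ext T
        simp [hA]
      simp [this]

/-- The excess risk bound for a fixed sample size: outside of an event of small probability the
excess risk is at most the approximation error, a multiple of the Gaussian tail divided by `lam`,
and the stability bound. -/
theorem exists_jointLaw_excessRisk_le (I : Fin d → ℕ)
    (ρ : Measure (CPTensor d r I × ℝ)) [IsProbabilityMeasure ρ]
    (hL : ∀ j, LipschitzOnWith (L j) (κ j).profile (κ j).form.range) {B : ℝ}
    (hρ : ∀ᵐ z ∂ρ, IsAdmissible B z) :
    ∃ C : ℝ, 1 ≤ C ∧ ∀ K : ℝ, 0 ≤ K → ∃ M : ℝ, 0 ≤ M ∧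
      ∀ (P : Fin d → ℕ) (S : Set (ModeMatrices P I)) (θ : ℝ), MeasurableSet S → 0 < θ →
        θ ≤ 1 / 2 → (∀ A ∈ S, ∀ j, IsNearIsometry θ (modeMap A j)) →
      ∀ (n : ℕ) (lam X δ : ℝ), 0 < n → 0 < lam → lam ≤ 1 → 0 ≤ X → X ≤ K → 0 < δ → δ < 1 →
        approxError κ ρ (C * lam) < ENNReal.ofReal X →
        jointLaw P I ρ n {ω | ¬ ExcessRiskAtMost κ ρ ω.1 ω.2 lam
          (X + gaussianTail θ * (r : ℝ) ^ 2 / (4 * lam) +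
            (M / (lam * n) + M / (lam * √n) * √(Real.log (2 / δ))))} ≤
          projectionLaw P I Sᶜ + ENNReal.ofReal δ * projectionLaw P I S := by
  obtain ⟨C, hC, hcmp⟩ := exists_svmObjective_project_le r I hL B
  obtain ⟨M₀, hM₀, hM₀le⟩ := exists_norm_labelledFeature_le r hL B
  -- Projected factors have squared norm at most `(1 + θ) |B| ≤ 2 |B|`.
  obtain ⟨M₁, hM₁, hM₁le⟩ := exists_norm_labelledFeature_le r hL (2 * |B|)
  obtain ⟨π, hπm, hπB, hπ⟩ := exists_admissible_retraction hρ
  -- `C` is fixed before `K`, since the bound on the approximation error at `C * lam` depends on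
  -- `C`. The constant `M` depends on `K` through the norm bound for the comparison function `f`.
  refine ⟨C, hC, fun K hK => ?_⟩
  set b₀ : ℝ := 2 * M₁ ^ 2 + 2 + M₁ + M₀ * √(1 + K) with hb₀
  have hb₀0 : 0 < b₀ := by positivity
  refine ⟨M₁ ^ 2 + √2 * b₀, by positivity, ?_⟩
  intro P S θ hS hθ hθ' hSA n lam X δ hn hlam hlam1 hX hXK hδ hδ1 hD
  obtain ⟨f, hf⟩ := exists_risk_add_le_of_approxError_lt hD
  have hnr : (0 : ℝ) < n := by exact_mod_cast hn
  have hCpos : 0 < C := by linarith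
  let q : CPTensor d r I × ℝ → ℝ := fun z => hinge 1 ⟪labelledFeature κ (π z), f⟫_ℝ
  have hqm : Measurable q := by
    have hc : Continuous fun z : CPTensor d r I × ℝ => hinge 1 ⟪labelledFeature κ z, f⟫_ℝ :=
      continuous_hinge_one.comp ((continuous_labelledFeature hL).inner continuous_const)
    exact hc.measurable.comp hπm
  have hfn : ‖f‖ ≤ √(1 + K) / √lam := by
    have h1 : ENNReal.ofReal (C * lam * ‖f‖ ^ 2) ≤ ENNReal.ofReal (1 + X) := by
      refine (le_add_self.trans hf).trans ?_
      rw [ENNReal.ofReal_add zero_le_one hX, ENNReal.ofReal_one]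
      exact add_le_add_left (bayesRisk_le_one ρ) _
    rw [ENNReal.ofReal_le_ofReal_iff (by positivity)] at h1
    rw [← Real.sqrt_div (by positivity)]
    refine Real.le_sqrt_of_sq_le ?_
    rw [le_div_iff₀ hlam]
    have h2 : 1 * (lam * ‖f‖ ^ 2) ≤ C * (lam * ‖f‖ ^ 2) :=
      mul_le_mul_of_nonneg_right hC (by positivity)
    linarith
  have hsl : 0 < √lam := Real.sqrt_pos.2 hlam
  have hsl1 : 1 / √lam ≤ 1 / lam := by
    refine one_div_le_one_div_of_le hlam (Real.le_sqrt_of_sq_le ?_)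
    nlinarith
  have hl1 : 1 ≤ 1 / lam := by rwa [le_div_iff₀ hlam, one_mul]
  set Mq : ℝ := 1 + M₀ * (√(1 + K) / √lam) with hMq
  have hqM : ∀ z, 0 ≤ q z ∧ q z ≤ Mq := by
    intro z
    refine ⟨hinge_nonneg _ _, (hinge_one_le _).trans ?_⟩
    have h1 := abs_real_inner_le_norm (labelledFeature κ (π z)) f
    have h2 := mul_le_mul (hM₀le I (π z) (hπB z).1 (hπB z).2) hfn (norm_nonneg _) hM₀
    linarith
  set b : ℝ := b₀ / (lam * n) with hb
  have hbb : 2 * (M₁ ^ 2 / (lam * n)) + (1 + M₁ / √lam + Mq) / n ≤ b := by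
    have h1 : M₁ / √lam ≤ M₁ * (1 / lam) := by
      rw [div_eq_mul_one_div]
      exact mul_le_mul_of_nonneg_left hsl1 hM₁
    have h2 : M₀ * (√(1 + K) / √lam) ≤ M₀ * √(1 + K) * (1 / lam) := by
      rw [div_eq_mul_one_div, ← mul_assoc]
      exact mul_le_mul_of_nonneg_left hsl1 (by positivity)
    have h3 : (1 + M₁ / √lam + Mq) / n ≤ ((2 + M₁ + M₀ * √(1 + K)) * (1 / lam)) / n := by
      gcongr
      rw [hMq]
      linarith
    have h4 : b = 2 * (M₁ ^ 2 / (lam * n)) + ((2 + M₁ + M₀ * √(1 + K)) * (1 / lam)) / n := by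
      rw [hb, hb₀]
      field_simp
      ring
    rw [h4]
    linarith
  have hbpos : 0 < b := by positivity
  -- With this `t` the concentration bound equals `δ / 2`.
  set t : ℝ := b * √(2 * n) * √(Real.log (2 / δ)) with ht
  have ht0 : 0 ≤ t := by positivity
  have hlog : 0 < Real.log (2 / δ) := Real.log_pos (by rw [lt_div_iff₀ hδ]; linarith)
  have hexp : Real.exp (-t ^ 2 / (2 * (n * b ^ 2))) ≤ δ := by
    have e : -t ^ 2 / (2 * (n * b ^ 2)) = -Real.log (2 / δ) := by
      rw [ht, mul_pow, mul_pow, Real.sq_sqrt (by positivity), Real.sq_sqrt hlog.le]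
      field_simp
    rw [e, Real.exp_neg, Real.exp_log (by positivity), inv_div]
    linarith
  set v : ℝ := M₁ ^ 2 / (lam * n) + t with hv
  have hmeas2 := fun A : ModeMatrices P I =>
    measurable_svmLoss_projectedFeature_fixed (κ := κ) (n := n) hL hlam hπm A
  let W : Set (ModeMatrices P I × (Fin n → CPTensor d r I × ℝ)) :=
    {ω | v ≤ generalizationGap ρ n lam (projectedFeature κ π ω.1) q ω.2}
  have hW : MeasurableSet W := measurableSet_le measurable_const
    (measurable_generalizationGap_projectedFeature hL hlam hπm hqm)
  have hψ : ∀ A ∈ S, ∀ z, ‖projectedFeature κ π A z‖ ≤ M₁ := fun A hA z =>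
    norm_projectedFeature_le hM₁le hπB hθ.le
      (mul_le_mul_of_nonneg_right (by linarith) (abs_nonneg _)) (hSA A hA) z
  refine jointLaw_not_le hS hW (fun A hA => ?_) hπ fun A hA T hT hAT => ?_
  · have h := measure_generalizationGap_ge_le ρ hn hlam (hψ A hA) (hmeas2 A) hqm hqM ht0 hbb
    rw [← ENNReal.ofReal_toReal (measure_ne_top (Measure.pi fun _ : Fin n => ρ) _)]
    exact ENNReal.ofReal_le_ofReal (h.trans hexp)
  · simp only [Set.mem_ofPred_eq, not_not]
    have hTB : ∀ i, IsAdmissible B (T i) := fun i => by rw [← hT i]; exact hπB _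
    have hm : Measurable (svmLoss lam (projectedFeature κ π A) T) := by
      have h := (hmeas2 A).comp (measurable_prodMk_left (x := T))
      simp only [Function.comp_def] at h
      exact h
    have hgap : generalizationGap ρ n lam (projectedFeature κ π A) q T < v := not_le.1 hAT
    have h := excessRiskAtMost_of_generalizationGap_lt hlam hCpos hπ hT (hψ A hA)
      hm (fun z => rfl) hqm (fun z => (hqM z).2) hf hX
      (hcmp P A θ hθ hθ' (hSA A hA) n hn T (fun i => (hTB i).1) (fun i => (hTB i).2) lam hlam f)
      hgap
    refine ⟨h.1, fun g hg => (h.2 g hg).trans (add_le_add_right (ENNReal.ofReal_le_ofReal ?_) _)⟩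
    have e1 : t = √2 * b₀ / (lam * √n) * √(Real.log (2 / δ)) := by
      rw [ht, hb, Real.sqrt_mul (by norm_num)]
      have := Real.mul_self_sqrt hnr.le
      have hs : √(n : ℝ) ≠ 0 := (Real.sqrt_pos.2 hnr).ne'
      congr 1
      rw [div_mul_eq_mul_div, div_eq_div_iff (by positivity) (by positivity)]
      linear_combination (√2 * b₀ * lam) * this
    have h2 : M₁ ^ 2 / (lam * n) ≤ (M₁ ^ 2 + √2 * b₀) / (lam * n) := by
      gcongr
      linarith [mul_nonneg (Real.sqrt_nonneg 2) hb₀0.le]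
    have h3 : t ≤ (M₁ ^ 2 + √2 * b₀) / (lam * √n) * √(Real.log (2 / δ)) := by
      rw [e1]
      gcongr
      linarith [sq_nonneg M₁]
    linarith

end FixedSampleSize

/-! ### The orders of magnitude of the parameters -/

section Parameters

variable {η μ : ℝ} {n : ℕ}

theorem regParam_pos (hn : 0 < n) : 0 < regParam η μ n :=
  Real.rpow_pos_of_pos (by positivity) _

theorem one_div_natCast_le_one (hn : 0 < n) : 1 / (n : ℝ) ≤ 1 := by
  rw [div_le_one (by exact_mod_cast hn)]
  exact_mod_cast hn

theorem regParam_le_one (hη : 0 < η) (hμ : 0 < μ) (hn : 0 < n) : regParam η μ n ≤ 1 :=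
  Real.rpow_le_one (by positivity) (one_div_natCast_le_one hn) (by positivity)

theorem projError_pos (d : ℕ) (hn : 0 < n) : 0 < projError d μ n :=
  Real.rpow_pos_of_pos (by positivity) _

theorem regParam_rpow (n : ℕ) :
    regParam η μ n ^ η = (1 / (n : ℝ)) ^ (μ * η / (2 * η + 2)) := by
  rw [regParam, ← Real.rpow_mul (by positivity)]
  congr 1
  ring

/-- The projection error has exactly the target order: `μ / 2 - μ / (2 η + 2) = μ η / (2 η + 2)`. -/
theorem projError_pow_div_regParam (hη : 0 < η) {d : ℕ} (hd : 0 < d) (hn : 0 < n) :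
    projError d μ n ^ d / regParam η μ n = (1 / (n : ℝ)) ^ (μ * η / (2 * η + 2)) := by
  have hd' : (d : ℝ) ≠ 0 := by exact_mod_cast hd.ne'
  rw [projError, regParam, ← Real.rpow_natCast, ← Real.rpow_mul (by positivity),
    ← Real.rpow_sub (by positivity)]
  congr 1
  field_simp
  ring

/-- The exponent on the left is `1 / 2 - μ / (2 η + 2)`; replacing `1 / 2` by the smaller `μ / 2`
gives the target exponent. -/
theorem one_div_regParam_mul_sqrt_le (hη : 0 < η) (hμ : μ < 1) (hn : 0 < n) :
    1 / (regParam η μ n * √n) ≤ (1 / (n : ℝ)) ^ (μ * η / (2 * η + 2)) := by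
  have hnr : (0 : ℝ) < n := by exact_mod_cast hn
  have e : 1 / (regParam η μ n * √n) = (1 / (n : ℝ)) ^ (1 / 2 - μ / (2 * η + 2)) := by
    rw [Real.rpow_sub (by positivity), ← Real.sqrt_eq_rpow, Real.sqrt_div zero_le_one,
      Real.sqrt_one, regParam]
    field_simp
  rw [e]
  refine Real.rpow_le_rpow_of_exponent_ge (by positivity) (one_div_natCast_le_one hn) ?_
  have : μ * η / (2 * η + 2) + μ / (2 * η + 2) = μ / 2 := by
    field_simp
  linarith

theorem one_div_regParam_mul_le (hη : 0 < η) (hμ : μ < 1) (hn : 0 < n) :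
    1 / (regParam η μ n * n) ≤ (1 / (n : ℝ)) ^ (μ * η / (2 * η + 2)) := by
  refine le_trans ?_ (one_div_regParam_mul_sqrt_le hη hμ hn)
  have hnr : (1 : ℝ) ≤ n := by exact_mod_cast hn
  have hs : 0 < √(n : ℝ) := Real.sqrt_pos.2 (by linarith)
  have := regParam_pos (η := η) (μ := μ) hn
  refine one_div_le_one_div_of_le (by positivity) (mul_le_mul_of_nonneg_left ?_ this.le)
  rw [Real.sqrt_le_left (by linarith)]
  nlinarith

/-- Terms of the risk bound without the confidence factor are absorbed into it at the cost of a
factor 2. -/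
theorem half_le_sqrt_log_two_div {δ : ℝ} (hδ : 0 < δ) (hδ' : δ < 1) :
    1 / 2 ≤ √(Real.log (2 / δ)) := by
  refine Real.le_sqrt_of_sq_le ?_
  have h1 : Real.log 2 ≤ Real.log (2 / δ) := by
    refine Real.log_le_log (by norm_num) ?_
    rw [le_div_iff₀ hδ]
    linarith
  have := Real.log_two_gt_d9
  norm_num at this ⊢
  linarith

theorem eventually_projError_le_half {d : ℕ} (hd : 0 < d) (hμ : 0 < μ) :
    ∀ᶠ n : ℕ in Filter.atTop, projError d μ n ≤ 1 / 2 := by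
  have h : Filter.Tendsto (fun n : ℕ => projError d μ n) Filter.atTop (nhds 0) := by
    have h1 : Filter.Tendsto (fun n : ℕ => ((n : ℝ) ^ (-(μ / (2 * d))))) Filter.atTop (nhds 0) :=
      (tendsto_rpow_neg_atTop (by positivity)).comp tendsto_natCast_atTop_atTop
    refine h1.congr fun n => ?_
    rw [projError, one_div, Real.inv_rpow (by positivity), Real.rpow_neg (by positivity)]
  exact (h.eventually (gt_mem_nhds (by norm_num : (0 : ℝ) < 1 / 2))).mono fun n hn => hn.le

/-- The product `P ε²` is at least `(log n) ^ (1 / d)`, which tends to infinity. This is where the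
threshold on `n` acquires its dependence on `δ₁`. -/
theorem eventually_div_projDim_mul_le {d r : ℕ} (hd : 0 < d) (hr : 0 < r) {c δ₁ : ℝ}
    (hδ : 0 < δ₁) (hδ' : δ₁ < 1 / 2) :
    ∀ᶠ n : ℕ in Filter.atTop, c / (projDim d r μ δ₁ n * projError d μ n ^ 2) ≤ 2 * δ₁ := by
  have h : Filter.Tendsto (fun n : ℕ => Real.log n ^ (1 / (d : ℝ))) Filter.atTop Filter.atTop :=
    (tendsto_rpow_atTop (by positivity)).comp
      (Real.tendsto_log_atTop.comp tendsto_natCast_atTop_atTop)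
  filter_upwards [h.eventually_ge_atTop (max 1 (c / (2 * δ₁))), Filter.eventually_gt_atTop 0]
    with n hn hn0
  have hnr : (1 : ℝ) ≤ n := by exact_mod_cast hn0
  have hθ := projError_pos (μ := μ) d hn0
  have hr1 : (1 : ℝ) ≤ (r : ℝ) ^ (2 / (d : ℝ)) :=
    Real.one_le_rpow (by exact_mod_cast hr) (by positivity)
  have hlog : Real.log n ^ (1 / (d : ℝ)) ≤ Real.log (n / δ₁) ^ (1 / (d : ℝ)) := by
    refine Real.rpow_le_rpow (Real.log_nonneg hnr) ?_ (by positivity)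
    refine Real.log_le_log (by linarith) ?_
    rw [le_div_iff₀ hδ]
    nlinarith
  have hP : 3 * (r : ℝ) ^ (2 / (d : ℝ)) * (projError d μ n ^ 2)⁻¹ *
      Real.log (n / δ₁) ^ (1 / (d : ℝ)) ≤ projDim d r μ δ₁ n := by
    refine (Nat.le_ceil _).trans ?_
    rw [projDim]
    push_cast
    linarith
  have hl1 := (le_max_left _ _).trans hn
  have hl2 := (le_max_right _ _).trans hn
  have h1 : Real.log n ^ (1 / (d : ℝ)) ≤ projDim d r μ δ₁ n * projError d μ n ^ 2 := by
    have h2 := mul_le_mul_of_nonneg_right hP (sq_nonneg (projError d μ n))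
    have h3 : 3 * (r : ℝ) ^ (2 / (d : ℝ)) * (projError d μ n ^ 2)⁻¹ *
        Real.log (n / δ₁) ^ (1 / (d : ℝ)) * projError d μ n ^ 2 =
        3 * (r : ℝ) ^ (2 / (d : ℝ)) * Real.log (n / δ₁) ^ (1 / (d : ℝ)) := by
      field_simp
    rw [h3] at h2
    refine hlog.trans (le_trans ?_ h2)
    exact le_mul_of_one_le_left (by linarith) (by linarith)
  rw [div_le_iff₀ (by linarith)]
  rw [div_le_iff₀ (by positivity)] at hl2
  nlinarith

end Parameters

/-! ### The rate -/

section Rate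

variable {d r : ℕ} {κ : Fin d → ModeKernel} {I : Fin d → ℕ} {L : Fin d → ℝ≥0}
  {ρ : Measure (CPTensor d r I × ℝ)}

theorem ExcessRiskAtMost.mono {P : Fin d → ℕ} {n : ℕ} {A : ModeMatrices P I}
    {T : Fin n → CPTensor d r I × ℝ} {lam b b' : ℝ} (h : ExcessRiskAtMost κ ρ A T lam b)
    (hb : b ≤ b') : ExcessRiskAtMost κ ρ A T lam b' :=
  ⟨h.1, fun g hg => (h.2 g hg).trans (add_le_add_right (ENNReal.ofReal_le_ofReal hb) _)⟩

theorem jointLaw_not_excessRiskAtMost_mono {P : Fin d → ℕ} {n : ℕ} {lam b b' : ℝ} (hb : b ≤ b') :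
    jointLaw P I ρ n {ω | ¬ ExcessRiskAtMost κ ρ ω.1 ω.2 lam b'} ≤
      jointLaw P I ρ n {ω | ¬ ExcessRiskAtMost κ ρ ω.1 ω.2 lam b} :=
  measure_mono fun _ h h' => h (h'.mono hb)

theorem measure_compl_add_mul_le {X : Type*} [MeasurableSpace X] {m : Measure X}
    [IsProbabilityMeasure m] {S : Set X} (hS : MeasurableSet S) {a δ : ℝ} (ha : 0 ≤ a)
    (hδ : 0 < δ) (hδ' : δ < 1) (h : m Sᶜ ≤ ENNReal.ofReal a) :
    m Sᶜ + ENNReal.ofReal δ * m S ≤ ENNReal.ofReal (1 - (1 - a) * (1 - δ)) := by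
  have h1 : m.real Sᶜ = 1 - m.real S := probReal_compl_eq_one_sub hS
  have h2 : m.real Sᶜ ≤ a := ENNReal.toReal_le_of_le_ofReal ha h
  rw [← ofReal_measureReal (s := Sᶜ), ← ofReal_measureReal (s := S),
    ← ENNReal.ofReal_mul hδ.le, ← ENNReal.ofReal_add measureReal_nonneg (by positivity)]
  refine ENNReal.ofReal_le_ofReal ?_
  nlinarith

theorem exists_eventually_hingeRateHolds [IsProbabilityMeasure ρ] (hd : 0 < d) (hr : 0 < r)
    (hL : ∀ j, LipschitzOnWith (L j) (κ j).profile (κ j).form.range) {B : ℝ}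
    (hρ : ∀ᵐ z ∂ρ, IsAdmissible B z) {η μ c : ℝ} (hη : 0 < η) (hμ : 0 < μ) (hμ' : μ < 1)
    (hD : ∀ lam : ℝ, 0 < lam → approxError κ ρ lam ≤ ENNReal.ofReal (c * lam ^ η)) :
    ∃ C : ℝ, 0 < C ∧ ∀ δ₁ : ℝ, 0 < δ₁ → δ₁ < 1 / 2 → ∃ N : ℕ, ∀ n : ℕ, 1 ≤ n → N ≤ n →
      ∀ δ₂ : ℝ, 0 < δ₂ → δ₂ < 1 → HingeRateHolds κ ρ η μ C δ₁ δ₂ n := by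
  obtain ⟨C, hC, hbound⟩ := exists_jointLaw_excessRisk_le I ρ hL hρ
  have hC0 : 0 < C := by linarith
  -- The hypothesis gives `D(C lam) ≤ |c| C ^ η lam ^ η`; the summand 1 makes the inequality strict,
  -- so a function `f` below the bound exists even if the infimum is not attained. All constants are
  -- fixed before `δ₁`.
  set K : ℝ := |c| * C ^ η + 1 with hK
  have hK1 : 1 ≤ K := by rw [hK]; linarith [mul_nonneg (abs_nonneg c) (Real.rpow_nonneg hC0.le η)]
  obtain ⟨M, hM, hbound⟩ := hbound K (by linarith)
  obtain ⟨cG, hcG, hG⟩ := exists_gaussianTail_le d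
  obtain ⟨cA, hcA, hA⟩ := exists_measure_not_isNearIsometry_le I
  set E : ℝ := K + cG * (r : ℝ) ^ 2 / 4 + M with hE
  have hE0 : 0 < E := by positivity
  refine ⟨2 * E + M, by positivity, fun δ₁ hδ₁ hδ₁' => ?_⟩
  obtain ⟨N, hN⟩ := Filter.eventually_atTop.1 ((eventually_projError_le_half hd hμ).and
    (eventually_div_projDim_mul_le (μ := μ) hd hr hδ₁ hδ₁'))
  refine ⟨N, fun n hn hNn δ₂ hδ₂ hδ₂' => ?_⟩
  obtain ⟨hθ', hPθ⟩ := hN n hNn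
  have hθ := projError_pos (μ := μ) d hn
  have hlam := regParam_pos (η := η) (μ := μ) hn
  have hlam1 := regParam_le_one hη hμ hn
  obtain ⟨S, hS, hSc, hSA⟩ := hA (projDim d r μ δ₁ n) _ (Nat.succ_pos _) hθ
  set R : ℝ := (1 / (n : ℝ)) ^ (μ * η / (2 * η + 2)) with hR
  have hR0 : 0 < R := Real.rpow_pos_of_pos (by positivity) _
  have hR1 : R ≤ 1 := Real.rpow_le_one (by positivity) (one_div_natCast_le_one hn) (by positivity)
  have hDX : approxError κ ρ (C * regParam η μ n) < ENNReal.ofReal (K * R) := by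
    refine (hD _ (by positivity)).trans_lt
      ((ENNReal.ofReal_lt_ofReal_iff (by positivity)).2 ?_)
    rw [Real.mul_rpow hC0.le hlam.le, regParam_rpow, ← hR, hK, ← mul_assoc]
    have : c * C ^ η * R ≤ |c| * C ^ η * R := by
      gcongr
      exact le_abs_self c
    linarith
  have hs := half_le_sqrt_log_two_div hδ₂ hδ₂'
  have h := hbound (fun _ => projDim d r μ δ₁ n) S _ hS hθ hθ' hSA n _ (K * R) δ₂ hn hlam hlam1
    (by positivity) (mul_le_of_le_one_right (by linarith) hR1) hδ₂ hδ₂' hDX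
  refine (jointLaw_not_excessRiskAtMost_mono ?_).trans (h.trans
    (measure_compl_add_mul_le hS (by linarith) hδ₂ hδ₂'
      (hSc.trans (ENNReal.ofReal_le_ofReal hPθ))))
  set s : ℝ := √(Real.log (2 / δ₂))
  have h1 : gaussianTail (projError d μ n) * (r : ℝ) ^ 2 / (4 * regParam η μ n) ≤
      cG * (r : ℝ) ^ 2 / 4 * R := by
    rw [hR, ← projError_pow_div_regParam (μ := μ) hη hd hn]
    have e : cG * (r : ℝ) ^ 2 / 4 * (projError d μ n ^ d / regParam η μ n) =
        cG * projError d μ n ^ d * (r : ℝ) ^ 2 / (4 * regParam η μ n) := by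
      field_simp
    rw [e]
    gcongr
    exact hG _ hθ
  have h2 : M / (regParam η μ n * n) ≤ M * R := by
    rw [div_eq_mul_one_div]
    exact mul_le_mul_of_nonneg_left (one_div_regParam_mul_le hη hμ' hn) hM
  have h3 : M / (regParam η μ n * √n) * s ≤ M * R * s := by
    refine mul_le_mul_of_nonneg_right ?_ (by linarith)
    rw [div_eq_mul_one_div]
    exact mul_le_mul_of_nonneg_left (one_div_regParam_mul_sqrt_le hη hμ' hn) hM
  have h4 : E * R ≤ 2 * E * s * R := by
    have := mul_le_mul_of_nonneg_right hs (mul_pos hE0 hR0).le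
    linarith
  have h5 : E * R = K * R + cG * (r : ℝ) ^ 2 / 4 * R + M * R := by rw [hE]; ring
  have h6 : (2 * E + M) * s * R = 2 * E * s * R + M * R * s := by ring
  rw [h6]
  linarith

/-! ### The finitely many small sample sizes. -/

/-- The sum of the squares of all entries. -/
def entrySq {P : Fin d → ℕ} (A : ModeMatrices P I) : ℝ := ∑ j, ∑ q, ∑ i, A j q i ^ 2

theorem norm_modeMap_sq_le {P : Fin d → ℕ} (A : ModeMatrices P I) (j : Fin d)
    (x : EuclideanSpace ℝ (Fin (I j))) : ‖modeMap A j x‖ ^ 2 ≤ entrySq A * ‖x‖ ^ 2 := by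
  have h1 : ‖modeMap A j x‖ ^ 2 ≤ (∑ q, ∑ i, A j q i ^ 2) * ‖x‖ ^ 2 := by
    rw [EuclideanSpace.real_norm_sq_eq, EuclideanSpace.real_norm_sq_eq, Finset.sum_mul]
    refine Finset.sum_le_sum fun q _ => ?_
    exact Finset.sum_mul_sq_le_sq_mul_sq Finset.univ (A j q) x
  refine h1.trans (mul_le_mul_of_nonneg_right ?_ (sq_nonneg _))
  exact Finset.single_le_sum (f := fun j => ∑ q, ∑ i, A j q i ^ 2)
    (fun j _ => by positivity) (Finset.mem_univ j)

theorem measurable_entrySq {P : Fin d → ℕ} :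
    Measurable (entrySq : ModeMatrices P I → ℝ) := by
  unfold entrySq
  fun_prop

theorem exists_measure_lt_le {X : Type*} [MeasurableSpace X] (m : Measure X)
    [IsProbabilityMeasure m] {φ : X → ℝ} (hφ : Measurable φ) {δ : ℝ≥0∞} (hδ : 0 < δ) :
    ∃ k : ℕ, m {x | (k : ℝ) < φ x} ≤ δ := by
  have h := tendsto_measure_iInter_atTop (μ := m) (s := fun k : ℕ => {x | (k : ℝ) < φ x})
    (fun k => (measurableSet_lt measurable_const hφ).nullMeasurableSet)
    (fun k l hkl x (hx : (l : ℝ) < φ x) => (Nat.cast_le.2 hkl).trans_lt hx) ⟨0, measure_ne_top _ _⟩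
  have e : ⋂ k : ℕ, {x | (k : ℝ) < φ x} = ∅ := by
    refine Set.eq_empty_iff_forall_notMem.2 fun x hx => ?_
    obtain ⟨k, hk⟩ := exists_nat_ge (φ x)
    exact absurd (Set.mem_iInter.1 hx k) (not_lt.2 hk)
  rw [e, measure_empty] at h
  exact (h.eventually (ge_mem_nhds hδ)).exists

/-- A bound without rate: outside an event of probability `δ` the entries of the projection are
bounded, hence so are the projected features. Since the minimizer has norm at most `1 / √lam`, its
risk is bounded for every training set. -/
theorem exists_jointLaw_not_excessRiskAtMost_le [IsProbabilityMeasure ρ]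
    (hL : ∀ j, LipschitzOnWith (L j) (κ j).profile (κ j).form.range) {B : ℝ}
    (hρ : ∀ᵐ z ∂ρ, IsAdmissible B z) (P : Fin d → ℕ) (n : ℕ) {lam : ℝ} (hlam : 0 < lam)
    {δ : ℝ≥0∞} (hδ : 0 < δ) :
    ∃ b : ℝ, 0 ≤ b ∧ jointLaw P I ρ n {ω | ¬ ExcessRiskAtMost κ ρ ω.1 ω.2 lam b} ≤ δ := by
  obtain ⟨k, hk⟩ := exists_measure_lt_le (projectionLaw P I) measurable_entrySq hδ
  obtain ⟨M, hM, hMle⟩ := exists_norm_labelledFeature_le r hL (k * |B|)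
  refine ⟨1 + M / √lam, by positivity, ?_⟩
  have hsub : {ω : ModeMatrices P I × (Fin n → CPTensor d r I × ℝ) |
      ¬ ExcessRiskAtMost κ ρ ω.1 ω.2 lam (1 + M / √lam)} ⊆
      {A | (k : ℝ) < entrySq A} ×ˢ Set.univ := by
    rintro ⟨A, T⟩ h
    refine ⟨?_, trivial⟩
    by_contra hA
    rw [Set.mem_ofPred_eq, not_lt] at hA
    refine h (excessRiskAtMost_of_svm κ hlam (le_add_left ?_))
    have hz : ∀ᵐ z ∂ρ, ENNReal.ofReal (hinge 1 ⟪labelledFeature κ (project A z.1, z.2),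
        svm lam fun i => labelledFeature κ (project A (T i).1, (T i).2)⟫_ℝ) ≤
        ENNReal.ofReal (1 + M / √lam) := by
      filter_upwards [hρ] with z hz
      refine ENNReal.ofReal_le_ofReal ((hinge_one_le _).trans ?_)
      have h1 : ‖labelledFeature κ (project A z.1, z.2)‖ ≤ M := by
        refine hMle P _ hz.1 fun j l => ?_
        simp only [project_apply]
        exact (norm_modeMap_sq_le A j _).trans (mul_le_mul hA
          ((hz.2 j l).trans (le_abs_self B)) (sq_nonneg _) (Nat.cast_nonneg k))
      have h2 := (isSVM_svm hlam fun i =>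
        labelledFeature κ (project A (T i).1, (T i).2)).norm_le hlam
      have h3 := abs_real_inner_le_norm (labelledFeature κ (project A z.1, z.2))
        (svm lam fun i => labelledFeature κ (project A (T i).1, (T i).2))
      have h4 := mul_le_mul h1 h2 (norm_nonneg _) hM
      rw [mul_one_div] at h4
      linarith
    refine (lintegral_mono_ae hz).trans ?_
    simp
  refine (measure_mono hsub).trans ?_
  rw [jointLaw, Measure.prod_prod, measure_univ, mul_one]
  exact hk

/-- For each `n < N` the crude bound is applied with exceptional probability `2 δ₁`, which is within
the allowed `1 - (1 - 2 δ₁)(1 - δ₂)` for every `δ₂`. The constant is enlarged by the finitely many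
quotients of the crude bounds by the rate. -/
theorem exists_hingeRateHolds [IsProbabilityMeasure ρ]
    (hL : ∀ j, LipschitzOnWith (L j) (κ j).profile (κ j).form.range) {B : ℝ}
    (hρ : ∀ᵐ z ∂ρ, IsAdmissible B z) {η μ C δ₁ : ℝ} {N : ℕ} (hC : 0 < C) (hδ₁ : 0 < δ₁)
    (hN : ∀ n : ℕ, 1 ≤ n → N ≤ n →
      ∀ δ₂ : ℝ, 0 < δ₂ → δ₂ < 1 → HingeRateHolds κ ρ η μ C δ₁ δ₂ n) (hδ₁' : δ₁ < 1 / 2) :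
    ∃ C : ℝ, 0 < C ∧ ∀ n : ℕ, 1 ≤ n →
      ∀ δ₂ : ℝ, 0 < δ₂ → δ₂ < 1 → HingeRateHolds κ ρ η μ C δ₁ δ₂ n := by
  have hδ : (0 : ℝ≥0∞) < ENNReal.ofReal (2 * δ₁) := ENNReal.ofReal_pos.2 (by linarith)
  choose b hb hble using fun n : {n : ℕ // 0 < n} => exists_jointLaw_not_excessRiskAtMost_le hL hρ
    (fun _ => projDim d r μ δ₁ n) n (regParam_pos (η := η) (μ := μ) n.2) hδ
  let R : ℕ → ℝ := fun n => (1 / (n : ℝ)) ^ (μ * η / (2 * η + 2))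
  let u : ℕ → ℝ := fun n => if h : 0 < n then 2 * b ⟨n, h⟩ / R n else 0
  have hR : ∀ n, 0 ≤ R n := fun n => Real.rpow_nonneg (by positivity) _
  have hu : ∀ n, 0 ≤ u n := fun n => by
    by_cases h : 0 < n
    · simp only [u, h, dif_pos]
      exact div_nonneg (mul_nonneg zero_le_two (hb _)) (hR n)
    · simp [u, h]
  have hsum := Finset.sum_nonneg fun n (_ : n ∈ Finset.range N) => hu n
  refine ⟨C + ∑ n ∈ Finset.range N, u n, by linarith, fun n hn δ₂ hδ₂ hδ₂' => ?_⟩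
  have hs := half_le_sqrt_log_two_div hδ₂ hδ₂'
  by_cases hNn : N ≤ n
  · refine (jointLaw_not_excessRiskAtMost_mono ?_).trans (hN n hn hNn δ₂ hδ₂ hδ₂')
    refine mul_le_mul_of_nonneg_right (mul_le_mul_of_nonneg_right ?_ (by linarith)) (hR n)
    linarith
  · refine (jointLaw_not_excessRiskAtMost_mono ?_).trans ((hble ⟨n, hn⟩).trans
      (ENNReal.ofReal_le_ofReal ?_))
    · have h1 : u n ≤ ∑ n ∈ Finset.range N, u n :=
        Finset.single_le_sum (fun n _ => hu n) (Finset.mem_range.2 (not_le.1 hNn))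
      have hRn : 0 < R n := Real.rpow_pos_of_pos (by positivity) _
      have h2 : u n * R n = 2 * b ⟨n, hn⟩ := by
        have h0 : 0 < n := hn
        simp only [u, h0, dif_pos]
        exact div_mul_cancel₀ _ hRn.ne'
      have h3 : u n * R n ≤ (C + ∑ n ∈ Finset.range N, u n) * R n :=
        mul_le_mul_of_nonneg_right (by linarith) hRn.le
      have h4 := mul_le_mul_of_nonneg_right hs
        ((mul_nonneg (hu n) hRn.le).trans h3)
      calc b ⟨n, hn⟩ ≤ √(Real.log (2 / δ₂)) * ((C + ∑ n ∈ Finset.range N, u n) * R n) := by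
            linarith
        _ = _ := by ring
    · nlinarith

end Rate

end

theorem mainTheorem6 (d r : ℕ) (hd : 1 ≤ d) (hr : 1 ≤ r) (I : Fin d → ℕ)
    (κ : Fin d → ModeKernel) (L : Fin d → ℝ≥0)
    (hL : ∀ j, LipschitzOnWith (L j) (κ j).profile (κ j).form.range)
    (ρ : Measure (CPTensor d r I × ℝ)) [IsProbabilityMeasure ρ]
    (hlabel : ∀ᵐ z ∂ρ, z.2 = 1 ∨ z.2 = -1)
    (B : ℝ) (hB : ∀ᵐ z ∂ρ, ∀ j k, ‖z.1 j k‖ ^ 2 ≤ B)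
    (η μ c : ℝ) (hη : 0 < η) (hη' : η ≤ 1) (hμ : 0 < μ) (hμ' : μ < 1)
    (hD : ∀ lam : ℝ, 0 < lam → approxError κ ρ lam ≤ ENNReal.ofReal (c * lam ^ η)) :
    (∃ C : ℝ, 0 < C ∧ ∀ δ₁ : ℝ, 0 < δ₁ → δ₁ < 1 / 2 → ∃ N : ℕ, ∀ n : ℕ, 1 ≤ n → N ≤ n →
      ∀ δ₂ : ℝ, 0 < δ₂ → δ₂ < 1 → HingeRateHolds κ ρ η μ C δ₁ δ₂ n) ∧
    (∀ δ₁ : ℝ, 0 < δ₁ → δ₁ < 1 / 2 → ∃ C : ℝ, 0 < C ∧ ∀ n : ℕ, 1 ≤ n →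
      ∀ δ₂ : ℝ, 0 < δ₂ → δ₂ < 1 → HingeRateHolds κ ρ η μ C δ₁ δ₂ n) := by
  have hρ : ∀ᵐ z ∂ρ, IsAdmissible B z := hlabel.and hB
  obtain ⟨C, hC, h⟩ := exists_eventually_hingeRateHolds hd hr hL hρ hη hμ hμ' hD
  refine ⟨⟨C, hC, h⟩, fun δ₁ hδ₁ hδ₁' => ?_⟩
  obtain ⟨N, hN⟩ := h δ₁ hδ₁ hδ₁'
  exact exists_hingeRateHolds hL hρ hC hδ₁ hN hδ₁'
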